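/- Let $\theta\in\mathbb R\setminus\mathbb Q$, let $g=\begin{pmatrix}a&b\\c&d\end{pmatrix}\in GL(2,\mathbb Z)$ with $c\neq0$, and put $\mu=\frac{c}{c\theta+d}$. On the Hilbert space $L^2(\mathbb R\times\mathbb Z/c\mathbb Z)$ consider, for $y=(y_1,\beta_1;y_2,\beta_2)$ in $G=(\mathbb R\times\mathbb Z/c\mathbb Z)^2$, the unitaries $$(\pi(y)u)(t,\alpha)=e^{2\pi i\left(\frac{y_1y_2}{2}+ty_2+\frac{\alpha\beta_2}{c}\right)}\,u(t+y_1,\alpha+\beta_1),$$ which satisfy $\pi(x)\pi(y)=e(x,y)\,\pi(x+y)$ for a cocycle $e$. Let $L=\mathbb Z\omega_1\oplus\mathbb Z\omega_2\subset G$ be the lattice with $\omega_1=(0,0;\frac1{c\theta+d},-1)$ and $\omega_2=(-\frac1c,-a;0,0)$, let $\mathscr B$ be the $C^*$-algebra generated by $\pi(\ell)$, $\ell\in L$, let $\mathscr B^\infty=\{\sum_{\ell\in L}a_\ell\,\pi(\ell): (a_\ell) \text{ rapidly decreasing}\}$ be its smooth subalgebra, with its natural Fréchet topology, and let $\varphi^{\mathscr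 B}(\sum a_\ell\pi(\ell))=a_0$ be its normalized trace. Consider the following two (projective) unitary representations $\varpi$ of $\mathbb R^2$ on a Hilbert space on which $\mathscr B$ acts. (1) The Heisenberg representation $\pi_w$, $w\in\mathbb R^2$, on $L^2(\mathbb R\times\mathbb Z/c\mathbb Z)$: $$(\pi_w(x)u)(t,\alpha)=e^{i\langle w,x\rangle}e^{\pi i\mu(x_1x_2+2tx_2)}u(t+x_1,\alpha).$$ (2) The unitary representation $\tilde\alpha$ on $L^2(\mathscr B,\varphi^{\mathscr B})$, the completion of $\mathscr B$ for $(a,b)\mapsto\varphi^{\mathscr B}(a^*b)$, on which $\mathscr B$ acts by left multiplication: $$\tilde\alpha_x(\pi(\ell_1\omega_1+\ell_2\omega_2))=e^{2\pi i\frac{\ell_1x_1+\ell_2x_2}{c\theta+d}}\,\pi(\ell_1\omega_1+\ell_2\omega_2).$$ Let $\Gamma\subset\mathbb C$ be open (for example an open cone), let $r>0$ and $m<-2$, and let $f\in S^m(\mathbb R^2\times\Gamma,\mathscr B^\infty)$ be a parameter-dependent symbol of order $m$ with a parameter $\lambda$ of degree $r$. That is, $f:\mathbb R^2\times\Gamma\to\mathscr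 B^\infty$ is smooth, and for every continuous seminorm $p$ of $\mathscr B^\infty$ and all multi-indices $\beta,\gamma$ there is a constant $C$ such that $$p\bigl(\partial_\xi^\beta\partial_\lambda^\gamma f(\xi,\lambda)\bigr)\le C\,(1+|\xi|+|\lambda|^{1/r})^{m-|\beta|-r|\gamma|},\qquad (\xi,\lambda)\in\mathbb R^2\times\Gamma.$$ Put $f^\vee(y,\lambda)=(2\pi)^{-2}\int_{\mathbb R^2}e^{i\langle y,\xi\rangle}f(\xi,\lambda)\,d\xi$. Then, for $\varpi=\pi_w$ (any $w\in\mathbb R^2$) and for $\varpi=\tilde\alpha$, and for every $\lambda\in\Gamma$, the integral $$\operatorname{Op}(f(\cdot,\lambda))=\int_{\mathbb R^2}f^\vee(y,\lambda)\,\varpi(y)\,dy$$ converges absolutely on every vector, and the operator $\operatorname{Op}(f(\cdot,\lambda))$ is of trace class. Moreover, as $\lambda\to\infty$ in $\Gamma$, $$\operatorname{Tr}\operatorname{Op}(f(\cdot,\lambda))=N(\varpi)\,\varphi^{\mathscr B}(f^\vee(0,\lambda))+O(\lambda^{-\infty})=N(\varpi)\,(2\pi)^{-2}\int_{\mathbb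 R^2}\varphi^{\mathscr B}(f(\xi,\lambda))\,d\xi+O(\lambda^{-\infty}),$$ where $O(\lambda^{-\infty})$ means $O(|\lambda|^{-K})$ for every $K\in\mathbb N$, with $$N(\pi_w)=|c\theta+d|,\qquad N(\tilde\alpha)=|c\theta+d|^2 .$$ -/

import Mathlib

open MeasureTheory

/-! ### Trace class operators -/

section TraceClass

variable {H : Type*} [NormedAddCommGroup H] [InnerProductSpace ℂ H]

/-- A bounded operator on a Hilbert space is of trace class if it is an absolutely convergent
sum of operators of rank at most one, `T v = ∑ₙ ⟪xₙ, v⟫ yₙ` with `∑ₙ ‖xₙ‖ ‖yₙ‖ < ∞`. -/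
def IsTraceClass (T : H →L[ℂ] H) : Prop :=
  ∃ x y : ℕ → H, Summable (fun n => ‖x n‖ * ‖y n‖) ∧
    ∀ v, HasSum (fun n => inner ℂ (x n) v • y n) (T v)

/-- The trace `∑ᵢ ⟪eᵢ, T eᵢ⟫` in an orthonormal basis of the Hilbert space. For an operator of
trace class the sum converges absolutely and does not depend on the basis. -/
noncomputable def opTrace [CompleteSpace H] (T : H →L[ℂ] H) : ℂ :=
  ∑' e : (exists_hilbertBasis ℂ H).choose, inner ℂ (e : H) (T e)

end TraceClass

/-! ### Weighted translations, as isometries of `L²` and of `ℓ²` -/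

lemma memLp_weightedComp {X : Type*} [MeasurableSpace X] {μ : Measure X}
    {c : X → ℂ} (hc : Measurable c) (hc1 : ∀ t, ‖c t‖ = 1)
    {τ : X → X} (hτ : MeasurePreserving τ μ μ) (u : Lp ℂ 2 μ) :
    MemLp (fun t => c t * u (τ t)) 2 μ :=
  ((Lp.memLp u).comp_measurePreserving hτ).of_le
    (hc.aestronglyMeasurable.mul ((Lp.aestronglyMeasurable u).comp_measurePreserving hτ))
    (Filter.Eventually.of_forall fun t => by simp [hc1])

/-- The isometry `(W u)(t) = c(t) u(τ(t))` of `L²`, for `c` of modulus one and `τ` measure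
preserving. -/
noncomputable def weightedCompL2 {X : Type*} [MeasurableSpace X] {μ : Measure X}
    (c : X → ℂ) (hc : Measurable c) (hc1 : ∀ t, ‖c t‖ = 1)
    (τ : X → X) (hτ : MeasurePreserving τ μ μ) : Lp ℂ 2 μ →ₗᵢ[ℂ] Lp ℂ 2 μ where
  toFun u := (memLp_weightedComp hc hc1 hτ u).toLp
  map_add' u v := by
    rw [← MemLp.toLp_add, MemLp.toLp_eq_toLp_iff]
    filter_upwards [hτ.quasiMeasurePreserving.ae (Lp.coeFn_add u v)] with t ht
    simp only [Pi.add_apply] at ht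
    change c t * (u + v : Lp ℂ 2 μ) (τ t) = c t * u (τ t) + c t * v (τ t)
    rw [ht, mul_add]
  map_smul' z u := by
    rw [RingHom.id_apply, ← MemLp.toLp_const_smul, MemLp.toLp_eq_toLp_iff]
    filter_upwards [hτ.quasiMeasurePreserving.ae (Lp.coeFn_smul z u)] with t ht
    simp [ht, mul_left_comm]
  norm_map' u := by
    have h : eLpNorm (fun t => c t * u (τ t)) 2 μ = eLpNorm u 2 μ := by
      rw [← eLpNorm_comp_measurePreserving (Lp.aestronglyMeasurable u) hτ]
      exact eLpNorm_congr_norm_ae (Filter.Eventually.of_forall fun t => by simp [hc1])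
    rw [LinearMap.coe_mk, AddHom.coe_mk, Lp.norm_toLp, Lp.norm_def, h]

/-- The Hilbert space `ℓ²(ℤ²)`. -/
abbrev EllTwo : Type := lp (fun _ : ℤ × ℤ => ℂ) 2

/-- The isometry `(W ψ)(l) = c(l) ψ(σ(l))` of `ℓ²(ℤ²)`, for `c` of modulus one and a
permutation `σ`. -/
noncomputable def weightedPermL2 (c : ℤ × ℤ → ℂ) (hc1 : ∀ l, ‖c l‖ = 1)
    (σ : ℤ × ℤ ≃ ℤ × ℤ) : EllTwo →ₗᵢ[ℂ] EllTwo where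
  toFun ψ := ⟨fun l => c l * ψ (σ l), by
    have h := (memℓp_gen_iff (by norm_num)).1 (lp.memℓp ψ)
    refine (memℓp_gen_iff (by norm_num)).2 ?_
    simpa [hc1, Function.comp_def] using σ.summable_iff.2 h⟩
  map_add' ψ χ := by ext l; exact mul_add _ _ _
  map_smul' z ψ := by ext l; simp [mul_left_comm]
  norm_map' ψ := by
    rw [lp.norm_eq_tsum_rpow (by norm_num), lp.norm_eq_tsum_rpow (by norm_num)]
    congr 1
    simpa [hc1] using σ.tsum_eq (fun l => ‖ψ l‖ ^ (2 : ENNReal).toReal)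

/-! ### The Heisenberg representation and the lattice -/

/-- `ℝ²`, with Lebesgue measure and the Euclidean inner product. -/
abbrev Plane : Type := EuclideanSpace ℝ (Fin 2)

/-- `exp(2 π i s)`. -/
noncomputable def e1 (s : ℝ) : ℂ := Complex.exp ((2 * Real.pi * s : ℝ) * Complex.I)

lemma norm_e1 (s : ℝ) : ‖e1 s‖ = 1 := Complex.norm_exp_ofReal_mul_I _

lemma measurable_e1 : Measurable e1 := by unfold e1; fun_prop

/-- `rk E(g, θ) = c θ + d`. -/
noncomputable def rk (g : GL (Fin 2) ℤ) (θ : ℝ) : ℝ := (g.1 1 0 : ℝ) * θ + (g.1 1 1 : ℝ)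

/-- The slope `μ = c / (c θ + d)`. -/
noncomputable def slope' (g : GL (Fin 2) ℤ) (θ : ℝ) : ℝ := (g.1 1 0 : ℝ) / rk g θ

/-- The finite cyclic group `ℤ / c ℤ`. -/
abbrev Zc (g : GL (Fin 2) ℤ) : Type := ZMod (g.1 1 0).natAbs

instance (g : GL (Fin 2) ℤ) : Countable (Zc g) := by
  unfold Zc
  cases (g.1 1 0).natAbs with
  | zero => exact inferInstanceAs (Countable ℤ)
  | succ n => exact inferInstanceAs (Countable (Fin (n + 1)))

/-- The group `M = ℝ × ℤ / c ℤ`. -/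
abbrev MGroup (g : GL (Fin 2) ℤ) : Type := ℝ × Zc g

/-- The Haar measure on `M`: Lebesgue measure times counting measure. -/
noncomputable abbrev haarM (g : GL (Fin 2) ℤ) : Measure (MGroup g) :=
  (volume : Measure ℝ).prod Measure.count

/-- The Hilbert space `L²(ℝ × ℤ / c ℤ)`. -/
abbrev L2M (g : GL (Fin 2) ℤ) : Type := Lp ℂ 2 (haarM g)

/-- The group `G = M × M^`, where `M^` is identified with `M` through the pairing
`⟨(t, α), (x, β)⟩ = exp(2 π i (t x + α β / c))`. -/
abbrev GGroup (g : GL (Fin 2) ℤ) : Type := MGroup g × MGroup g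

/-- `α β / c`, which is well defined modulo `1`. -/
noncomputable def cycPair (g : GL (Fin 2) ℤ) (α β : Zc g) : ℝ :=
  ((α.val : ℝ) * (β.val : ℝ)) / (g.1 1 0 : ℝ)

lemma measurable_heisPhase (g : GL (Fin 2) ℤ) (y : GGroup g) : Measurable (fun p : MGroup g =>
    e1 (y.1.1 * y.2.1 / 2 + p.1 * y.2.1 + cycPair g p.2 y.2.2)) :=
  measurable_e1.comp (Measurable.add (by fun_prop)
    ((measurable_of_countable (fun α : Zc g => cycPair g α y.2.2)).comp measurable_snd))

/-- The Heisenberg representation of `G` on `L²(M)`: for `y = ((y₁, β₁), (y₂, β₂))`,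
`(π(y) u)(t, α) = exp(2 π i (y₁ y₂ / 2 + t y₂ + α β₂ / c)) u(t + y₁, α + β₁)`. -/
noncomputable def heis (g : GL (Fin 2) ℤ) (y : GGroup g) : L2M g →L[ℂ] L2M g :=
  (weightedCompL2 (μ := haarM g)
    (fun p : MGroup g => e1 (y.1.1 * y.2.1 / 2 + p.1 * y.2.1 + cycPair g p.2 y.2.2))
    (measurable_heisPhase g y) (fun _ => norm_e1 _) (fun p => p + y.1)
    (measurePreserving_add_right (haarM g) y.1)).toContinuousLinearMap

/-- The cocycle of the Heisenberg representation, `π(x) π(y) = e(x, y) π(x + y)`. -/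
noncomputable def cocycle (g : GL (Fin 2) ℤ) (x y : GGroup g) : ℂ :=
  e1 ((x.1.1 * y.2.1 - x.2.1 * y.1.1) / 2 + cycPair g x.1.2 y.2.2)

lemma e1_add (s t : ℝ) : e1 (s + t) = e1 s * e1 t := by
  rw [e1, e1, e1, ← Complex.exp_add]; congr 1; push_cast; ring

lemma e1_int (n : ℤ) : e1 n = 1 := by
  rw [e1, Complex.exp_eq_one_iff]; exact ⟨n, by push_cast; ring⟩

lemma cycPair_comm (g : GL (Fin 2) ℤ) (α β : Zc g) : cycPair g α β = cycPair g β α := by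
  simp [cycPair, mul_comm]

lemma e1_cycPair_add (g : GL (Fin 2) ℤ) (α α' β : Zc g) :
    e1 (cycPair g (α + α') β) = e1 (cycPair g α β) * e1 (cycPair g α' β) := by
  by_cases hc : g.1 1 0 = 0
  · simp [cycPair, hc, e1]
  have : NeZero (g.1 1 0).natAbs := ⟨Int.natAbs_ne_zero.2 hc⟩
  have hc' : ((g.1 1 0 : ℤ) : ℝ) ≠ 0 := by exact_mod_cast hc
  obtain ⟨s, hs⟩ : ∃ s : ℤ, (((g.1 1 0).natAbs : ℤ)) = s * g.1 1 0 := by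
    rcases Int.natAbs_eq (g.1 1 0) with h | h
    · exact ⟨1, by omega⟩
    · exact ⟨-1, by omega⟩
  have hs' : (((g.1 1 0).natAbs : ℕ) : ℝ) = s * (g.1 1 0 : ℝ) := by
    rw [← Int.cast_natCast, hs, Int.cast_mul]
  have hv : ((α + α').val : ℝ) + ((g.1 1 0).natAbs : ℝ) *
      (((α.val + α'.val) / (g.1 1 0).natAbs : ℕ) : ℝ) = α.val + α'.val := by
    rw [ZMod.val_add]; exact_mod_cast Nat.mod_add_div _ _
  rw [hs'] at hv
  set q : ℕ := (α.val + α'.val) / (g.1 1 0).natAbs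
  rw [← e1_add, ← mul_one (e1 (cycPair g (α + α') β)), ← e1_int (s * q * β.val), ← e1_add]
  congr 1
  simp only [cycPair]
  push_cast
  field_simp
  linear_combination (β.val : ℝ) * hv

lemma heis_coeFn (g : GL (Fin 2) ℤ) (y : GGroup g) (u : L2M g) :
    heis g y u =ᵐ[haarM g] fun p =>
      e1 (y.1.1 * y.2.1 / 2 + p.1 * y.2.1 + cycPair g p.2 y.2.2) * u (p + y.1) :=
  (memLp_weightedComp (measurable_heisPhase g y) (fun _ => norm_e1 _)
    (measurePreserving_add_right (haarM g) y.1) u).coeFn_toLp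

/-- The representation `π` is projective, with the cocycle `e`. -/
lemma heis_mul (g : GL (Fin 2) ℤ) (x y : GGroup g) (u : L2M g) :
    heis g x (heis g y u) = cocycle g x y • heis g (x + y) u := by
  have hτ := (measurePreserving_add_right (haarM g) x.1).quasiMeasurePreserving
  refine Lp.ext ?_
  filter_upwards [heis_coeFn g x (heis g y u), hτ.ae (heis_coeFn g y u),
    heis_coeFn g (x + y) u, Lp.coeFn_smul (cocycle g x y) (heis g (x + y) u)] with p h1 h2 h3 h4
  rw [h1, h2, h4, Pi.smul_apply, h3, smul_eq_mul, ← mul_assoc, ← mul_assoc, add_assoc p]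
  congr 1
  simp only [cocycle, e1_add, Prod.fst_add, Prod.snd_add, e1_cycPair_add,
    cycPair_comm g p.2 (x.2.2 + y.2.2), cycPair_comm g x.2.2, cycPair_comm g y.2.2]
  have : e1 (x.1.1 * x.2.1 / 2) * e1 (p.1 * x.2.1) * (e1 (y.1.1 * y.2.1 / 2) *
      e1 ((p.1 + x.1.1) * y.2.1)) = e1 ((x.1.1 * y.2.1 - x.2.1 * y.1.1) / 2) *
      (e1 ((x.1.1 + y.1.1) * (x.2.1 + y.2.1) / 2) * e1 (p.1 * (x.2.1 + y.2.1))) := by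
    simp only [← e1_add]; congr 1; ring
  linear_combination (e1 (cycPair g p.2 x.2.2) * e1 (cycPair g p.2 y.2.2) *
    e1 (cycPair g x.1.2 y.2.2)) * this

/-- The point `l₁ ω₁ + l₂ ω₂` of the lattice `L = ℤ ω₁ ⊕ ℤ ω₂ ⊂ G`, where
`ω₁ = ((0, 0), (1 / (c θ + d), -1))` and `ω₂ = ((-1 / c, -a), (0, 0))`. -/
noncomputable def latticePt (g : GL (Fin 2) ℤ) (θ : ℝ) (l : ℤ × ℤ) : GGroup g :=
  ((-(l.2 : ℝ) / (g.1 1 0 : ℝ), -((l.2 * g.1 0 0 : ℤ) : Zc g)),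
    ((l.1 : ℝ) / rk g θ, -((l.1 : ℤ) : Zc g)))

/-- The projective representation `π_w` of `ℝ²` on `L²(M)`: the character `x ↦ exp(i ⟨w, x⟩)`
times `x ↦ π((x₁, 0), (μ x₂, 0))`, that is,
`(π_w(x) u)(t, α) = exp(i ⟨w, x⟩) exp(π i μ (x₁ x₂ + 2 t x₂)) u(t + x₁, α)`. -/
noncomputable def piW (g : GL (Fin 2) ℤ) (θ : ℝ) (w x : Plane) : L2M g →L[ℂ] L2M g :=
  Complex.exp ((inner ℝ w x : ℝ) * Complex.I) • heis g ((x 0, 0), (slope' g θ * x 1, 0))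

/-- The action of `ℝ²` on `π(l)` by conjugation with `π_w(x)`. -/
lemma piW_covariant (g : GL (Fin 2) ℤ) (θ : ℝ) (hc : g.1 1 0 ≠ 0) (w x : Plane) (l : ℤ × ℤ)
    (u : L2M g) :
    piW g θ w x (heis g (latticePt g θ l) u) =
      e1 (((l.1 : ℝ) * x 0 + (l.2 : ℝ) * x 1) / rk g θ) •
        heis g (latticePt g θ l) (piW g θ w x u) := by
  have hc' : ((g.1 1 0 : ℤ) : ℝ) ≠ 0 := by exact_mod_cast hc
  simp only [piW, smul_apply, map_smul, heis_mul]
  rw [smul_comm (e1 _), smul_smul (e1 _), add_comm (latticePt g θ l)]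
  congr 2
  simp only [cocycle, ← e1_add, latticePt, slope', cycPair, ZMod.val_zero]
  congr 1
  by_cases hr : rk g θ = 0
  · simp [hr]
  field_simp
  push_cast
  ring

/-! ### The smooth algebra of the lattice -/

/-- The smooth algebra `B^∞` of the `C*`-algebra `B` generated by the unitaries `π(l)`, `l ∈ L`:
the elements `∑ a(l) π(l)` with rapidly decreasing coefficients. An element is recorded by its
coefficients; the seminorms `sup (1 + |l|)^k |a(l)|` define the Fréchet topology of `B^∞`. -/
structure SmoothB where
  /-- the coefficients in `∑ a(l) π(l)` -/
  coeff : ℤ × ℤ → ℂ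
  rapid : ∀ k : ℕ, ∃ C : ℝ, ∀ l, (1 + ‖l‖) ^ k * ‖coeff l‖ ≤ C

/-- The normalized trace `φ^B(∑ a(l) π(l)) = a(0)`. -/
def phiB (a : ℤ × ℤ → ℂ) : ℂ := a 0

/-- The product of `∑ a(l) π(l)` and `∑ b(l) π(l)`: the twisted convolution. -/
noncomputable def twConv (g : GL (Fin 2) ℤ) (θ : ℝ) (a b : ℤ × ℤ → ℂ) (l : ℤ × ℤ) : ℂ :=
  ∑' k, a k * b (l - k) * cocycle g (latticePt g θ k) (latticePt g θ (l - k))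

/-- The adjoint of `∑ a(l) π(l)`. -/
noncomputable def twStar (g : GL (Fin 2) ℤ) (θ : ℝ) (a : ℤ × ℤ → ℂ) (l : ℤ × ℤ) : ℂ :=
  starRingEnd ℂ (cocycle g (latticePt g θ l) (latticePt g θ (-l)) * a (-l))

/-- The `π(l)` are orthonormal for the scalar product `φ^B(a^* b)`. Hence the completion
`L²(B, φ^B)` is `ℓ²(ℤ²)`, with `π(l)` as the orthonormal basis. -/
lemma phiB_twStar_twConv (g : GL (Fin 2) ℤ) (θ : ℝ) (a b : ℤ × ℤ → ℂ) :
    phiB (twConv g θ (twStar g θ a) b) = ∑' l, starRingEnd ℂ (a l) * b l := by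
  unfold phiB twConv
  rw [← (Equiv.neg (ℤ × ℤ)).tsum_eq (fun l => starRingEnd ℂ (a l) * b l)]
  refine tsum_congr fun k => ?_
  have h : starRingEnd ℂ (cocycle g (latticePt g θ k) (latticePt g θ (-k))) *
      cocycle g (latticePt g θ k) (latticePt g θ (-k)) = 1 := by
    rw [mul_comm, Complex.mul_conj, Complex.normSq_eq_norm_sq]
    simp [cocycle, norm_e1]
  simp only [twStar, map_mul, zero_sub, Equiv.neg_apply]
  linear_combination (starRingEnd ℂ (a (-k)) * b (-k)) * h

/-- Left multiplication by `π(k)` on `L²(B, φ^B)`, which sends the basis vector `π(l)` to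
`e(k, l) π(k + l)`. -/
noncomputable def leftReg (g : GL (Fin 2) ℤ) (θ : ℝ) (k : ℤ × ℤ) : EllTwo →L[ℂ] EllTwo :=
  (weightedPermL2 (fun l => cocycle g (latticePt g θ k) (latticePt g θ (l - k)))
    (fun _ => norm_e1 _) (Equiv.subRight k)).toContinuousLinearMap

/-- The unitary representation `α̃` of `ℝ²` on `L²(B, φ^B)` induced by the action
`α̃_x(b) = π_0(x) b π_0(x)^*` on `B`, which multiplies `π(l)` by
`exp(2 π i (l₁ x₁ + l₂ x₂) / (c θ + d))`. -/
noncomputable def alphaT (g : GL (Fin 2) ℤ) (θ : ℝ) (x : Plane) : EllTwo →L[ℂ] EllTwo :=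
  (weightedPermL2 (fun l => e1 (((l.1 : ℝ) * x 0 + (l.2 : ℝ) * x 1) / rk g θ))
    (fun _ => norm_e1 _) (Equiv.refl _)).toContinuousLinearMap

/-! ### Parameter-dependent symbols and their realization -/

/-- `f ∈ S^m(ℝ² × Γ, B^∞)`, for a parameter `lam` of degree `r`: `f` is smooth on `ℝ² × Γ`, and
every Fréchet seminorm of a derivative of order `i` in `ξ` and `j` in `lam` is bounded by a
constant times `(1 + |ξ| + |lam|^(1/r))^(m - i - r j)`. (Smoothness as a map into `B^∞` is
smoothness of the coefficients, given these bounds.) -/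
def IsParamSymbol (r m : ℝ) (Γ : Set ℂ) (f : Plane → ℂ → SmoothB) : Prop :=
  (∀ l, ContDiffOn ℝ ((⊤ : ℕ∞) : WithTop ℕ∞)
    (fun p : Plane × ℂ => (f p.1 p.2).coeff l) (Set.univ ×ˢ Γ)) ∧
  ∀ i j k : ℕ, ∃ C : ℝ, ∀ ξ : Plane, ∀ lam ∈ Γ, ∀ l,
    (1 + ‖l‖) ^ k *
      ‖iteratedFDeriv ℝ i (fun η : Plane => iteratedFDeriv ℝ j
        (fun z : ℂ => (f η z).coeff l) lam) ξ‖
      ≤ C * (1 + ‖ξ‖ + ‖lam‖ ^ (1 / r)) ^ (m - i - r * j)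

/-- The inverse Fourier transform `h^∨(y) = (2 π)⁻² ∫ exp(i ⟨y, ξ⟩) h(ξ) dξ` of a `B^∞`-valued
function, given by its coefficients. -/
noncomputable def invFourierB (h : Plane → SmoothB) (y : Plane) (l : ℤ × ℤ) : ℂ :=
  (((2 * Real.pi) ^ 2)⁻¹ : ℝ) •
    ∫ ξ : Plane, Complex.exp ((inner ℝ y ξ : ℝ) * Complex.I) * (h ξ).coeff l

/-- `T` is the operator `Op(h) = ∫ h^∨(y) U(y) dy` on `H`, where `b = ∑ b(l) π(l)` acts on `H` as
`∑ b(l) P(l)`: the integral converges absolutely on every vector and has the value `T v`. -/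
def IsOp {H : Type*} [NormedAddCommGroup H] [InnerProductSpace ℂ H]
    (P : ℤ × ℤ → H →L[ℂ] H) (U : Plane → H →L[ℂ] H) (h : Plane → SmoothB)
    (T : H →L[ℂ] H) : Prop :=
  ∀ v : H, Integrable (fun y => (∑' l, invFourierB h y l • P l) (U y v)) ∧
    T v = ∫ y, (∑' l, invFourierB h y l • P l) (U y v)

/-! ### Parseval families and the trace -/

/-! Write `f = ∑ f_l π(l)`. Then `Op(f) = ∑ P(l) S_l` with `S_l = ∫ f_l^∨(y) ϖ(y) dy`, and rapid
decay in `l` lets the trace be taken term by term (`IsParseval.exists_isOp`). Every error term is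
small for one reason: each derivative in `ξ` gains a factor `(1 + |λ|^(1/r))⁻¹`, so enough of them
beat any power of `|λ|` (`isBigO_of_param_bound`).

On `L²(B, φ^B)` the basis `π(k)` diagonalizes `α̃`, with frequencies `2πk/(cθ+d)`, so by Fourier
inversion `S_l` multiplies `π(k)` by `f_l(-2πk/(cθ+d))`. Left multiplication by `π(l)`, `l ≠ 0`,
shifts the basis and has zero diagonal. The trace is thus the sum of `f_0` over a lattice of
covolume `(2π/(cθ+d))²`, and Poisson summation, one coordinate at a time, replaces it by the
integral (`DecayBound.norm_tsum_sub_integral_le`).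

On `L²(ℝ × ℤ/cℤ)` the trace of `π(Z) π_w(y)` is, as a distribution in `y`, a multiple (possibly
zero) of the point mass at the `y` that cancels the real part of `Z`. So `Tr(π(l) S_l)` is a
multiple of the value of `f_l^∨` at one point (`opTrace_heis_comp`). For `l = 0` this point is the
origin and the multiple is `|c|/|μ| = |cθ+d|`; for `l ≠ 0` it has norm at least `1/|c|`, where
`f_l^∨` is negligible by integration by parts.

The distributional statement is made rigorous with a Parseval family of phase-space translates of a
smooth, compactly supported window, over a lattice of redundancy two. Its ambiguity function is
Schwartz, so the matrix entry of `S_l` between the members at `a` and `b` decays as the power `-3`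
in `b - a` and as the power `m` in `a + b`. Both exponents are below `-2`, so the matrix is
absolutely summable and the operator is of trace class. The trace is the same for every phase-space
translate of the family; averaging over translates gives an integral over phase space, which Fourier
inversion evaluates (`opTrace_eq_integral`). -/

lemma HasSum.of_eq {ι E : Type*} [AddCommMonoid E] [TopologicalSpace E] {f g : ι → E} {a b : E}
    (h : HasSum f a) (hf : ∀ i, g i = f i) (hab : b = a) : HasSum g b := by
  rw [hab, funext hf]; exact h

section Parseval

variable {H : Type*} [NormedAddCommGroup H] [InnerProductSpace ℂ H] {ι κ : Type*}

/-- A family of vectors that resolves the identity, `⟪u, v⟫ = ∑ᵢ ⟪u, φᵢ⟫ ⟪φᵢ, v⟫`. -/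
def IsParseval (φ : ι → H) : Prop :=
  ∀ u v, HasSum (fun i => inner ℂ u (φ i) * inner ℂ (φ i) v) (inner ℂ u v)

lemma IsParseval.hasSum_sq {φ : ι → H} (h : IsParseval φ) (v : H) :
    HasSum (fun i => ‖inner ℂ (φ i) v‖ ^ 2) (‖v‖ ^ 2) := by
  rw [← Complex.hasSum_ofReal]
  refine (h v v).of_eq (fun i => ?_) (by simp [inner_self_eq_norm_sq_to_K])
  rw [← inner_conj_symm v, mul_comm, RCLike.mul_conj]
  simp

/-- Polarization, applied to the vectors and to each of the scalars `⟪φ i, u⟫`, `⟪φ i, v⟫`. -/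
lemma isParseval_of_hasSum_sq {φ : ι → H}
    (h : ∀ v, HasSum (fun i => ‖inner ℂ (φ i) v‖ ^ 2) (‖v‖ ^ 2)) : IsParseval φ := by
  intro u v
  have h' : ∀ v, HasSum (fun i => ((‖inner ℂ (φ i) v‖ : ℂ)) ^ 2) ((‖v‖ : ℂ) ^ 2) := fun v => by
    exact_mod_cast Complex.hasSum_ofReal.2 (h v)
  have := (((h' (u + v)).sub (h' (u - v))).add
    (((h' (u - Complex.I • v)).sub (h' (u + Complex.I • v))).mul_right Complex.I)).div_const 4
  refine this.of_eq (fun i => ?_) (inner_eq_sum_norm_sq_div_four u v)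
  have := inner_eq_sum_norm_sq_div_four (𝕜 := ℂ) (inner ℂ (φ i) u) (inner ℂ (φ i) v)
  simp only [RCLike.inner_apply, inner_conj_symm] at this
  rw [mul_comm, this]
  simp

/-- The single term of index `i` in the Parseval identity for `φ i` is `‖φ i‖ ^ 4`, which cannot
exceed the total `‖φ i‖ ^ 2`. -/
lemma IsParseval.norm_le_one {φ : ι → H} (h : IsParseval φ) (i : ι) : ‖φ i‖ ≤ 1 := by
  have h1 : ‖inner ℂ (φ i) (φ i)‖ ^ 2 ≤ ‖φ i‖ ^ 2 :=
    le_hasSum (h.hasSum_sq (φ i)) i fun _ _ => by positivity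
  have h2 : ‖inner ℂ (φ i) (φ i)‖ = ‖φ i‖ ^ 2 := by simp
  rw [h2] at h1
  by_contra! hc
  nlinarith [sq_nonneg (‖φ i‖ ^ 2 - 1)]

lemma IsParseval.summable_norm_mul {φ : ι → H} (h : IsParseval φ) (u v : H) :
    Summable (fun i => ‖inner ℂ u (φ i)‖ * ‖inner ℂ (φ i) v‖) ∧
      ∑' i, ‖inner ℂ u (φ i)‖ * ‖inner ℂ (φ i) v‖ ≤ ‖u‖ * ‖v‖ := by
  obtain ⟨C, -, h2, h3⟩ := Real.inner_le_Lp_mul_Lq_hasSum_of_nonneg (p := 2) (q := 2)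
    (f := fun i => ‖inner ℂ u (φ i)‖) (g := fun i => ‖inner ℂ (φ i) v‖) (A := ‖u‖) (B := ‖v‖)
    ⟨by norm_num, by norm_num, by norm_num⟩ (norm_nonneg _) (norm_nonneg _)
    (fun _ => norm_nonneg _) (fun _ => norm_nonneg _)
    (by simpa [norm_inner_symm] using h.hasSum_sq u) (by simpa using h.hasSum_sq v)
  exact ⟨h3.summable, h3.tsum_eq.le.trans h2⟩

/-- Only the adjoint `W'` has to preserve norms, since the coefficients of `v` in the new family are
those of `W' v` in the old one. -/
lemma IsParseval.map_isometry {φ : ι → H} (h : IsParseval φ) (W : H →L[ℂ] H)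
    (W' : H →L[ℂ] H) (hW : ∀ u v, inner ℂ (W u) v = inner ℂ u (W' v)) (hW' : ∀ v, ‖W' v‖ = ‖v‖) :
    IsParseval fun i => W (φ i) :=
  isParseval_of_hasSum_sq fun v => by simpa [hW, hW'] using h.hasSum_sq (W' v)

lemma HilbertBasis.isParseval (b : HilbertBasis ι ℂ H) : IsParseval b :=
  fun u v => b.hasSum_inner_mul_inner u v

/-- An absolutely convergent expansion of an operator into operators of rank at most one. -/
def RankOneExpansion (x y : ι → H) (T : H →L[ℂ] H) : Prop :=
  Summable (fun n => ‖x n‖ * ‖y n‖) ∧ ∀ v, HasSum (fun n => inner ℂ (x n) v • y n) (T v)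

lemma RankOneExpansion.isTraceClass [Countable ι] {x y : ι → H} {T : H →L[ℂ] H}
    (h : RankOneExpansion x y T) : IsTraceClass T := by
  obtain ⟨f, hf⟩ := exists_injective_nat ι
  -- Indices outside the range of `f` carry zero vectors, which change no sum.
  refine ⟨Function.extend f x 0, Function.extend f y 0, ?_, fun v => ?_⟩
  · rw [← hf.summable_iff]
    · simpa [Function.comp_def, hf.extend_apply] using h.1
    · intro n hn
      simp [Function.extend_apply' _ _ _ hn]
  · rw [← hf.hasSum_iff]
    · simpa [Function.comp_def, hf.extend_apply] using h.2 v
    · intro n hn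
      simp [Function.extend_apply' _ _ _ hn]

/-- Fubini for `⟪x n, φ i⟫ ⟪φ i, y n⟫`: summing over `n` first gives the diagonal entries of `T`,
over `i` first gives `⟪x n, y n⟫`. Cauchy–Schwarz bounds each inner sum by `‖x n‖ ‖y n‖`. The value
does not involve `φ`, hence the independence of the trace from the family. -/
lemma RankOneExpansion.hasSum_trace {x y : κ → H} {T : H →L[ℂ] H}
    (h : RankOneExpansion x y T) {φ : ι → H} (hφ : IsParseval φ) :
    HasSum (fun i => inner ℂ (φ i) (T (φ i))) (∑' n, inner ℂ (x n) (y n)) := by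
  let F : κ × ι → ℂ := fun p => inner ℂ (x p.1) (φ p.2) * inner ℂ (φ p.2) (y p.1)
  have hF : Summable fun p => ‖F p‖ := by
    rw [summable_prod_of_nonneg fun _ => norm_nonneg _]
    simp only [F, norm_mul]
    exact ⟨fun n => (hφ.summable_norm_mul (x n) (y n)).1,
      h.1.of_nonneg_of_le (fun n => tsum_nonneg fun i => by positivity)
        fun n => (hφ.summable_norm_mul (x n) (y n)).2⟩
  have h1 : ∀ i, HasSum (fun n => F (n, i)) (inner ℂ (φ i) (T (φ i))) := fun i => by
    exact ((h.2 (φ i)).mapL (innerSL ℂ (φ i))).of_eq (fun n => by simp [F]) rfl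
  have h4 : ∑' p, F p = ∑' n, inner ℂ (x n) (y n) := by
    rw [hF.of_norm.tsum_prod]
    exact tsum_congr fun n => (hφ (x n) (y n)).tsum_eq
  have h5 : HasSum (F ∘ Equiv.prodComm ι κ) (∑' p, F p) :=
    (Equiv.hasSum_iff _).2 hF.of_norm.hasSum
  rw [← h4]
  exact h5.prod_fiberwise h1

lemma RankOneExpansion.comp {x y : ι → H} {S : H →L[ℂ] H} (h : RankOneExpansion x y S)
    {P : H →L[ℂ] H} (hP : ∀ v, ‖P v‖ ≤ ‖v‖) : RankOneExpansion x (fun i => P (y i)) (P ∘L S) := by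
  refine ⟨Summable.of_nonneg_of_le (fun _ => by positivity) (fun p => ?_) h.1, fun v => ?_⟩
  · gcongr
    apply hP
  · exact ((h.2 v).mapL P).of_eq (fun p => by simp only [map_smul]) rfl

variable [CompleteSpace H]

lemma RankOneExpansion.opTrace_eq {x y : κ → H} {T : H →L[ℂ] H}
    (h : RankOneExpansion x y T) : opTrace T = ∑' n, inner ℂ (x n) (y n) := by
  obtain ⟨b, hb⟩ := (exists_hilbertBasis ℂ H).choose_spec
  have := (h.hasSum_trace b.isParseval).tsum_eq
  rw [hb] at this
  exact this

/-- The trace of a trace class operator can be computed with any Parseval family. -/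
lemma IsTraceClass.hasSum_opTrace {T : H →L[ℂ] H} (h : IsTraceClass T) {φ : ι → H}
    (hφ : IsParseval φ) : HasSum (fun i => inner ℂ (φ i) (T (φ i))) (opTrace T) := by
  obtain ⟨x, y, hxy⟩ := h
  rw [RankOneExpansion.opTrace_eq hxy]
  exact RankOneExpansion.hasSum_trace hxy hφ

/-- The expansion of an operator whose matrix in a Parseval family is absolutely summable. -/
lemma IsParseval.rankOneExpansion {φ : ι → H} (hφ : IsParseval φ) {S : H →L[ℂ] H}
    (hS : Summable fun p : ι × ι => ‖inner ℂ (φ p.1) (S (φ p.2))‖) :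
    RankOneExpansion (fun p : ι × ι => φ p.2)
      (fun p : ι × ι => inner ℂ (φ p.1) (S (φ p.2)) • φ p.1) S := by
  have hn := hφ.norm_le_one
  refine ⟨hS.of_nonneg_of_le (fun _ => by positivity) fun p => ?_, fun v => ?_⟩
  · rw [norm_smul]
    calc _ ≤ 1 * (‖inner ℂ (φ p.1) (S (φ p.2))‖ * 1) := by gcongr <;> apply hn
      _ = _ := by ring
  · have hs : Summable fun p : ι × ι =>
        ‖inner ℂ (φ p.2) v • inner ℂ (φ p.1) (S (φ p.2)) • φ p.1‖ := by
      refine (hS.mul_left ‖v‖).of_nonneg_of_le (fun _ => norm_nonneg _) fun p => ?_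
      rw [norm_smul, norm_smul]
      calc _ ≤ (1 * ‖v‖) * (‖inner ℂ (φ p.1) (S (φ p.2))‖ * 1) := by
            gcongr
            · exact (norm_inner_le_norm _ _).trans (by gcongr; apply hn)
            · apply hn
        _ = _ := by ring
    have key : ∑' p : ι × ι, inner ℂ (φ p.2) v • inner ℂ (φ p.1) (S (φ p.2)) • φ p.1 = S v := by
      refine ext_inner_left ℂ fun w => ?_
      have h1 := hs.of_norm.hasSum.mapL (innerSL ℂ w)
      -- In row `i` the sum over `j` is the Parseval identity for the pair `S* φ i`, `v`.
      have h2 : ∀ i, HasSum (fun j => innerSL ℂ w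
          (inner ℂ (φ j) v • inner ℂ (φ i) (S (φ j)) • φ i))
          (inner ℂ w (φ i) * inner ℂ (φ i) (S v)) := fun i => by
        have := (hφ (ContinuousLinearMap.adjoint S (φ i)) v).mul_left (inner ℂ w (φ i))
        simp only [ContinuousLinearMap.adjoint_inner_left] at this
        refine this.of_eq (fun j => ?_) rfl
        simp only [innerSL_apply_apply, inner_smul_right]
        ring
      exact (h1.prod_fiberwise h2).unique (hφ w (S v))
    rw [← key]
    exact hs.of_norm.hasSum

/-- A sum of operators with jointly absolutely convergent expansions is of trace class, and its
trace is the sum of the traces. -/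
lemma RankOneExpansion.sum {x y : κ → ι → H} {R : κ → H →L[ℂ] H} {T : H →L[ℂ] H}
    (h : ∀ l, RankOneExpansion (x l) (y l) (R l))
    (hs : Summable fun p : κ × ι => ‖x p.1 p.2‖ * ‖y p.1 p.2‖)
    (hT : ∀ v, HasSum (fun l => R l v) (T v)) :
    RankOneExpansion (fun p : κ × ι => x p.1 p.2) (fun p : κ × ι => y p.1 p.2) T ∧
      HasSum (fun l => opTrace (R l)) (opTrace T) := by
  have ht : RankOneExpansion (fun p : κ × ι => x p.1 p.2) (fun p : κ × ι => y p.1 p.2) T := by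
    refine ⟨hs, fun v => ?_⟩
    have h2 : Summable fun p : κ × ι => inner ℂ (x p.1 p.2) v • y p.1 p.2 := by
      refine Summable.of_norm ((hs.mul_right ‖v‖).of_nonneg_of_le (fun _ => norm_nonneg _)
        fun p => ?_)
      rw [norm_smul]
      calc _ ≤ (‖x p.1 p.2‖ * ‖v‖) * ‖y p.1 p.2‖ := by gcongr; exact norm_inner_le_norm _ _
        _ = _ := by ring
    have h3 := h2.hasSum.prod_fiberwise (g := fun l => R l v) fun l => (h l).2 v
    rw [(hT v).unique h3]
    exact h2.hasSum
  refine ⟨ht, ?_⟩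
  let F : κ × ι → ℂ := fun p => inner ℂ (x p.1 p.2) (y p.1 p.2)
  have h3 : Summable F :=
    Summable.of_norm (Summable.of_nonneg_of_le (fun _ => norm_nonneg _)
      (fun p => norm_inner_le_norm (𝕜 := ℂ) (x p.1 p.2) (y p.1 p.2)) hs)
  have h4 : HasSum (fun l => ∑' p, F (l, p)) (∑' p, F p) :=
    h3.hasSum.prod_fiberwise fun l =>
      (h3.comp_injective (i := fun p : ι => (l, p)) (Prod.mk_right_injective l)).hasSum
  exact h4.of_eq (fun l => (h l).opTrace_eq) ht.opTrace_eq

/-- A sum of operators `P l ∘ S l` is of trace class, if the matrices of the `S l` in a Parseval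
family are absolutely summable, and its trace is the sum of the traces. -/
lemma IsParseval.isTraceClass_sum [Countable ι] [Countable κ] {φ : ι → H} (hφ : IsParseval φ)
    {P S : κ → H →L[ℂ] H} {T : H →L[ℂ] H} (hP : ∀ l v, ‖P l v‖ ≤ ‖v‖) {c : κ → ι × ι → ℝ}
    (hc : ∀ l p, ‖inner ℂ (φ p.1) (S l (φ p.2))‖ ≤ c l p)
    (hS : Summable fun p : κ × (ι × ι) => c p.1 p.2)
    (hT : ∀ v, HasSum (fun l => P l (S l v)) (T v)) :
    IsTraceClass T ∧ (∀ l, IsTraceClass (P l ∘L S l)) ∧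
      HasSum (fun l => opTrace (P l ∘L S l)) (opTrace T) := by
  have hn := hφ.norm_le_one
  have hl : ∀ l, RankOneExpansion (fun p : ι × ι => φ p.2)
      (fun p : ι × ι => P l (inner ℂ (φ p.1) (S l (φ p.2)) • φ p.1)) (P l ∘L S l) := fun l => by
    have h0 : Summable fun p : ι × ι => c l p :=
      hS.comp_injective (i := fun p : ι × ι => (l, p)) (Prod.mk_right_injective l)
    exact (hφ.rankOneExpansion (h0.of_nonneg_of_le (fun _ => norm_nonneg _) (hc l))).comp (hP l)
  have h := RankOneExpansion.sum hl (hS.of_nonneg_of_le (fun _ => by positivity) fun p => ?_) hT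
  · exact ⟨h.1.isTraceClass, fun l => (hl l).isTraceClass, h.2⟩
  · calc _ ≤ 1 * (c p.1 p.2 * 1) := by
          gcongr
          · apply hn
          · refine (hP _ _).trans ?_
            rw [norm_smul]
            exact mul_le_mul (hc _ _) (hn _) (norm_nonneg _) ((norm_nonneg _).trans (hc _ _))
      _ = _ := by ring

end Parseval

/-! ### The inverse Fourier transform of a symbol on the plane -/

section Fourier

open scoped FourierTransform

/-- The inverse Fourier transform `(2 π)⁻² ∫ exp(i ⟨y, ξ⟩) h(ξ) dξ`. -/
noncomputable def invFT (h : Plane → ℂ) (y : Plane) : ℂ :=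
  (((2 * Real.pi) ^ 2)⁻¹ : ℝ) • ∫ ξ : Plane, Complex.exp ((inner ℝ y ξ : ℝ) * Complex.I) * h ξ

lemma invFT_eq (h : Plane → ℂ) (y : Plane) :
    invFT h y = (((2 * Real.pi) ^ 2)⁻¹ : ℝ) • 𝓕⁻ h ((2 * Real.pi)⁻¹ • y) := by
  rw [invFT, Real.fourierInv_eq']
  congr 2
  ext ξ
  rw [smul_eq_mul]
  congr 4
  rw [inner_smul_right, real_inner_comm]
  field_simp

/-- The Fourier transform of the `N`-th derivative is a multilinear form; on `(w, …, w)` it equals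
`𝓕 h w` times a scalar of modulus `(2π ‖w‖²) ^ N`, while its norm is at most the integral on the
right. Dividing by `‖w‖ ^ N` leaves the claim. -/
lemma norm_pow_mul_fourier_le {V E : Type*} [NormedAddCommGroup V] [InnerProductSpace ℝ V]
    [FiniteDimensional ℝ V] [MeasurableSpace V] [BorelSpace V] [NormedAddCommGroup E]
    [NormedSpace ℂ E] {h : V → E} {N : ℕ}
    (hh : ContDiff ℝ N h) (hi : ∀ n ≤ N, Integrable (iteratedFDeriv ℝ n h)) (w : V) :
    (2 * Real.pi * ‖w‖) ^ N * ‖𝓕 h w‖ ≤ ∫ v, ‖iteratedFDeriv ℝ N h v‖ := by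
  have h1 := congrFun (Real.fourier_iteratedFDeriv (N := (N : ℕ∞)) (n := N) (by exact_mod_cast hh)
    (fun n hn => hi n (by exact_mod_cast hn)) le_rfl) w
  have h2 : ‖𝓕 (iteratedFDeriv ℝ N h) w‖ ≤ ∫ v, ‖iteratedFDeriv ℝ N h v‖ :=
    VectorFourier.norm_fourierIntegral_le_integral_norm _ _ _ _ _
  have h3 := (𝓕 (iteratedFDeriv ℝ N h) w).le_opNorm fun _ => w
  rw [h1] at h3
  rw [VectorFourier.fourierPowSMulRight_apply] at h3
  simp only [norm_smul, norm_pow, norm_neg, norm_mul, Complex.norm_ofNat, Complex.norm_real,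
    Complex.norm_I, mul_one, Finset.prod_const, Finset.card_univ, Fintype.card_fin,
    Real.norm_eq_abs, abs_of_pos Real.pi_pos, neg_apply] at h3
  rw [← h1] at h3
  have h4 : |innerSL ℝ w w| = ‖w‖ ^ 2 := by
    rw [innerSL_apply_apply, real_inner_self_eq_norm_sq, abs_of_nonneg (by positivity)]
  erw [h4] at h3
  rcases eq_or_ne w 0 with rfl | hw
  · rcases Nat.eq_zero_or_pos N with rfl | hN
    · simpa using h3.trans (by simpa using h2)
    · rw [norm_zero, mul_zero, zero_pow hN.ne', zero_mul]
      positivity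
  · have hw' : 0 < ‖w‖ ^ N := by positivity
    refine le_of_mul_le_mul_right ?_ hw'
    calc _ = (2 * Real.pi) ^ N * ((‖w‖ ^ 2) ^ N * ‖𝓕 h w‖) := by ring
      _ ≤ _ := h3
      _ ≤ _ := by gcongr

/-- A function all of whose derivatives decay as the power `m` of `1 + ‖ξ‖`. -/
structure DecayBound (h : Plane → ℂ) (m : ℝ) (K : ℕ → ℝ) : Prop where
  contDiff : ContDiff ℝ ((⊤ : ℕ∞) : WithTop ℕ∞) h
  bound : ∀ i ξ, ‖iteratedFDeriv ℝ i h ξ‖ ≤ K i * (1 + ‖ξ‖) ^ m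

variable {h : Plane → ℂ} {m : ℝ} {K : ℕ → ℝ}

/-- The integral of `(1 + ‖ξ‖) ^ m` over the plane. -/
noncomputable def decayMass (m : ℝ) : ℝ := ∫ ξ : Plane, (1 + ‖ξ‖) ^ m

lemma decayMass_nonneg (m : ℝ) : 0 ≤ decayMass m :=
  integral_nonneg fun ξ => by positivity

lemma integrable_decay (hm : m < -2) : Integrable fun ξ : Plane => (1 + ‖ξ‖) ^ m := by
  have := integrable_one_add_norm (E := Plane) (μ := volume) (r := -m) (by simp; linarith)
  simpa using this

lemma DecayBound.nonneg (hh : DecayBound h m K) (i : ℕ) : 0 ≤ K i := by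
  simpa using (norm_nonneg _).trans (hh.bound i 0)

lemma DecayBound.integrable_iteratedFDeriv (hh : DecayBound h m K) (hm : m < -2) (i : ℕ) :
    Integrable (iteratedFDeriv ℝ i h) :=
  ((integrable_decay hm).const_mul (K i)).mono'
    (hh.contDiff.continuous_iteratedFDeriv (by exact_mod_cast le_top)).aestronglyMeasurable
    (Filter.Eventually.of_forall (hh.bound i))

lemma DecayBound.norm_le (hh : DecayBound h m K) (ξ : Plane) : ‖h ξ‖ ≤ K 0 * (1 + ‖ξ‖) ^ m := by
  simpa using hh.bound 0 ξ

lemma DecayBound.integrable (hh : DecayBound h m K) (hm : m < -2) : Integrable h :=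
  ((integrable_decay hm).const_mul (K 0)).mono' hh.contDiff.continuous.aestronglyMeasurable
    (Filter.Eventually.of_forall hh.norm_le)

/-- Integration by parts `i` times. For a symbol, `K i` contains `(1 + |λ|^(1/r)) ^ (-i)`, so at any
fixed distance from the origin the inverse transform decays faster than every power of `|λ|`. -/
lemma DecayBound.pow_mul_norm_invFT_le (hh : DecayBound h m K) (hm : m < -2) (i : ℕ) (y : Plane) :
    ‖y‖ ^ i * ‖invFT h y‖ ≤ K i * decayMass m := by
  have h1 := norm_pow_mul_fourier_le (N := i) (hh.contDiff.of_le (by exact_mod_cast le_top))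
    (fun n _ => hh.integrable_iteratedFDeriv hm n) (-((2 * Real.pi)⁻¹ • y))
  have h2 : ∫ ξ, ‖iteratedFDeriv ℝ i h ξ‖ ≤ K i * decayMass m := by
    rw [decayMass, ← integral_const_mul]
    exact integral_mono (hh.integrable_iteratedFDeriv hm i).norm
      ((integrable_decay hm).const_mul _) (hh.bound i)
  have hpi := Real.pi_pos
  have h3 : 2 * Real.pi * ‖-((2 * Real.pi)⁻¹ • y)‖ = ‖y‖ := by
    rw [norm_neg, norm_smul, Real.norm_of_nonneg (by positivity)]
    field_simp
  rw [h3, ← Real.fourierInv_eq_fourier_neg] at h1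
  -- The normalizing factor `(2π)⁻²` is at most one and is discarded.
  have h4 : ‖invFT h y‖ ≤ ‖𝓕⁻ h ((2 * Real.pi)⁻¹ • y)‖ := by
    rw [invFT_eq, norm_smul, Real.norm_of_nonneg (by positivity)]
    refine mul_le_of_le_one_left (norm_nonneg _) (inv_le_one_of_one_le₀ ?_)
    nlinarith [Real.pi_gt_three]
  exact (mul_le_mul_of_nonneg_left h4 (by positivity)).trans (h1.trans h2)

/-- The orders `0` and `3` suffice: the exponent `-3` lies below `-2`, so the bound is integrable
over the plane. -/
lemma DecayBound.norm_invFT_le (hh : DecayBound h m K) (hm : m < -2) (y : Plane) :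
    ‖invFT h y‖ ≤ 4 * (K 0 + K 3) * decayMass m * (1 + ‖y‖) ^ (-3 : ℝ) := by
  have h0 := hh.pow_mul_norm_invFT_le hm 0 y
  have h3 := hh.pow_mul_norm_invFT_le hm 3 y
  have hy := norm_nonneg y
  rw [Real.rpow_neg (by positivity), ← div_eq_mul_inv, le_div_iff₀ (by positivity)]
  have h5 : (1 + ‖y‖) ^ (3 : ℝ) ≤ 4 * (1 + ‖y‖ ^ 3) := by
    rw [show (3 : ℝ) = ((3 : ℕ) : ℝ) by norm_num, Real.rpow_natCast]
    -- With `t = ‖y‖`, the difference of the two sides is `3 (1 + t) (t - 1)²`.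
    nlinarith [mul_nonneg (add_nonneg zero_le_one hy) (sq_nonneg (‖y‖ - 1))]
  calc _ ≤ ‖invFT h y‖ * (4 * (1 + ‖y‖ ^ 3)) := by gcongr
    _ = 4 * (‖y‖ ^ 0 * ‖invFT h y‖ + ‖y‖ ^ 3 * ‖invFT h y‖) := by ring
    _ ≤ 4 * (K 0 * decayMass m + K 3 * decayMass m) := by gcongr
    _ = _ := by ring

lemma continuous_fourierInv {V : Type*} [NormedAddCommGroup V] [InnerProductSpace ℝ V]
    [FiniteDimensional ℝ V] [MeasurableSpace V] [BorelSpace V] {h : V → ℂ} (hi : Integrable h) :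
    Continuous (𝓕⁻ h) := by
  have h1 : Continuous (𝓕 h) := VectorFourier.fourierIntegral_continuous Real.continuous_fourierChar
    (by exact continuous_inner) hi
  have h2 : 𝓕⁻ h = fun w => 𝓕 h (-w) := funext fun w => Real.fourierInv_eq_fourier_neg h w
  rw [h2]
  fun_prop

lemma continuous_invFT (hi : Integrable h) : Continuous (invFT h) := by
  have := continuous_fourierInv hi
  simp only [funext (invFT_eq h)]
  fun_prop

lemma DecayBound.integrable_invFT (hh : DecayBound h m K) (hm : m < -2) : Integrable (invFT h) :=
  ((integrable_decay (m := -3) (by norm_num)).const_mul _).mono'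
    (continuous_invFT (hh.integrable hm)).aestronglyMeasurable
    (Filter.Eventually.of_forall (hh.norm_invFT_le hm))

lemma integral_comp_two_pi_smul (F : Plane → ℂ) :
    ∫ x, F ((2 * Real.pi) • x) = (((2 * Real.pi) ^ 2)⁻¹ : ℝ) • ∫ y, F y := by
  rw [Measure.integral_comp_smul]
  simp [abs_of_pos Real.pi_pos]

/-- An integral against the inverse Fourier transform. -/
lemma integral_invFT_mul (h : Plane → ℂ) (Ψ : Plane → ℂ) :
    ∫ y, invFT h y * Ψ y = ∫ x, 𝓕⁻ h x * Ψ ((2 * Real.pi) • x) := by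
  have hpi := Real.pi_pos
  have := integral_comp_two_pi_smul fun y => 𝓕⁻ h ((2 * Real.pi)⁻¹ • y) * Ψ y
  simp only [smul_smul, inv_mul_cancel₀ (by positivity : 2 * Real.pi ≠ 0), one_smul] at this
  rw [this, ← integral_smul]
  simp only [invFT_eq, smul_mul_assoc]

/-- Fourier inversion. -/
lemma DecayBound.integral_invFT_mul_exp (hh : DecayBound h m K) (hm : m < -2) (η : Plane) :
    ∫ y, invFT h y * Complex.exp ((inner ℝ y η : ℝ) * Complex.I) = h (-η) := by
  have h1 : Integrable (𝓕⁻ h) := by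
    have := (hh.integrable_invFT hm).comp_smul (R := 2 * Real.pi) (by positivity)
    simp only [invFT_eq, smul_smul, inv_mul_cancel₀ (by positivity : 2 * Real.pi ≠ 0),
      one_smul] at this
    have h2 := this.smul ((2 * Real.pi) ^ 2)
    simpa only [Pi.smul_def, smul_smul, mul_inv_cancel₀ (by positivity : (2 * Real.pi) ^ 2 ≠ 0),
      one_smul] using h2
  have h3 : Integrable (𝓕 h) := by
    have h4 : 𝓕 h = fun w => 𝓕⁻ h (-w) := funext fun w => by
      rw [Real.fourierInv_eq_fourier_neg, neg_neg]
    rw [h4]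
    exact h1.comp_neg
  have h5 := (hh.integrable hm).fourier_fourierInv_eq h3
    (v := -η) hh.contDiff.continuous.continuousAt
  rw [integral_invFT_mul, ← h5, Real.fourier_eq']
  congr 1
  ext x
  rw [smul_eq_mul, mul_comm]
  congr 4
  rw [inner_smul_left, inner_neg_right]
  simp

end Fourier

/-! ### Bounds for parameter-dependent symbols -/

/-- The bounds of a parameter-dependent symbol, at a fixed parameter. -/
lemma IsParamSymbol.decayBound {r m : ℝ} {Γ : Set ℂ} {f : Plane → ℂ → SmoothB}
    (hf : IsParamSymbol r m Γ f) (hm : m ≤ 0) :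
    ∃ C : ℕ → ℕ → ℝ, (∀ k i, 0 ≤ C k i) ∧ ∀ lam ∈ Γ, ∀ (k : ℕ) (l : ℤ × ℤ),
      DecayBound (fun ξ => (f ξ lam).coeff l) m
        fun i => C k i * ((1 + ‖l‖) ^ k)⁻¹ * ((1 + ‖lam‖ ^ (1 / r)) ^ i)⁻¹ := by
  -- Only the estimates without derivatives in the parameter are needed, hence `j = 0`.
  choose C hC using fun k i => hf.2 i 0 k
  refine ⟨fun k i => |C k i|, fun k i => abs_nonneg _, fun lam hlam k l => ⟨?_, fun i ξ => ?_⟩⟩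
  · have h1 : ContDiff ℝ ((⊤ : ℕ∞) : WithTop ℕ∞) fun ξ : Plane => (ξ, lam) :=
      contDiff_id.prodMk contDiff_const
    exact contDiffOn_univ.1 ((hf.1 l).comp h1.contDiffOn fun ξ _ => ⟨trivial, hlam⟩)
  · have h1 := hC k i ξ lam hlam l
    have h2 : (fun η : Plane => iteratedFDeriv ℝ 0 (fun z : ℂ => (f η z).coeff l) lam) =
        (continuousMultilinearCurryFin0 ℝ ℂ ℂ).symm ∘ fun η => (f η lam).coeff l := by
      ext1 η
      rw [iteratedFDeriv_zero_eq_comp]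
      rfl
    rw [h2, LinearIsometryEquiv.norm_iteratedFDeriv_comp_left] at h1
    set X := 1 + ‖lam‖ ^ (1 / r) with hX
    have hlr : 0 ≤ ‖lam‖ ^ (1 / r) := by positivity
    have hX1 : 1 ≤ X := by rw [hX]; linarith
    have hY1 : 1 ≤ 1 + ‖ξ‖ := by linarith [norm_nonneg ξ]
    -- The power `m - i` is split: in the factor of exponent `m ≤ 0` the parameter is dropped, in
    -- the factor of exponent `-i` the variable `ξ` is dropped.
    have h3 : (1 + ‖ξ‖ + ‖lam‖ ^ (1 / r)) ^ (m - i - r * (0 : ℕ)) ≤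
        (1 + ‖ξ‖) ^ m * (X ^ i)⁻¹ := by
      have hpos : 0 < 1 + ‖ξ‖ + ‖lam‖ ^ (1 / r) := by positivity
      rw [Nat.cast_zero, mul_zero, sub_zero, Real.rpow_sub hpos, div_eq_mul_inv, Real.rpow_natCast]
      gcongr ?_ * ?_
      · exact Real.rpow_le_rpow_of_nonpos (by positivity) (by linarith) hm
      · gcongr
        rw [hX]
        linarith [norm_nonneg ξ]
    have hl : 0 < (1 + ‖l‖) ^ k := by positivity
    rw [← mul_le_mul_iff_right₀ hl]
    calc _ ≤ C k i * (1 + ‖ξ‖ + ‖lam‖ ^ (1 / r)) ^ (m - i - r * (0 : ℕ)) := h1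
      _ ≤ |C k i| * ((1 + ‖ξ‖) ^ m * (X ^ i)⁻¹) := by
          gcongr
          exact le_abs_self _
      _ = _ := by field_simp

/-! ### Operators defined by a symbol -/

section Op

variable {H : Type*} [NormedAddCommGroup H] [InnerProductSpace ℂ H]

lemma integrable_smul_of_contraction {U : Plane → H →L[ℂ] H} (hU : ∀ y v, ‖U y v‖ ≤ ‖v‖)
    (hUc : ∀ v, Continuous fun y => U y v) {F : Plane → ℂ} (hF : Integrable F) (v : H) :
    Integrable fun y => F y • U y v :=
  (hF.norm.mul_const ‖v‖).mono' (hF.aestronglyMeasurable.smul (hUc v).aestronglyMeasurable)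
    (Filter.Eventually.of_forall fun y => by rw [norm_smul]; gcongr; apply hU)

/-- The operator `v ↦ ∫ F(y) U(y) v dy`. -/
lemma exists_integral_operator {U : Plane → H →L[ℂ] H} (hU : ∀ y v, ‖U y v‖ ≤ ‖v‖)
    (hUc : ∀ v, Continuous fun y => U y v) {F : Plane → ℂ} (hF : Integrable F) :
    ∃ S : H →L[ℂ] H, ∀ v, S v = ∫ y, F y • U y v := by
  have hi := integrable_smul_of_contraction hU hUc hF
  refine ⟨LinearMap.mkContinuous
    { toFun := fun v => ∫ y, F y • U y v
      map_add' := fun u v => by simp [← integral_add (hi u) (hi v)]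
      map_smul' := fun c v => by simp [← integral_smul, smul_comm c] } (∫ y, ‖F y‖) fun v => ?_,
    fun v => rfl⟩
  rw [← integral_mul_const]
  refine norm_integral_le_of_norm_le (hF.norm.mul_const _) (Filter.Eventually.of_forall fun y => ?_)
  rw [norm_smul]
  gcongr
  apply hU

variable [CompleteSpace H]

lemma hasSum_smul_apply {P : ℤ × ℤ → H →L[ℂ] H} (hP : ∀ l v, ‖P l v‖ ≤ ‖v‖) {a : ℤ × ℤ → ℂ}
    (ha : Summable fun l => ‖a l‖) (u : H) :
    HasSum (fun l => a l • P l u) ((∑' l, a l • P l) u) := by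
  have h1 : Summable fun l => a l • P l := by
    refine Summable.of_norm (ha.of_nonneg_of_le (fun _ => norm_nonneg _) fun l => ?_)
    rw [norm_smul]
    refine mul_le_of_le_one_right (norm_nonneg _) ?_
    exact ContinuousLinearMap.opNorm_le_bound _ zero_le_one fun v => by simpa using hP l v
  exact (h1.hasSum.mapL (ContinuousLinearMap.apply ℂ H u)).of_eq (fun l => rfl) rfl

/-- The operator of a symbol is the sum of the operators of the coefficients of the symbol. -/
lemma exists_isOp {P : ℤ × ℤ → H →L[ℂ] H} (hP : ∀ l v, ‖P l v‖ ≤ ‖v‖) {U : Plane → H →L[ℂ] H}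
    (hU : ∀ y v, ‖U y v‖ ≤ ‖v‖) (hUc : ∀ v, Continuous fun y => U y v) {h : Plane → SmoothB}
    {D : ℤ × ℤ → ℝ} (hD : Summable D) (hFc : ∀ l, Continuous fun y => invFourierB h y l)
    (hF : ∀ l y, ‖invFourierB h y l‖ ≤ D l * (1 + ‖y‖) ^ (-3 : ℝ))
    {S : ℤ × ℤ → H →L[ℂ] H} (hS : ∀ l v, S l v = ∫ y, invFourierB h y l • U y v) :
    ∃ T : H →L[ℂ] H, IsOp P U h T ∧ ∀ v, HasSum (fun l => P l (S l v)) (T v) := by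
  have hD0 : ∀ l, 0 ≤ D l := fun l => by simpa using (norm_nonneg _).trans (hF l 0)
  have hw := integrable_decay (m := -3) (by norm_num)
  have hFi : ∀ l, Integrable fun y => invFourierB h y l := fun l =>
    (hw.const_mul (D l)).mono' (hFc l).aestronglyMeasurable (Filter.Eventually.of_forall (hF l))
  have hF1 : ∀ l y, ‖invFourierB h y l‖ ≤ D l := fun l y =>
    (hF l y).trans (mul_le_of_le_one_right (hD0 l)
      (Real.rpow_le_one_of_one_le_of_nonpos (by linarith [norm_nonneg y]) (by norm_num)))
  have hs : ∀ y, Summable fun l => ‖invFourierB h y l‖ := fun y =>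
    hD.of_nonneg_of_le (fun _ => norm_nonneg _) fun l => hF1 l y
  have hsum : ∀ y u, HasSum (fun l => invFourierB h y l • P l u)
      ((∑' l, invFourierB h y l • P l) u) := fun y u => hasSum_smul_apply hP (hs y) u
  have hi : ∀ v l, Integrable fun y => invFourierB h y l • P l (U y v) := fun v l =>
    ((hFi l).norm.mul_const ‖v‖).mono' ((hFi l).aestronglyMeasurable.smul
      ((P l).continuous.comp (hUc v)).aestronglyMeasurable) (Filter.Eventually.of_forall fun y => by
        rw [norm_smul]; gcongr; exact (hP _ _).trans (hU _ _))
  have hbd : ∀ v l y, ‖invFourierB h y l • P l (U y v)‖ ≤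
      D l * ((1 + ‖y‖) ^ (-3 : ℝ) * ‖v‖) := fun v l y => by
    rw [norm_smul, ← mul_assoc]
    exact mul_le_mul (hF l y) ((hP _ _).trans (hU _ _)) (norm_nonneg _)
      ((norm_nonneg _).trans (hF l y))
  have hint : ∀ v, Integrable fun y => (∑' l, invFourierB h y l • P l) (U y v) := fun v => by
    simp only [← (hsum _ _).tsum_eq]
    refine ((hw.mul_const ‖v‖).const_mul (∑' l, D l)).mono' (Continuous.aestronglyMeasurable ?_)
      (Filter.Eventually.of_forall fun y => ?_)
    · refine continuous_tsum (fun l => (hFc l).smul ((P l).continuous.comp (hUc v)))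
        (hD.mul_right ‖v‖) fun l y => ?_
      rw [norm_smul]
      gcongr
      · exact hD0 l
      · exact hF1 l y
      · exact (hP _ _).trans (hU _ _)
    · exact tsum_of_norm_bounded (hD.hasSum.mul_right _) (hbd v · y)
  -- The majorant `D l (1 + ‖y‖)⁻³ ‖v‖` is summable in `l` and integrable in `y`, so sum and
  -- integral may be exchanged.
  have hsw : ∀ v, HasSum (fun l => P l (S l v))
      (∫ y, (∑' l, invFourierB h y l • P l) (U y v)) := fun v => by
    simp only [← (hsum _ _).tsum_eq]
    refine (hasSum_integral_of_summable_integral_norm (hi v) ?_).of_eq (fun l => ?_) rfl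
    · refine (hD.mul_right (∫ y : Plane, (1 + ‖y‖) ^ (-3 : ℝ) * ‖v‖)).of_nonneg_of_le
        (fun l => integral_nonneg fun y => norm_nonneg _) fun l => ?_
      rw [← integral_const_mul]
      exact integral_mono (hi v l).norm ((hw.mul_const _).const_mul _) (hbd v l)
    · rw [hS, ← (P l).integral_comp_comm (integrable_smul_of_contraction hU hUc (hFi l) v)]
      simp only [map_smul]
  obtain ⟨T, hT⟩ : ∃ T : H →L[ℂ] H,
      ∀ v, T v = ∫ y, (∑' l, invFourierB h y l • P l) (U y v) := by
    refine ⟨LinearMap.mkContinuous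
      { toFun := fun v => ∫ y, (∑' l, invFourierB h y l • P l) (U y v)
        map_add' := fun u v => by simp only [map_add, integral_add (hint u) (hint v)]
        map_smul' := fun c v => by simp only [map_smul, integral_smul, RingHom.id_apply] }
      ((∑' l, D l) * ∫ y : Plane, (1 + ‖y‖) ^ (-3 : ℝ)) fun v => ?_, fun v => rfl⟩
    rw [mul_assoc, ← integral_mul_const, ← integral_const_mul]
    refine norm_integral_le_of_norm_le ((hw.mul_const ‖v‖).const_mul (∑' l, D l))
      (Filter.Eventually.of_forall fun y => ?_)
    rw [← (hsum _ _).tsum_eq]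
    exact tsum_of_norm_bounded (hD.hasSum.mul_right _) (hbd v · y)
  exact ⟨T, fun v => ⟨hint v, hT v⟩, fun v => hT v ▸ hsw v⟩

end Op

/-! ### The plane as a product -/

/-- The point `(x, y)` of the plane. -/
noncomputable def toPlane (p : ℝ × ℝ) : Plane := WithLp.toLp 2 ![p.1, p.2]

@[simp] lemma toPlane_zero (p : ℝ × ℝ) : toPlane p 0 = p.1 := rfl

@[simp] lemma toPlane_one (p : ℝ × ℝ) : toPlane p 1 = p.2 := rfl

lemma continuous_toPlane : Continuous toPlane := by
  unfold toPlane
  refine (PiLp.continuous_toLp 2 _).comp ?_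
  fun_prop

lemma measurePreserving_toPlane : MeasurePreserving toPlane volume volume :=
  (PiLp.volume_preserving_toLp (Fin 2)).comp
    ((volume_preserving_finTwoArrow ℝ).symm MeasurableEquiv.finTwoArrow)

lemma measurableEmbedding_toPlane : MeasurableEmbedding toPlane :=
  (MeasurableEquiv.toLp 2 (Fin 2 → ℝ)).measurableEmbedding.comp
    (MeasurableEquiv.finTwoArrow (α := ℝ)).symm.measurableEmbedding

lemma norm_sq_plane (x : Plane) : ‖x‖ ^ 2 = x 0 ^ 2 + x 1 ^ 2 := by
  simp [EuclideanSpace.norm_sq_eq]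

lemma abs_coord_le_norm (x : Plane) (i : Fin 2) : |x i| ≤ ‖x‖ := PiLp.norm_apply_le x i

lemma inner_plane (x y : Plane) : inner ℝ x y = x 0 * y 0 + x 1 * y 1 := by
  simp [PiLp.inner_apply, mul_comm]

/-! ### Comparison of sums with integrals -/

section Poisson

open scoped FourierTransform

lemma integrable_one_add_mul_abs {a p : ℝ} (ha : 0 < a) (hp : p < -1) :
    Integrable fun x : ℝ => (1 + a * |x|) ^ p := by
  have h := integrable_one_add_norm (E := ℝ) (μ := volume) (r := -p) (by simp; linarith)
  simpa [abs_mul, abs_of_pos ha] using h.comp_mul_left' ha.ne'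

lemma summable_one_add_mul_abs {a p : ℝ} (ha : 0 < a) (hp : p < -1) :
    Summable fun n : ℤ => (1 + a * |(n : ℝ)|) ^ p := by
  have h1 := (Real.summable_abs_int_rpow (b := -p) (by linarith)).mul_left (a ^ p)
  refine h1.of_norm_bounded_eventually ?_
  filter_upwards [(Set.finite_singleton (0 : ℤ)).compl_mem_cofinite] with n hn
  have hn' : 0 < |(n : ℝ)| := by
    rw [abs_pos]; exact_mod_cast hn
  rw [Real.norm_of_nonneg (by positivity), neg_neg, ← Real.mul_rpow ha.le hn'.le]
  exact Real.rpow_le_rpow_of_nonpos (by positivity) (by linarith) (by linarith)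

/-- The sum of `1 / |n| ^ N` over the integers. -/
noncomputable def intZeta (N : ℕ) : ℝ := ∑' n : ℤ, (|(n : ℝ)| ^ N)⁻¹

lemma intZeta_nonneg (N : ℕ) : 0 ≤ intZeta N := tsum_nonneg fun _ => by positivity

/-- Poisson summation: the zero frequency is the integral, and the frequency `n ≠ 0` costs `|n| ^
(-N)` times the `L¹` norm of the `N`-th derivative. The condition `2 ≤ N` makes the sum over
frequencies converge. -/
lemma norm_tsum_int_sub_integral_le {g : ℝ → ℂ} {a p : ℝ} (ha : 0 < a) (hp : p < -1) {K : ℕ → ℝ}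
    (hg : ContDiff ℝ ((⊤ : ℕ∞) : WithTop ℕ∞) g)
    (hK : ∀ i x, ‖iteratedFDeriv ℝ i g x‖ ≤ K i * (1 + a * |x|) ^ p) {N : ℕ} (hN : 2 ≤ N) :
    ‖∑' n : ℤ, g n - ∫ x, g x‖ ≤ intZeta N * (K N * ∫ x : ℝ, (1 + a * |x|) ^ p) := by
  have hw := integrable_one_add_mul_abs ha hp
  have hi : ∀ i, Integrable (iteratedFDeriv ℝ i g) := fun i =>
    (hw.const_mul (K i)).mono' (hg.continuous_iteratedFDeriv
      (by exact_mod_cast le_top)).aestronglyMeasurable (Filter.Eventually.of_forall (hK i))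
  set M := ∫ v, ‖iteratedFDeriv ℝ N g v‖ with hM
  have hM0 : 0 ≤ M := integral_nonneg fun _ => norm_nonneg _
  have hMle : M ≤ K N * ∫ x : ℝ, (1 + a * |x|) ^ p := by
    rw [← integral_const_mul]
    exact integral_mono (hi N).norm (hw.const_mul _) (hK N)
  have hz : Summable fun n : ℤ => (|(n : ℝ)| ^ N)⁻¹ := by
    have := Real.summable_abs_int_rpow (b := N) (by exact_mod_cast hN)
    refine this.congr fun n => ?_
    rw [Real.rpow_neg (abs_nonneg _), Real.rpow_natCast]
  have hF : ∀ n : ℤ, n ≠ 0 → ‖𝓕 g n‖ ≤ M * (|(n : ℝ)| ^ N)⁻¹ := fun n hn => by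
    have h1 := norm_pow_mul_fourier_le (N := N) (hg.of_le (by exact_mod_cast le_top))
      (fun i _ => hi i) (n : ℝ)
    have hn' : 0 < |(n : ℝ)| := by rw [abs_pos]; exact_mod_cast hn
    rw [← div_eq_mul_inv, le_div_iff₀ (by positivity), mul_comm]
    refine le_trans ?_ h1
    gcongr
    rw [Real.norm_eq_abs]
    nlinarith [Real.pi_gt_three]
  have hFs : Summable fun n : ℤ => 𝓕 g n := by
    refine (hz.mul_left M).of_norm_bounded_eventually ?_
    filter_upwards [(Set.finite_singleton (0 : ℤ)).compl_mem_cofinite] with n hn using hF n hn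
  have hgO : g =O[Filter.cocompact ℝ] fun x : ℝ => |x| ^ (-(-p)) := by
    refine Asymptotics.IsBigO.of_bound (K 0 * a ^ p) ?_
    have h0 : ∀ᶠ x : ℝ in Filter.cocompact ℝ, x ∈ ({0} : Set ℝ)ᶜ :=
      isCompact_singleton.compl_mem_cocompact
    filter_upwards [h0] with x hx
    have hx' : 0 < |x| := abs_pos.2 hx
    have hK0 : 0 ≤ K 0 := by simpa using (norm_nonneg _).trans (hK 0 0)
    rw [neg_neg, Real.norm_of_nonneg (by positivity), mul_assoc, ← Real.mul_rpow ha.le hx'.le]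
    refine (by simpa using hK 0 x : ‖g x‖ ≤ _).trans ?_
    gcongr ?_ * ?_
    exact Real.rpow_le_rpow_of_nonpos (by positivity) (by linarith) (by linarith)
  have hP := Real.tsum_eq_tsum_fourier_of_rpow_decay_of_summable hg.continuous
    (by linarith : 1 < -p) hgO hFs 0
  simp only [zero_add, QuotientAddGroup.mk_zero, fourier_eval_zero, mul_one] at hP
  have h0 : 𝓕 g (((0 : ℤ) : ℝ)) = ∫ x, g x := by
    rw [Real.fourier_eq']
    simp
  rw [hP, hFs.tsum_eq_add_tsum_ite 0, h0, add_sub_cancel_left]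
  calc _ ≤ ∑' n : ℤ, M * (|(n : ℝ)| ^ N)⁻¹ :=
        tsum_of_norm_bounded (hz.mul_left M).hasSum fun n => by
          split_ifs with h
          · simp only [norm_zero]; positivity
          · exact hF n h
    _ = M * intZeta N := tsum_mul_left
    _ ≤ (K N * ∫ x : ℝ, (1 + a * |x|) ^ p) * intZeta N := by
        gcongr; exact intZeta_nonneg N
    _ = _ := mul_comm _ _

variable {h : Plane → ℂ} {m : ℝ} {K : ℕ → ℝ}

/-- Splitting the exponent evenly separates the coordinates; for `m < -2` each factor has exponent
below `-1` and is summable and integrable on the line. -/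
lemma one_add_norm_rpow_le (hm : m ≤ 0) (x : Plane) :
    (1 + ‖x‖) ^ m ≤ (1 + |x 0|) ^ (m / 2) * (1 + |x 1|) ^ (m / 2) := by
  have h1 := abs_coord_le_norm x 0
  have h2 := abs_coord_le_norm x 1
  calc (1 + ‖x‖) ^ m = (1 + ‖x‖) ^ (m / 2) * (1 + ‖x‖) ^ (m / 2) := by
        rw [← Real.rpow_add (by positivity), add_halves]
    _ ≤ _ := by
        gcongr ?_ * ?_ <;>
        exact Real.rpow_le_rpow_of_nonpos (by positivity) (by linarith) (by linarith)

lemma norm_iteratedFDeriv_slice_le (hh : ContDiff ℝ ((⊤ : ℕ∞) : WithTop ℕ∞) h) (x v : Plane)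
    (i : ℕ) (t : ℝ) :
    ‖iteratedFDeriv ℝ i (fun t : ℝ => h (x + t • v)) t‖ ≤
      ‖v‖ ^ i * ‖iteratedFDeriv ℝ i h (x + t • v)‖ := by
  let L : ℝ →L[ℝ] Plane := ContinuousLinearMap.toSpanSingleton ℝ v
  have h1 : (fun t : ℝ => h (x + t • v)) = (fun z => h (x + z)) ∘ L := by
    ext t; simp [L]
  have h2 : ContDiff ℝ ((⊤ : ℕ∞) : WithTop ℕ∞) fun z => h (x + z) := by fun_prop
  rw [h1, ContinuousLinearMap.iteratedFDeriv_comp_right L h2 _ (by exact_mod_cast le_top),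
    iteratedFDeriv_comp_add_left]
  refine (ContinuousMultilinearMap.norm_compContinuousLinearMap_le _ _).trans ?_
  simp [L, mul_comm]

lemma contDiff_slice (hh : ContDiff ℝ ((⊤ : ℕ∞) : WithTop ℕ∞) h) (x v : Plane) :
    ContDiff ℝ ((⊤ : ℕ∞) : WithTop ℕ∞) fun t : ℝ => h (x + t • v) := by fun_prop

/-- The sum of a symbol over a lattice differs little from its integral. -/
lemma DecayBound.norm_tsum_sub_integral_le (hh : DecayBound h m K) (hm : m < -2) {a : ℝ}
    (ha : a ≠ 0) {N : ℕ} (hN : 2 ≤ N) :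
    Summable (fun k : ℤ × ℤ => ‖h (toPlane (a * k.1, a * k.2))‖) ∧
    ‖∑' k : ℤ × ℤ, h (toPlane (a * k.1, a * k.2)) - ((a ^ 2)⁻¹ : ℝ) • ∫ x, h x‖ ≤
      intZeta N * (|a| ^ N * K N) * (∫ x : ℝ, (1 + |a| * |x|) ^ (m / 2)) *
        ((∑' n : ℤ, (1 + |a| * |(n : ℝ)|) ^ (m / 2)) + ∫ x : ℝ, (1 + |a| * |x|) ^ (m / 2)) := by
  have ha' : 0 < |a| := abs_pos.2 ha
  have hm2 : m / 2 < -1 := by linarith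
  set w : ℝ → ℝ := fun t => (1 + |a| * |t|) ^ (m / 2) with hw
  have hwi : Integrable w := integrable_one_add_mul_abs ha' hm2
  have hws : Summable fun n : ℤ => w n := summable_one_add_mul_abs ha' hm2
  have hw0 : ∀ t, 0 ≤ w t := fun t => by simp only [hw]; positivity
  set W := ∫ x, w x with hW
  have hW0 : 0 ≤ W := integral_nonneg hw0
  let q : ℝ → ℝ → ℂ := fun s t => h (toPlane (a * s, a * t))
  have hqc : Continuous fun p : ℝ × ℝ => q p.1 p.2 :=
    hh.contDiff.continuous.comp (continuous_toPlane.comp (by fun_prop))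
  have hdec : ∀ i s t, ‖iteratedFDeriv ℝ i h (toPlane (a * s, a * t))‖ ≤ K i * (w s * w t) :=
    fun i s t => by
      refine (hh.bound i _).trans ?_
      have := one_add_norm_rpow_le (m := m) (by linarith) (toPlane (a * s, a * t))
      simp only [toPlane_zero, toPlane_one, abs_mul] at this
      exact mul_le_mul_of_nonneg_left this (hh.nonneg i)
  have hqb : ∀ s t, ‖q s t‖ ≤ K 0 * (w s * w t) := fun s t => by simpa using hdec 0 s t
  have e0 : ∀ s t, toPlane (a * s, a * t) = toPlane (0, a * t) + s • toPlane (a, 0) := fun s t => by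
    ext i; fin_cases i <;> simp [toPlane, mul_comm]
  have e1 : ∀ s t, toPlane (a * s, a * t) = toPlane (a * s, 0) + t • toPlane (0, a) := fun s t => by
    ext i; fin_cases i <;> simp [toPlane, mul_comm]
  have n0 : ‖toPlane (a, 0)‖ = |a| := by
    rw [← abs_of_nonneg (norm_nonneg _), ← sq_eq_sq_iff_abs_eq_abs, norm_sq_plane]; simp
  have n1 : ‖toPlane (0, a)‖ = |a| := by
    rw [← abs_of_nonneg (norm_nonneg _), ← sq_eq_sq_iff_abs_eq_abs, norm_sq_plane]; simp
  -- Poisson summation is applied along the second coordinate, then (`E2`) along the first. The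
  -- weight `w` in the frozen variable survives in the bound, so that `E1` can be summed (`B1`) and
  -- `E2` integrated (`B2`).
  have E1 : ∀ s, ‖∑' n : ℤ, q s n - ∫ t, q s t‖ ≤ intZeta N * (|a| ^ N * K N * w s * W) :=
    fun s => by
      refine norm_tsum_int_sub_integral_le (K := fun i => |a| ^ i * K i * w s) ha' hm2
        (by simp only [q, e1]; exact contDiff_slice hh.contDiff _ _) (fun i t => ?_) hN
      simp only [q, e1]
      refine (norm_iteratedFDeriv_slice_le hh.contDiff _ _ i t).trans ?_
      rw [n1, ← e1]
      calc _ ≤ |a| ^ i * (K i * (w s * w t)) := by gcongr; exact hdec i s t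
        _ = _ := by ring
  have E2 : ∀ t, ‖∑' n : ℤ, q n t - ∫ s, q s t‖ ≤ intZeta N * (|a| ^ N * K N * w t * W) :=
    fun t => by
      refine norm_tsum_int_sub_integral_le (g := fun s => q s t)
        (K := fun i => |a| ^ i * K i * w t) ha' hm2
        (by simp only [q, e0]; exact contDiff_slice hh.contDiff _ _) (fun i s => ?_) hN
      simp only [q, e0]
      refine (norm_iteratedFDeriv_slice_le hh.contDiff _ _ i s).trans ?_
      rw [n0, ← e0]
      calc _ ≤ |a| ^ i * (K i * (w s * w t)) := by gcongr; exact hdec i s t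
        _ = _ := by ring
  have hww : Summable fun k : ℤ × ℤ => w k.1 * w k.2 :=
    hws.mul_of_nonneg hws (fun n => hw0 n) fun n => hw0 n
  have hs : Summable fun k : ℤ × ℤ => ‖q k.1 k.2‖ :=
    (hww.mul_left (K 0)).of_nonneg_of_le (fun _ => norm_nonneg _) fun k => hqb _ _
  refine ⟨hs, ?_⟩
  have hqi : Integrable (fun p : ℝ × ℝ => q p.1 p.2) (volume.prod volume) :=
    ((hwi.mul_prod hwi).const_mul (K 0)).mono' hqc.aestronglyMeasurable
      (Filter.Eventually.of_forall fun p => hqb p.1 p.2)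
  have hqt : ∀ s, Integrable (q s) := fun s =>
    ((hwi.const_mul (w s)).const_mul (K 0)).mono'
      (hqc.comp (by fun_prop : Continuous fun t => (s, t))).aestronglyMeasurable
      (Filter.Eventually.of_forall fun t => hqb s t)
  have hI : ∫ t, ∫ s, q s t = ((a ^ 2)⁻¹ : ℝ) • ∫ x, h x := by
    have h1 : ∫ p : ℝ × ℝ, q p.1 p.2 = ∫ t, ∫ s, q s t := by
      rw [← integral_prod_symm _ hqi]; rfl
    have h2 : ∀ p : ℝ × ℝ, q p.1 p.2 = (fun x => h (a • x)) (toPlane p) := fun p => by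
      simp only [q]
      congr 1
      ext i; fin_cases i <;> simp [toPlane]
    rw [← h1, integral_congr_ae (Filter.Eventually.of_forall h2),
      measurePreserving_toPlane.integral_comp measurableEmbedding_toPlane (fun x => h (a • x)),
      Measure.integral_comp_smul]
    simp
  have hsum1 : HasSum (fun n : ℤ => ∑' k : ℤ, q n k) (∑' k : ℤ × ℤ, q k.1 k.2) :=
    hs.of_norm.hasSum.prod_fiberwise fun n =>
      (hs.of_norm.comp_injective (i := fun k : ℤ => (n, k)) (Prod.mk_right_injective n)).hasSum
  have hsum2 : HasSum (fun n : ℤ => ∫ t, q n t) (∫ t, ∑' n : ℤ, q n t) := by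
    refine hasSum_integral_of_summable_integral_norm (fun n => hqt n) ?_
    refine (hws.mul_right (K 0 * W)).of_nonneg_of_le
      (fun n => integral_nonneg fun _ => norm_nonneg _) fun n => ?_
    calc _ ≤ ∫ t, K 0 * (w n * w t) := integral_mono (hqt n).norm
          ((hwi.const_mul _).const_mul _) (hqb n)
      _ = _ := by rw [integral_const_mul, integral_const_mul]; ring
  have B1 : ‖∑' k : ℤ × ℤ, q k.1 k.2 - ∫ t, ∑' n : ℤ, q n t‖ ≤
      intZeta N * (|a| ^ N * K N) * W * ∑' n : ℤ, w n := by
    rw [← (hsum1.sub hsum2).tsum_eq]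
    refine tsum_of_norm_bounded (hws.hasSum.mul_left _) fun n => (E1 n).trans_eq (by ring)
  have B2 : ‖(∫ t, ∑' n : ℤ, q n t) - ∫ t, ∫ s, q s t‖ ≤
      intZeta N * (|a| ^ N * K N) * W * W := by
    have hc : Continuous fun t => ∑' n : ℤ, q n t := by
      refine continuous_tsum (fun n => hqc.comp (by fun_prop : Continuous fun t => ((n : ℝ), t)))
        (hws.mul_left (K 0)) fun n t => (hqb n t).trans ?_
      have : w t ≤ 1 := Real.rpow_le_one_of_one_le_of_nonpos
        (by nlinarith [mul_nonneg ha'.le (abs_nonneg t)]) (by linarith)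
      exact mul_le_mul_of_nonneg_left (mul_le_of_le_one_right (hw0 _) this) (hh.nonneg 0)
    have hi1 : Integrable fun t => ∑' n : ℤ, q n t := by
      refine (hwi.const_mul (K 0 * ∑' n : ℤ, w n)).mono' hc.aestronglyMeasurable
        (Filter.Eventually.of_forall fun t => ?_)
      exact tsum_of_norm_bounded ((hws.hasSum.mul_left (K 0)).mul_right (w t))
        fun n => (hqb n t).trans_eq (by ring)
    rw [← integral_sub hi1 hqi.integral_prod_right]
    refine (norm_integral_le_of_norm_le (hwi.const_mul (intZeta N * (|a| ^ N * K N) * W))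
      (Filter.Eventually.of_forall fun t => (E2 t).trans_eq (by ring))).trans_eq ?_
    rw [integral_const_mul]
  rw [← hI]
  calc _ ≤ ‖∑' k : ℤ × ℤ, q k.1 k.2 - ∫ t, ∑' n : ℤ, q n t‖ +
        ‖(∫ t, ∑' n : ℤ, q n t) - ∫ t, ∫ s, q s t‖ := norm_sub_le_norm_sub_add_norm_sub _ _ _
    _ ≤ _ := add_le_add B1 B2
    _ = _ := by ring

end Poisson

/-! ### Strong continuity, and the assembly of the operator of a symbol -/

section Assembly

variable {H : Type*} [NormedAddCommGroup H] [InnerProductSpace ℂ H] [CompleteSpace H] {ι : Type*}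

lemma IsParseval.dense_span {φ : ι → H} (hφ : IsParseval φ) :
    (Submodule.span ℂ (Set.range φ)).topologicalClosure = ⊤ := by
  rw [Submodule.topologicalClosure_eq_top_iff, Submodule.eq_bot_iff]
  intro v hv
  rw [Submodule.mem_orthogonal] at hv
  have h := hφ.hasSum_sq v
  have h0 : ∀ i, inner ℂ (φ i) v = 0 := fun i => hv _ (Submodule.subset_span ⟨i, rfl⟩)
  simp only [h0, norm_zero, ne_eq, OfNat.ofNat_ne_zero, not_false_eq_true, zero_pow] at h
  have := h.unique hasSum_zero
  simpa using this

/-- A family of contractions is strongly continuous if it is so on a Parseval family. -/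
lemma IsParseval.continuous_apply {φ : ι → H} (hφ : IsParseval φ) {X : Type*} [TopologicalSpace X]
    {U : X → H →L[ℂ] H} (hU : ∀ y v, ‖U y v‖ ≤ ‖v‖) (hc : ∀ i, Continuous fun y => U y (φ i))
    (v : H) : Continuous fun y => U y v := by
  have hs : ∀ v ∈ Submodule.span ℂ (Set.range φ), Continuous fun y => U y v := fun v hv => by
    induction hv using Submodule.span_induction with
    | mem x hx => obtain ⟨i, rfl⟩ := hx; exact hc i
    | zero => simpa using continuous_const
    | add x y _ _ hx hy => simpa only [map_add] using! hx.add hy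
    | smul a x _ hx => simpa only [map_smul] using! hx.const_smul a
  have hv : v ∈ closure (Submodule.span ℂ (Set.range φ) : Set H) := by
    rw [← Submodule.topologicalClosure_coe, hφ.dense_span]; trivial
  refine continuous_of_uniform_approx_of_continuous fun u hu => ?_
  obtain ⟨ε, hε, hεu⟩ := Metric.mem_uniformity_dist.1 hu
  obtain ⟨w, hw, hvw⟩ := Metric.mem_closure_iff.1 hv ε hε
  refine ⟨fun y => U y w, hs w hw, fun y => hεu ?_⟩
  rw [dist_eq_norm, ← map_sub]
  exact (hU _ _).trans_lt (by rwa [← dist_eq_norm])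

/-- The fourth power dominates the product of the squares in the two coordinates. This is why the
seminorm of index `4` is taken for the coefficients of a symbol. -/
lemma summable_inv_one_add_norm_pow :
    Summable fun l : ℤ × ℤ => ((1 + ‖l‖) ^ 4)⁻¹ := by
  have h1 := summable_one_add_mul_abs (a := 1) (p := -2) one_pos (by norm_num)
  refine (h1.mul_of_nonneg h1 (fun n => by positivity) fun n => by positivity).of_nonneg_of_le
    (fun l => by positivity) fun l => ?_
  have ha : |(l.1 : ℝ)| ≤ ‖l‖ := (Int.norm_eq_abs l.1).symm.trans_le (norm_fst_le l)
  have hb : |(l.2 : ℝ)| ≤ ‖l‖ := (Int.norm_eq_abs l.2).symm.trans_le (norm_snd_le l)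
  have h2 : (-2 : ℝ) = -((2 : ℕ) : ℝ) := by norm_num
  rw [h2, Real.rpow_neg (by positivity), Real.rpow_neg (by positivity), Real.rpow_natCast,
    Real.rpow_natCast, ← mul_inv, one_mul, one_mul]
  gcongr
  calc _ ≤ (1 + ‖l‖) ^ 2 * (1 + ‖l‖) ^ 2 := by gcongr
    _ = _ := by ring

/-- The sum of the first constants of a symbol. -/
def boundSum (K : ℕ → ℝ) : ℝ := K 0 + K 1 + K 2 + K 3

/-- The operator of a symbol exists and is of trace class, and its trace is the sum of the traces
of the operators of its coefficients, if the matrices of these operators in a Parseval family are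
summable, uniformly in terms of the bounds of the symbol. -/
lemma IsParseval.exists_isOp [Countable ι] {φ : ι → H} (hφ : IsParseval φ)
    {P : ℤ × ℤ → H →L[ℂ] H} (hP : ∀ l v, ‖P l v‖ ≤ ‖v‖) {U : Plane → H →L[ℂ] H}
    (hU : ∀ y v, ‖U y v‖ ≤ ‖v‖) (hUc : ∀ v, Continuous fun y => U y v) {m : ℝ} (hm : m < -2)
    {c : ι × ι → ℝ} (hc : Summable c)
    (hS : ∀ (k : Plane → ℂ) (K : ℕ → ℝ), DecayBound k m K → ∀ S : H →L[ℂ] H,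
      (∀ v, S v = ∫ y, invFT k y • U y v) → ∀ i j, ‖inner ℂ (φ i) (S (φ j))‖ ≤ boundSum K * c (i, j))
    {h : Plane → SmoothB} {A : ℕ → ℝ}
    (hh : ∀ l, DecayBound (fun ξ => (h ξ).coeff l) m fun i => A i * ((1 + ‖l‖) ^ 4)⁻¹) :
    ∃ (T : H →L[ℂ] H) (S : ℤ × ℤ → H →L[ℂ] H), IsOp P U h T ∧ IsTraceClass T ∧
      (∀ l v, S l v = ∫ y, invFT (fun ξ => (h ξ).coeff l) y • U y v) ∧
      (∀ l, IsTraceClass (P l ∘L S l)) ∧ HasSum (fun l => opTrace (P l ∘L S l)) (opTrace T) := by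
  choose S hSv using fun l => exists_integral_operator hU hUc ((hh l).integrable_invFT hm)
  have hs := summable_inv_one_add_norm_pow
  obtain ⟨T, hT, hTs⟩ := _root_.exists_isOp hP hU hUc (h := h)
    (D := fun l => 4 * (A 0 * ((1 + ‖l‖) ^ 4)⁻¹ + A 3 * ((1 + ‖l‖) ^ 4)⁻¹) * decayMass m)
    ((((hs.mul_left _).add (hs.mul_left _)).mul_left _).mul_right _)
    (fun l => continuous_invFT ((hh l).integrable hm)) (fun l y => (hh l).norm_invFT_le hm y) hSv
  have h0 : ∀ i, 0 ≤ A i := fun i => by simpa using (hh 0).nonneg i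
  have hb : 0 ≤ boundSum A := by simp only [boundSum]; linarith [h0 0, h0 1, h0 2, h0 3]
  have hsc : Summable fun p : (ℤ × ℤ) × (ι × ι) =>
      (boundSum A * ((1 + ‖p.1‖) ^ 4)⁻¹) * |c p.2| :=
    Summable.mul_of_nonneg (f := fun l : ℤ × ℤ => boundSum A * ((1 + ‖l‖) ^ 4)⁻¹)
      (g := fun p => |c p|) (hs.mul_left _) hc.abs
      (fun l => mul_nonneg hb (inv_nonneg.2 (by positivity))) fun p => abs_nonneg _
  have hcb : ∀ l (p : ι × ι), ‖inner ℂ (φ p.1) (S l (φ p.2))‖ ≤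
      (boundSum A * ((1 + ‖l‖) ^ 4)⁻¹) * |c p| := fun l p => by
    refine (hS _ _ (hh l) (S l) (hSv l) p.1 p.2).trans ?_
    have : boundSum (fun i => A i * ((1 + ‖l‖) ^ 4)⁻¹) = boundSum A * ((1 + ‖l‖) ^ 4)⁻¹ := by
      simp only [boundSum]; ring
    rw [this]
    gcongr
    exact le_abs_self _
  obtain ⟨h1, h2, h3⟩ := hφ.isTraceClass_sum hP (S := S) (T := T)
    (c := fun l p => (boundSum A * ((1 + ‖l‖) ^ 4)⁻¹) * |c p|) hcb hsc hTs
  exact ⟨T, S, hT, h1, hSv, h2, h3⟩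

end Assembly

/-- For `|λ| ≥ 1` and `i ≥ r N`, the power `(|λ|^(1/r)) ^ i` is at least `|λ| ^ N`. -/
lemma isBigO_of_param_bound {r : ℝ} (hr : 0 < r) {Γ : Set ℂ} {X : ℂ → ℂ}
    (hX : ∀ i : ℕ, 2 ≤ i → ∃ C, ∀ lam ∈ Γ, ‖X lam‖ ≤ C * ((1 + ‖lam‖ ^ (1 / r)) ^ i)⁻¹) (N : ℕ) :
    X =O[Bornology.cobounded ℂ ⊓ Filter.principal Γ] fun lam => (‖lam‖ ^ N)⁻¹ := by
  obtain ⟨i, hi⟩ := exists_nat_ge (r * N)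
  -- The bounds are available from order two on, as required by Poisson summation.
  obtain ⟨C, hC⟩ := hX (i + 2) (by omega)
  refine Asymptotics.IsBigO.of_bound |C| ?_
  rw [Filter.eventually_inf_principal]
  filter_upwards [tendsto_norm_cobounded_atTop.eventually_ge_atTop (1 : ℝ)] with lam h1 hlam
  refine (hC lam hlam).trans ?_
  have h0 : 0 < ‖lam‖ := by linarith
  rw [norm_inv, norm_pow, norm_norm]
  gcongr
  · exact le_abs_self C
  · have hp : 1 ≤ ‖lam‖ ^ (1 / r) := Real.one_le_rpow h1 (by positivity)
    calc ‖lam‖ ^ N = ‖lam‖ ^ (N : ℝ) := (Real.rpow_natCast _ _).symm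
      _ ≤ ‖lam‖ ^ (1 / r * i) := by
          refine Real.rpow_le_rpow_of_exponent_le h1 ?_
          rw [one_div, ← div_eq_inv_mul, le_div_iff₀ hr]
          linarith
      _ = (‖lam‖ ^ (1 / r)) ^ i := by rw [Real.rpow_mul h0.le, Real.rpow_natCast]
      _ ≤ (1 + ‖lam‖ ^ (1 / r)) ^ i := by gcongr; linarith
      _ ≤ _ := pow_le_pow_right₀ (by linarith) (by omega)

/-! ### The trivial bundle -/

section Trivial

/-- The basis vector `π(k)` of `ℓ²(ℤ²)`. -/
noncomputable def ellBasis (k : ℤ × ℤ) : EllTwo := lp.single 2 k (1 : ℂ)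

lemma inner_ellBasis (k : ℤ × ℤ) (v : EllTwo) : inner ℂ (ellBasis k) v = v k := by
  simp [ellBasis, lp.inner_single_left]

lemma isParseval_ellBasis : IsParseval ellBasis := fun u v => by
  refine (lp.hasSum_inner u v).of_eq (fun k => ?_) rfl
  rw [← inner_conj_symm u, inner_ellBasis, inner_ellBasis]
  simp [mul_comm]

lemma e1_eq_exp (s : ℝ) : e1 s = Complex.exp ((2 * Real.pi * s : ℝ) * Complex.I) := rfl

lemma continuous_e1 : Continuous e1 := by unfold e1; fun_prop

variable (g : GL (Fin 2) ℤ) (θ : ℝ)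

lemma norm_alphaT (x : Plane) (v : EllTwo) : ‖alphaT g θ x v‖ = ‖v‖ :=
  LinearIsometry.norm_map _ _

lemma norm_leftReg (k : ℤ × ℤ) (v : EllTwo) : ‖leftReg g θ k v‖ = ‖v‖ :=
  LinearIsometry.norm_map _ _

/-- The lattice point at which the coefficients of a symbol are evaluated. -/
noncomputable def dualPt (k : ℤ × ℤ) : Plane :=
  toPlane (2 * Real.pi / rk g θ * k.1, 2 * Real.pi / rk g θ * k.2)

lemma alphaT_ellBasis (x : Plane) (k : ℤ × ℤ) : alphaT g θ x (ellBasis k) =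
    Complex.exp ((inner ℝ x (dualPt g θ k) : ℝ) * Complex.I) • ellBasis k := by
  ext l
  change e1 (((l.1 : ℝ) * x 0 + (l.2 : ℝ) * x 1) / rk g θ) * ellBasis k l = _
  by_cases hl : l = k
  · subst hl
    rw [lp.coeFn_smul, Pi.smul_apply, smul_eq_mul, e1_eq_exp]
    congr 4
    rw [inner_plane, dualPt, toPlane_zero, toPlane_one]
    ring
  · simp [ellBasis, lp.single_apply, hl]

lemma continuous_alphaT (v : EllTwo) : Continuous fun x => alphaT g θ x v :=
  isParseval_ellBasis.continuous_apply (fun x v => (norm_alphaT g θ x v).le) (fun k => by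
    simp only [alphaT_ellBasis]; fun_prop) v

variable {g θ} {h : Plane → ℂ} {m : ℝ} {K : ℕ → ℝ}

/-- On an eigenvector of the representation the operator integral becomes a scalar Fourier integral,
and Fourier inversion returns the symbol at minus the frequency. -/
lemma integral_alphaT_ellBasis (hh : DecayBound h m K) (hm : m < -2) {S : EllTwo →L[ℂ] EllTwo}
    (hS : ∀ v, S v = ∫ y, invFT h y • alphaT g θ y v) (k : ℤ × ℤ) :
    S (ellBasis k) = h (-dualPt g θ k) • ellBasis k := by
  rw [hS, ← hh.integral_invFT_mul_exp hm, ← integral_smul_const]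
  simp only [alphaT_ellBasis, smul_smul]

lemma inner_ellBasis_ellBasis (j k : ℤ × ℤ) :
    inner ℂ (ellBasis j) (ellBasis k) = if j = k then (1 : ℂ) else 0 := by
  rw [inner_ellBasis]
  simp [ellBasis, lp.single_apply, Pi.single_apply]

lemma leftReg_apply (l : ℤ × ℤ) (v : EllTwo) (k : ℤ × ℤ) :
    leftReg g θ l v k = cocycle g (latticePt g θ l) (latticePt g θ (k - l)) * v (k - l) := rfl

lemma cocycle_latticePt_zero (y : GGroup g) : cocycle g (latticePt g θ 0) y = 1 := by
  simp [cocycle, latticePt, cycPair, e1]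

/-- The matrix of the operator of a symbol on the trivial bundle. -/
lemma leftReg_trace (hh : DecayBound h m K) (hm : m < -2) {S : EllTwo →L[ℂ] EllTwo}
    (hS : ∀ v, S v = ∫ y, invFT h y • alphaT g θ y v) (l k : ℤ × ℤ) :
    inner ℂ (ellBasis k) ((leftReg g θ l ∘L S) (ellBasis k)) =
      if l = 0 then h (-dualPt g θ k) else 0 := by
  rw [inner_ellBasis, ContinuousLinearMap.comp_apply, integral_alphaT_ellBasis hh hm hS, map_smul,
    lp.coeFn_smul, Pi.smul_apply, leftReg_apply]
  split_ifs with hl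
  · subst hl
    simp [cocycle_latticePt_zero, ellBasis]
  · simp [ellBasis, lp.single_apply, hl]

/-- The operators `S l` are diagonal and `leftReg` shifts the basis, so only `l = 0` has a diagonal;
its trace is a lattice sum of the symbol, compared with the integral by Poisson summation. -/
theorem trivial_bundle_trace (hrk : rk g θ ≠ 0) {r : ℝ} (hr : 0 < r) {Γ : Set ℂ} (hm : m < -2)
    {f : Plane → ℂ → SmoothB} (hf : IsParamSymbol r m Γ f) :
    ∃ T : ℂ → EllTwo →L[ℂ] EllTwo,
      (∀ lam ∈ Γ, IsOp (leftReg g θ) (alphaT g θ) (fun ξ => f ξ lam) (T lam) ∧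
        IsTraceClass (T lam)) ∧
      ∀ N : ℕ, (fun lam => opTrace (T lam) -
          (|rk g θ| ^ 2 : ℝ) • ((((2 * Real.pi) ^ 2)⁻¹ : ℝ) • ∫ ξ, phiB (f ξ lam).coeff))
        =O[Bornology.cobounded ℂ ⊓ Filter.principal Γ] fun lam => (‖lam‖ ^ N)⁻¹ := by
  obtain ⟨C, hC0, hC⟩ := hf.decayBound (by linarith)
  -- The signed spacing of the points at which the symbol is evaluated; `(a ^ 2)⁻¹` is `|rk g θ| ^ 2
  -- / (2π)²`, the constant of the theorem.
  set a := -(2 * Real.pi / rk g θ) with ha_def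
  have hpi := Real.pi_pos
  have ha : a ≠ 0 := by rw [ha_def]; exact neg_ne_zero.2 (div_ne_zero (by positivity) hrk)
  have hdual : ∀ k, -dualPt g θ k = toPlane (a * k.1, a * k.2) := fun k => by
    ext i; fin_cases i <;> simp [dualPt, toPlane, ha_def]
  set w : ℝ → ℝ := fun t => (1 + |a| * |t|) ^ (m / 2) with hw
  have hws : Summable fun n : ℤ => w n := summable_one_add_mul_abs (abs_pos.2 ha) (by linarith)
  have hw0 : ∀ t, 0 ≤ w t := fun t => by simp only [hw]; positivity
  have key : ∀ lam ∈ Γ, ∃ T : EllTwo →L[ℂ] EllTwo,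
      (IsOp (leftReg g θ) (alphaT g θ) (fun ξ => f ξ lam) T ∧ IsTraceClass T) ∧
      opTrace T = ∑' k : ℤ × ℤ, (f (toPlane (a * k.1, a * k.2)) lam).coeff 0 := fun lam hlam => by
    let A : ℕ → ℝ := fun i => C 4 i * ((1 + ‖lam‖ ^ (1 / r)) ^ i)⁻¹
    have hA : ∀ l, DecayBound (fun ξ => (f ξ lam).coeff l) m fun i => A i * ((1 + ‖l‖) ^ 4)⁻¹ :=
      fun l => by
        have := hC lam hlam 4 l
        simpa only [A, mul_right_comm] using this
    have hcs : Summable fun p : (ℤ × ℤ) × (ℤ × ℤ) =>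
        if p.1 = p.2 then w p.2.1 * w p.2.2 else 0 := by
      have h1 : Function.Injective fun k : ℤ × ℤ => (k, k) := fun a b h => congrArg Prod.fst h
      rw [← h1.summable_iff]
      · simpa [Function.comp_def] using hws.mul_of_nonneg hws (fun n => hw0 n) fun n => hw0 n
      · rintro ⟨i, j⟩ hij
        rw [if_neg]
        rintro (h : i = j)
        exact hij ⟨i, by rw [h]⟩
    have hmat : ∀ (k : Plane → ℂ) (K : ℕ → ℝ), DecayBound k m K → ∀ S : EllTwo →L[ℂ] EllTwo,
        (∀ v, S v = ∫ y, invFT k y • alphaT g θ y v) → ∀ i j,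
        ‖inner ℂ (ellBasis i) (S (ellBasis j))‖ ≤
          boundSum K * if i = j then w j.1 * w j.2 else 0 := by
      intro k K hk S hS i j
      rw [integral_alphaT_ellBasis hk hm hS, inner_smul_right, inner_ellBasis_ellBasis]
      have h0 := fun i => hk.nonneg i
      by_cases hij : i = j
      · simp only [hij, if_true, mul_one]
        refine (hk.norm_le _).trans ?_
        have h1 := one_add_norm_rpow_le (m := m) (by linarith) (-dualPt g θ j)
        rw [hdual] at h1 ⊢
        simp only [toPlane_zero, toPlane_one, abs_mul] at h1
        refine mul_le_mul ?_ h1 (by positivity) ?_ <;> simp only [boundSum] <;>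
          linarith [h0 0, h0 1, h0 2, h0 3]
      · simp [hij]
    obtain ⟨T, S, hT, hTt, hS, hSt, htr⟩ := isParseval_ellBasis.exists_isOp (P := leftReg g θ)
      (fun l v => (norm_leftReg g θ l v).le) (fun y v => (norm_alphaT g θ y v).le)
      (continuous_alphaT g θ) hm (h := fun ξ => f ξ lam) (A := A)
      (c := fun p => if p.1 = p.2 then w p.2.1 * w p.2.2 else 0) hcs hmat hA
    · refine ⟨T, ⟨hT, hTt⟩, ?_⟩
      have h1 : ∀ l, HasSum (fun k : ℤ × ℤ => if l = 0 then (f (toPlane (a * k.1, a * k.2)) lam).coeff l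
          else 0) (opTrace (leftReg g θ l ∘L S l)) := fun l => by
        refine ((hSt l).hasSum_opTrace isParseval_ellBasis).of_eq (fun k => ?_) rfl
        rw [leftReg_trace (hA l) hm (hS l), hdual]
      have h2 : ∀ l, l ≠ 0 → opTrace (leftReg g θ l ∘L S l) = 0 := fun l hl => by
        have := h1 l
        simp only [hl, if_false] at this
        exact this.unique hasSum_zero
      rw [← htr.tsum_eq, tsum_eq_single 0 h2, ← (h1 0).tsum_eq]
      simp
  -- Outside `Γ` the operator has a default value, invisible to a filter below the principal filter
  -- of `Γ`.
  choose! T hT htr using key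
  refine ⟨T, hT, fun N => isBigO_of_param_bound hr (fun i hi => ?_) N⟩
  refine ⟨intZeta i * (|a| ^ i * C 0 i) * (∫ x : ℝ, w x) *
    ((∑' n : ℤ, w n) + ∫ x : ℝ, w x), fun lam hlam => ?_⟩
  have h1 := ((hC lam hlam 0 0).norm_tsum_sub_integral_le hm ha hi).2
  have h2 : (|rk g θ| ^ 2 : ℝ) • ((((2 * Real.pi) ^ 2)⁻¹ : ℝ) • ∫ ξ, phiB (f ξ lam).coeff) =
      ((a ^ 2)⁻¹ : ℝ) • ∫ ξ, (f ξ lam).coeff 0 := by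
    rw [smul_smul]
    congr 1
    rw [ha_def, sq_abs]
    field_simp
  rw [htr lam hlam, h2]
  refine h1.trans_eq ?_
  simp only [pow_zero, inv_one, mul_one, ← hw]
  ring

end Trivial

/-! ### A smooth window with orthonormal translates -/

section Window

/-- A smooth function supported in `[-1, 1]` whose integer translates have squares that sum up
to one. -/
noncomputable def win (t : ℝ) : ℝ :=
  Real.sin (Real.pi / 2 * Real.smoothTransition (t + 1)) *
    Real.cos (Real.pi / 2 * Real.smoothTransition t)

lemma contDiff_win : ContDiff ℝ ((⊤ : ℕ∞) : WithTop ℕ∞) win := by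
  have h : ContDiff ℝ ((⊤ : ℕ∞) : WithTop ℕ∞) Real.smoothTransition := Real.smoothTransition.contDiff
  unfold win
  exact (Real.contDiff_sin.comp (contDiff_const.mul (h.comp (contDiff_id.add contDiff_const)))).mul
    (Real.contDiff_cos.comp (contDiff_const.mul h))

lemma continuous_win : Continuous win := contDiff_win.continuous

lemma win_eq_zero {t : ℝ} (ht : 1 ≤ |t|) : win t = 0 := by
  rcases le_abs.1 ht with h | h
  · simp [win, Real.smoothTransition.one_of_one_le h]
  · simp [win, Real.smoothTransition.zero_of_nonpos (by linarith : t + 1 ≤ 0)]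

lemma abs_win_le (t : ℝ) : |win t| ≤ 1 := by
  rw [win, abs_mul]
  exact mul_le_one₀ (Real.abs_sin_le_one _) (abs_nonneg _) (Real.abs_cos_le_one _)

/-- Over `[0, 1]` one factor of each translate is constant, and what remains is the cosine and the
sine of the same angle. -/
lemma win_sq_add {t : ℝ} (h0 : 0 ≤ t) (h1 : t ≤ 1) : win t ^ 2 + win (t - 1) ^ 2 = 1 := by
  have e1 : win t = Real.cos (Real.pi / 2 * Real.smoothTransition t) := by
    simp [win, Real.smoothTransition.one_of_one_le (by linarith : 1 ≤ t + 1)]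
  have e2 : win (t - 1) = Real.sin (Real.pi / 2 * Real.smoothTransition t) := by
    simp [win, Real.smoothTransition.zero_of_nonpos (by linarith : t - 1 ≤ 0)]
  rw [e1, e2, Real.cos_sq_add_sin_sq]

lemma hasSum_win_sq (t : ℝ) : HasSum (fun j : ℤ => win (t + j) ^ 2) 1 := by
  have h0 := Int.fract_nonneg t
  have h1 := Int.fract_lt_one t
  have ht : t = Int.fract t + ⌊t⌋ := (Int.fract_add_floor t).symm
  have hne : -⌊t⌋ ≠ -⌊t⌋ - 1 := by omega
  rw [← win_sq_add h0 h1.le]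
  -- Only the two translates that bring `t` to its fractional part, or to that minus one, meet the
  -- support `[-1, 1]`.
  have hz : ∀ j : ℤ, j ∉ ({-⌊t⌋, -⌊t⌋ - 1} : Finset ℤ) → win (t + j) ^ 2 = 0 := fun j hj => ?_
  · have : HasSum _ _ := hasSum_sum_of_ne_finset_zero hz
    rw [Finset.sum_pair hne] at this
    refine this.of_eq (fun _ => rfl) ?_
    push_cast
    congr 3
    rw [← Int.self_sub_floor]
    ring
  · simp only [Finset.mem_insert, Finset.mem_singleton, not_or] at hj
    have : 1 ≤ |t + j| := by
      rcases lt_or_gt_of_ne hj.1 with h | h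
      · have h2 : j ≤ -⌊t⌋ - 2 := by omega
        have h3 : (j : ℝ) ≤ -⌊t⌋ - 2 := by exact_mod_cast h2
        rw [abs_of_neg (by linarith)]
        linarith
      · have h2 : -⌊t⌋ + 1 ≤ j := by omega
        have h3 : -(⌊t⌋ : ℝ) + 1 ≤ j := by exact_mod_cast h2
        exact le_abs.2 (Or.inl (by linarith))
    simp [win_eq_zero this]

lemma integrable_win_sq : Integrable fun t => win t ^ 2 := by
  refine Continuous.integrable_of_hasCompactSupport (continuous_win.pow 2)
    (HasCompactSupport.of_support_subset_isCompact (isCompact_Icc (a := -1) (b := 1)) fun t ht => ?_)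
  by_contra h
  refine ht ?_
  have : 1 ≤ |t| := by
    by_contra h2
    exact h (abs_le.1 (not_le.1 h2).le)
  simp [win_eq_zero this]

/-- The integral over the line folds onto `[0, 1]`, where the squares of the translates sum to one.
-/
lemma integral_win_sq : ∫ t, win t ^ 2 = 1 := by
  have h := integrable_win_sq.hasSum_intervalIntegral_comp_add_int
  have h2 := intervalIntegral.hasSum_integral_of_dominated_convergence (a := 0) (b := 1)
    (μ := volume) (F := fun (n : ℤ) t => win (t + n) ^ 2) (f := fun _ => 1)
    (fun n t => win (t + n) ^ 2) (fun n => ((continuous_win.comp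
      (continuous_id.add continuous_const)).pow 2).aestronglyMeasurable)
    (fun n => Filter.Eventually.of_forall fun t _ => by
      rw [Real.norm_of_nonneg (by positivity)])
    (Filter.Eventually.of_forall fun t _ => (hasSum_win_sq t).summable)
    (by simp only [(hasSum_win_sq _).tsum_eq]; exact intervalIntegrable_const)
    (Filter.Eventually.of_forall fun t _ => hasSum_win_sq t)
  rw [h.unique h2]
  simp

end Window

/-! ### A Parseval family in `L²(ℝ × ℤ / c ℤ)` -/

section Frame

lemma hasSum_prod_of_nonneg {β γ : Type*} {f : β × γ → ℝ} (hf : ∀ p, 0 ≤ f p) {s : β → ℝ} {a : ℝ}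
    (h1 : ∀ b, HasSum (fun c => f (b, c)) (s b)) (h2 : HasSum s a) : HasSum f a := by
  have hs : Summable f := by
    rw [summable_prod_of_nonneg hf]
    exact ⟨fun b => (h1 b).summable, h2.summable.congr fun b => (h1 b).tsum_eq.symm⟩
  rw [← (hs.hasSum.prod_fiberwise h1).unique h2]
  exact hs.hasSum

variable (g : GL (Fin 2) ℤ)

/-- The window on the identity component. -/
noncomputable def winM (p : MGroup g) : ℂ := if p.2 = 0 then ((win p.1 / √2 : ℝ) : ℂ) else 0

lemma measurable_winM : Measurable (winM g) := by
  refine Measurable.ite (measurable_snd (measurableSet_singleton _)) ?_ measurable_const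
  exact Complex.measurable_ofReal.comp ((continuous_win.measurable.comp measurable_fst).div_const _)

lemma norm_winM_sq (p : MGroup g) : ‖winM g p‖ ^ 2 = if p.2 = 0 then win p.1 ^ 2 / 2 else 0 := by
  unfold winM
  split_ifs
  · rw [Complex.norm_real, Real.norm_eq_abs, sq_abs, div_pow, Real.sq_sqrt (by norm_num)]
  · simp

lemma norm_heis (y : GGroup g) (u : L2M g) : ‖heis g y u‖ = ‖u‖ := LinearIsometry.norm_map _ _

lemma conj_e1 (s : ℝ) : starRingEnd ℂ (e1 s) = e1 (-s) := by
  rw [e1, e1, ← Complex.exp_conj, map_mul, Complex.conj_ofReal, Complex.conj_I]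
  congr 1
  push_cast
  ring

lemma integrable_norm_sq (v : L2M g) : Integrable (fun p => ‖v p‖ ^ 2) (haarM g) :=
  (memLp_two_iff_integrable_sq_norm (Lp.aestronglyMeasurable v)).1 (Lp.memLp v)

variable [NeZero (g.1 1 0).natAbs]

lemma integral_haarM {E : Type*} [NormedAddCommGroup E] [NormedSpace ℝ E]
    [CompleteSpace E] {G : MGroup g → E} (hG : Integrable G (haarM g)) :
    (∀ α, Integrable fun t => G (t, α)) ∧ ∫ p, G p ∂haarM g = ∑ α, ∫ t, G (t, α) := by
  have h1 := ((integrable_prod_iff' hG.1).1 hG).1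
  have h2 : ∀ α, Integrable fun t => G (t, α) := by
    -- A null set for the counting measure is empty, so integrability holds on every fibre and not
    -- merely on almost every one.
    rw [ae_iff, Measure.count_eq_zero_iff, Set.eq_empty_iff_forall_notMem] at h1
    simpa using h1
  refine ⟨h2, ?_⟩
  rw [integral_prod_symm _ hG, integral_fintype]
  · simp
  · exact .of_finite

lemma memLp_winM : MemLp (winM g) 2 (haarM g) := by
  rw [memLp_two_iff_integrable_sq_norm (measurable_winM g).aestronglyMeasurable]
  have : (fun p => ‖winM g p‖ ^ 2) = fun p : ℝ × Zc g =>
      (win p.1 ^ 2) * (if p.2 = 0 then 1 / 2 else 0) := by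
    ext p; rw [norm_winM_sq]; split_ifs <;> ring
  rw [this]
  exact integrable_win_sq.mul_prod (g := fun α : Zc g => if α = 0 then (1 / 2 : ℝ) else 0) .of_finite

/-- The window as a vector of `L²`. -/
noncomputable def phi0 : L2M g := (memLp_winM g).toLp

lemma heis_phi0_coeFn (y : GGroup g) : heis g y (phi0 g) =ᵐ[haarM g] fun p =>
    e1 (y.1.1 * y.2.1 / 2 + p.1 * y.2.1 + cycPair g p.2 y.2.2) * winM g (p + y.1) := by
  have hτ := (measurePreserving_add_right (haarM g) y.1).quasiMeasurePreserving
  filter_upwards [heis_coeFn g y (phi0 g), hτ.ae (memLp_winM g).coeFn_toLp] with p h1 h2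
  rw [h1, ← h2]
  rfl

/-- The lattice of the Parseval family. -/
noncomputable def framePt (z : Zc g × (ℤ × ℤ)) : GGroup g :=
  (((z.2.1 : ℝ), z.1), ((z.2.2 : ℝ) / 2, 0))

/-- The members of the Parseval family. -/
noncomputable def frame (z : Zc g × (ℤ × ℤ)) : L2M g := heis g (framePt g z) (phi0 g)

lemma cycPair_zero (α : Zc g) : cycPair g α 0 = 0 := by simp [cycPair]

/-- The window lives on the identity component, so only the component `-z.1` of `v` is seen. -/
lemma inner_frame (z : Zc g × (ℤ × ℤ)) (v : L2M g) :
    inner ℂ (frame g z) v = e1 (-(z.2.1 * (z.2.2 / 2) / 2)) * ∫ t : ℝ,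
      e1 (-(z.2.2 * t / 2)) * (((win (t + z.2.1) / √2 : ℝ) : ℂ) * v (t, -z.1)) := by
  rw [L2.inner_def, integral_congr_ae (g := fun p : MGroup g =>
    e1 (-(z.2.1 * (z.2.2 / 2) / 2)) * (e1 (-(z.2.2 * p.1 / 2)) *
      (starRingEnd ℂ (winM g (p + (framePt g z).1)) * v p))), (integral_haarM g _).2]
  · rw [Finset.sum_eq_single (-z.1)]
    · rw [← integral_const_mul]
      congr 1
      ext t
      simp [winM, framePt]
    · intro α _ hα
      have : α + z.1 ≠ 0 := fun h => hα (eq_neg_of_add_eq_zero_left h)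
      simp [winM, framePt, this]
    · simp
  · refine (L2.integrable_inner (𝕜 := ℂ) (frame g z) v).congr ?_
    filter_upwards [heis_phi0_coeFn g (framePt g z)] with p hp
    rw [frame, hp, RCLike.inner_apply]
    simp only [framePt, cycPair_zero, add_zero, e1_add, map_mul, conj_e1]
    rw [show p.1 * ((z.2.2 : ℝ) / 2) = z.2.2 * p.1 / 2 by ring]
    ring
  · filter_upwards [heis_phi0_coeFn g (framePt g z)] with p hp
    rw [frame, hp, RCLike.inner_apply]
    simp only [framePt, cycPair_zero, add_zero, e1_add, map_mul, conj_e1]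
    rw [show p.1 * ((z.2.2 : ℝ) / 2) = z.2.2 * p.1 / 2 by ring]
    ring

lemma norm_sq_L2M (v : L2M g) : ‖v‖ ^ 2 = ∑ α, ∫ t, ‖v (t, α)‖ ^ 2 := by
  rw [← (integral_haarM g (integrable_norm_sq g v)).2]
  have h := L2.inner_def (𝕜 := ℂ) v v
  have h2 : ∀ p, inner ℂ (v p) (v p) = ((‖v p‖ ^ 2 : ℝ) : ℂ) := fun p => by
    rw [inner_self_eq_norm_sq_to_K]; norm_cast
  simp only [h2, integral_complex_ofReal] at h
  rw [inner_self_eq_norm_sq_to_K] at h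
  exact Complex.ofReal_injective (by simpa using h)

/-- The translated window is supported in an interval of length `2`, for which the frequencies in
`½ℤ` are exactly those of a Fourier series. Parseval for this series carries the factor `1/2` of the
interval length, and the `1/√2` in the window compensates it. -/
lemma hasSum_frame_frequency (v : L2M g) (β : Zc g) (j : ℤ) :
    HasSum (fun n : ℤ => ‖inner ℂ (frame g (β, (j, n))) v‖ ^ 2)
      (∫ t, win (t + j) ^ 2 * ‖v (t, -β)‖ ^ 2) := by
  let F : ℝ → ℂ := fun t => (win (t + j) : ℂ) * v (t, -β)
  have hvm : StronglyMeasurable fun t => v (t, -β) :=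
    (Lp.stronglyMeasurable v).comp_measurable (by fun_prop)
  have hvi := (integral_haarM g (integrable_norm_sq g v)).1 (-β)
  have hv2 : MemLp (fun t => v (t, -β)) 2 volume :=
    (memLp_two_iff_integrable_sq_norm hvm.aestronglyMeasurable).2 hvi
  have hcw : Continuous fun t => ((win (t + j) : ℝ) : ℂ) :=
    Complex.continuous_ofReal.comp (continuous_win.comp (by fun_prop))
  have hF2 : MemLp F 2 volume := by
    refine hv2.of_le (hcw.aestronglyMeasurable.mul hvm.aestronglyMeasurable)
      (Filter.Eventually.of_forall fun t => ?_)
    rw [norm_mul, Complex.norm_real]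
    exact mul_le_of_le_one_left (norm_nonneg _) (abs_win_le _)
  have hab : -(j : ℝ) - 1 < -j + 1 := by linarith
  have hsupp : ∀ t, t ∉ Set.Ioc (-(j : ℝ) - 1) (-j + 1) → F t = 0 := fun t ht => by
    have : 1 ≤ |t + j| := by
      by_contra h
      rw [not_le, abs_lt] at h
      exact ht ⟨by linarith, by linarith⟩
    simp [F, win_eq_zero this]
  have h := (hasSum_sq_fourierCoeffOn hab (hF2.mono_measure Measure.restrict_le_self)).mul_left 2
  refine h.of_eq (fun n => ?_) ?_
  · rw [fourierCoeffOn_eq_integral, inner_frame, norm_mul, norm_e1, one_mul,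
      intervalIntegral.integral_of_le hab.le, setIntegral_eq_integral_of_forall_compl_eq_zero]
    · have h2 : -(j : ℝ) + 1 - (-j - 1) = 2 := by ring
      have h3 : ∀ t : ℝ, e1 (-(n * t / 2)) * (((win (t + j) / √2 : ℝ) : ℂ) * v (t, -β)) =
          ((1 / √2 : ℝ) : ℂ) *
            (fourier (-n) (t : AddCircle (-(j : ℝ) + 1 - (-j - 1))) • F t) := fun t => by
        rw [fourier_coe_apply, h2, e1_eq_exp, smul_eq_mul]
        have : Complex.exp (((2 * Real.pi * -(n * t / 2) : ℝ) : ℂ) * Complex.I) =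
            Complex.exp (2 * Real.pi * Complex.I * ((-n : ℤ) : ℂ) * t / ((2 : ℝ) : ℂ)) := by
          congr 1; push_cast; ring
        rw [this]
        simp only [F]
        push_cast
        ring
      simp only [h3]
      rw [integral_const_mul, norm_mul, norm_smul, h2, Complex.norm_real,
        Real.norm_of_nonneg (by positivity), mul_pow, div_pow, Real.sq_sqrt (by norm_num)]
      norm_num
      ring
    · intro t ht
      rw [hsupp t ht, smul_zero]
  · have h2 : -(j : ℝ) + 1 - (-j - 1) = 2 := by ring
    rw [intervalIntegral.integral_of_le hab.le, setIntegral_eq_integral_of_forall_compl_eq_zero, h2]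
    · rw [smul_eq_mul, ← mul_assoc, mul_inv_cancel₀ (by norm_num), one_mul]
      congr 1
      ext t
      simp only [F, norm_mul, mul_pow, Complex.norm_real, Real.norm_eq_abs, sq_abs]
    · intro t ht
      rw [hsupp t ht]; simp

/-- The sum over frequencies is a Fourier series, the sum over translates is the partition of unity
`hasSum_win_sq`, and the sum over `β` runs through the components. All terms are nonnegative, so the
iterated sums give the sum over the product. -/
lemma isParseval_frame : IsParseval (frame g) := by
  refine isParseval_of_hasSum_sq fun v => ?_
  rw [norm_sq_L2M]
  have h1 : ∀ β : Zc g, HasSum (fun j : ℤ => ∫ t, win (t + j) ^ 2 * ‖v (t, -β)‖ ^ 2)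
      (∫ t, ‖v (t, -β)‖ ^ 2) := fun β => by
    have hvm : StronglyMeasurable fun t => v (t, -β) :=
      (Lp.stronglyMeasurable v).comp_measurable (by fun_prop)
    have hvi := (integral_haarM g (integrable_norm_sq g v)).1 (-β)
    have hw : ∀ t, HasSum (fun j : ℤ => win (t + j) ^ 2 * ‖v (t, -β)‖ ^ 2) (‖v (t, -β)‖ ^ 2) :=
      fun t => by simpa using (hasSum_win_sq t).mul_right (‖v (t, -β)‖ ^ 2)
    refine hasSum_integral_of_dominated_convergence (μ := volume)
      (fun (j : ℤ) t => win (t + j) ^ 2 * ‖v (t, -β)‖ ^ 2) (fun j => ?_)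
      (fun j => Filter.Eventually.of_forall fun t => (Real.norm_of_nonneg (by positivity)).le)
      (Filter.Eventually.of_forall fun t => (hw t).summable) ?_
      (Filter.Eventually.of_forall fun t => hw t)
    · exact ((continuous_win.comp (by fun_prop)).pow 2).aestronglyMeasurable.mul
        (hvm.norm.pow 2).aestronglyMeasurable
    · simpa only [(hw _).tsum_eq] using hvi
  refine hasSum_prod_of_nonneg (fun _ => by positivity) (s := fun β => ∫ t, ‖v (t, -β)‖ ^ 2)
    (fun β => hasSum_prod_of_nonneg (fun _ => by positivity)
      (fun j => hasSum_frame_frequency g v β j) (h1 β)) ?_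
  rw [← Equiv.sum_comp (Equiv.neg (Zc g)) fun α => ∫ t, ‖v (t, α)‖ ^ 2]
  exact hasSum_fintype _

end Frame

/-! ### The ambiguity function of the window is a Schwartz function -/

section Ambiguity

open scoped FourierTransform

lemma hasDerivAt_e1 (s : ℝ) : HasDerivAt e1 (2 * Real.pi * Complex.I * e1 s) s := by
  have h1 : HasDerivAt (fun s : ℝ => ((2 * Real.pi * s : ℝ) : ℂ) * Complex.I)
      (((2 * Real.pi * 1 : ℝ) : ℂ) * Complex.I) s :=
    (((hasDerivAt_id s).const_mul (2 * Real.pi)).ofReal_comp).mul_const Complex.I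
  have h2 := h1.cexp
  unfold e1
  convert h2 using 1
  push_cast
  ring

/-- The partial Fourier transform `∫ exp(2 π i y₁ p) R(p, y₀) dp`. -/
noncomputable def partialFT {E : Type*} [NormedAddCommGroup E] [NormedSpace ℂ E]
    (R : ℝ × ℝ → E) (y : Plane) : E := ∫ p : ℝ, e1 (y 1 * p) • R (p, y 0)

/-- The symbol whose partial Fourier transform is the derivative of that of `R`. -/
noncomputable def partialFTDeriv {E : Type*} [NormedAddCommGroup E] [NormedSpace ℂ E]
    (R : ℝ × ℝ → E) (x : ℝ × ℝ) : Plane →L[ℝ] E :=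
  (fderiv ℝ R x).comp ((ContinuousLinearMap.inr ℝ ℝ ℝ).comp (EuclideanSpace.proj 0)) +
    (2 * Real.pi * Complex.I * x.1 : ℂ) •
      (EuclideanSpace.proj 1 : Plane →L[ℝ] ℝ).smulRight (R x)

section

variable {E : Type*} [NormedAddCommGroup E] [NormedSpace ℂ E] {R : ℝ × ℝ → E}

lemma contDiff_partialFTDeriv (hR : ContDiff ℝ ((⊤ : ℕ∞) : WithTop ℕ∞) R) :
    ContDiff ℝ ((⊤ : ℕ∞) : WithTop ℕ∞) (partialFTDeriv R) := by
  unfold partialFTDeriv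
  have h1 : ContDiff ℝ ((⊤ : ℕ∞) : WithTop ℕ∞) (fderiv ℝ R) :=
    hR.fderiv_right (by exact_mod_cast le_rfl)
  have h2 : ContDiff ℝ ((⊤ : ℕ∞) : WithTop ℕ∞)
      fun x : ℝ × ℝ => (2 * Real.pi * Complex.I * x.1 : ℂ) :=
    contDiff_const.mul (Complex.ofRealCLM.contDiff.comp contDiff_fst)
  exact (h1.clm_comp contDiff_const).add (h2.smul (contDiff_const.smulRight hR))

lemma hasCompactSupport_partialFTDeriv (hR : HasCompactSupport R) :
    HasCompactSupport (partialFTDeriv R) := by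
  have h1 := (hR.fderiv ℝ).comp_left
    (g := fun L : ℝ × ℝ →L[ℝ] E =>
      L.comp ((ContinuousLinearMap.inr ℝ ℝ ℝ).comp (EuclideanSpace.proj (𝕜 := ℝ) (ι := Fin 2) 0)))
    (by simp)
  have h2 := (hR.comp_left (g := fun e : E =>
    (EuclideanSpace.proj 1 : Plane →L[ℝ] ℝ).smulRight e) (by ext; simp)).smul_left
    (f := fun x : ℝ × ℝ => (2 * Real.pi * Complex.I * x.1 : ℂ))
  exact h1.add h2

/-- A majorant integrable in `p` and uniform in `q`, as dominated convergence and differentiation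
under the integral require. -/
lemma exists_decay_bound {F : Type*} [NormedAddCommGroup F] {R : ℝ × ℝ → F} (hR : Continuous R)
    (hs : HasCompactSupport R) (M : ℕ) :
    ∃ C, ∀ p q : ℝ, |q| ^ M * ‖R (p, q)‖ ≤ C * (1 + p ^ 2)⁻¹ := by
  obtain ⟨C, hC⟩ := Continuous.bounded_above_of_compact_support
    (f := fun x : ℝ × ℝ => |x.2| ^ M * (1 + x.1 ^ 2) * ‖R x‖) (by fun_prop)
    (hs.mono fun x hx h => hx (by simp [h]))
  refine ⟨C, fun p q => ?_⟩
  have h := (le_abs_self _).trans (hC (p, q))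
  rw [← div_eq_mul_inv, le_div_iff₀ (by positivity)]
  linarith

lemma integrable_partialFT (hR : Continuous R) (hs : HasCompactSupport R) (y : Plane) :
    Integrable fun p : ℝ => e1 (y 1 * p) • R (p, y 0) := by
  obtain ⟨C, hC⟩ := exists_decay_bound hR hs 0
  refine (integrable_inv_one_add_sq.const_mul C).mono' (Continuous.aestronglyMeasurable ?_)
    (Filter.Eventually.of_forall fun p => ?_)
  · exact (continuous_e1.comp (by fun_prop)).smul (hR.comp (by fun_prop))
  · simpa [norm_smul, norm_e1] using hC p (y 0)

lemma hasFDerivAt_partialFT [CompleteSpace E] (hR : ContDiff ℝ ((⊤ : ℕ∞) : WithTop ℕ∞) R)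
    (hs : HasCompactSupport R) (y : Plane) :
    HasFDerivAt (partialFT R) (partialFT (partialFTDeriv R) y) y := by
  have hR' := (contDiff_partialFTDeriv hR).continuous
  have hs' := hasCompactSupport_partialFTDeriv hs
  obtain ⟨C, hC⟩ := exists_decay_bound hR' hs' 0
  unfold partialFT
  refine hasFDerivAt_integral_of_dominated_of_fderiv_le (s := Set.univ)
    (F := fun (y : Plane) (p : ℝ) => e1 (y 1 * p) • R (p, y 0))
    (F' := fun (y : Plane) (p : ℝ) => e1 (y 1 * p) • partialFTDeriv R (p, y 0))
    (bound := fun p => C * (1 + p ^ 2)⁻¹) Filter.univ_mem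
    (Filter.Eventually.of_forall fun y =>
      (integrable_partialFT hR.continuous hs y).aestronglyMeasurable)
    (integrable_partialFT hR.continuous hs y)
    (integrable_partialFT hR' hs' y).aestronglyMeasurable
    (Filter.Eventually.of_forall fun p y _ => by simpa [norm_smul, norm_e1] using hC p (y 0))
    (integrable_inv_one_add_sq.const_mul C)
    (Filter.Eventually.of_forall fun p y _ => ?_)
  have h1 : HasFDerivAt (fun y : Plane => y 1 * p) (p • (EuclideanSpace.proj 1 : Plane →L[ℝ] ℝ)) y :=
    (EuclideanSpace.proj 1 : Plane →L[ℝ] ℝ).hasFDerivAt.mul_const p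
  have h2 := (hasDerivAt_e1 (y 1 * p)).hasFDerivAt.comp y h1
  have h3 : HasFDerivAt (fun y : Plane => (p, y 0))
      ((ContinuousLinearMap.inr ℝ ℝ ℝ).comp (EuclideanSpace.proj 0 : Plane →L[ℝ] ℝ)) y := by
    have := (hasFDerivAt_const p y).prodMk
      (EuclideanSpace.proj 0 : Plane →L[ℝ] ℝ).hasFDerivAt
    exact this.congr_fderiv (by ext <;> simp)
  have h4 := ((hR.differentiable (by simp)) (p, y 0)).hasFDerivAt.comp y h3
  refine (h2.smul h4).congr_fderiv ?_
  ext z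
  simp only [partialFTDeriv, add_apply, smul_apply, ContinuousLinearMap.comp_apply,
    ContinuousLinearMap.smulRight_apply, ContinuousLinearMap.toSpanSingleton_apply, smul_add]
  simp only [← Complex.coe_smul, smul_smul, smul_eq_mul, Function.comp_apply]
  congr 2
  push_cast
  ring

end

/-- The derivative of a partial Fourier transform is the partial Fourier transform of
`partialFTDeriv R`, again smooth with compact support but with values in a larger space. The
induction therefore quantifies over all target spaces `E`, and only order zero needs an estimate:
compact support gives decay in `y 0`, integration by parts in `p` gives decay in `y 1`. -/
lemma partialFT_decay (n : ℕ) : ∀ (E : Type) [NormedAddCommGroup E] [NormedSpace ℂ E]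
    [CompleteSpace E] (R : ℝ × ℝ → E), ContDiff ℝ ((⊤ : ℕ∞) : WithTop ℕ∞) R →
    HasCompactSupport R → ContDiff ℝ n (partialFT R) ∧
      ∀ M : ℕ, ∃ C, ∀ y, ‖y‖ ^ M * ‖iteratedFDeriv ℝ n (partialFT R) y‖ ≤ C := by
  induction n with
  | zero =>
    intro E _ _ _ R hR hs
    have hdiff : Differentiable ℝ (partialFT R) := fun y =>
      (hasFDerivAt_partialFT hR hs y).differentiableAt
    refine ⟨contDiff_zero.2 hdiff.continuous, fun M => ?_⟩
    obtain ⟨C, hC⟩ := exists_decay_bound hR.continuous hs M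
    obtain ⟨C', hC'⟩ := exists_decay_bound
      (hR.continuous_iteratedFDeriv (m := M) (by exact_mod_cast le_top)) (hs.iteratedFDeriv M) 0
    refine ⟨2 ^ (M - 1) * (C * Real.pi + C' * Real.pi), fun y => ?_⟩
    have hint : ∀ c : ℝ, ∫ p : ℝ, c * (1 + p ^ 2)⁻¹ = c * Real.pi := fun c => by
      rw [integral_const_mul, integral_univ_inv_one_add_sq]
    have b0 : |y 0| ^ M * ‖partialFT R y‖ ≤ C * Real.pi := by
      have h1 : ‖((|y 0| ^ M : ℝ) : ℂ) • partialFT R y‖ ≤ C * Real.pi := by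
        rw [partialFT, ← integral_smul, ← hint]
        refine norm_integral_le_of_norm_le (integrable_inv_one_add_sq.const_mul C)
          (Filter.Eventually.of_forall fun p => ?_)
        simpa [norm_smul, norm_e1] using hC p (y 0)
      simpa [norm_smul] using h1
    have b1 : |y 1| ^ M * ‖partialFT R y‖ ≤ C' * Real.pi := by
      let L : ℝ →L[ℝ] ℝ × ℝ := ContinuousLinearMap.inl ℝ ℝ ℝ
      have hf : ContDiff ℝ ((⊤ : ℕ∞) : WithTop ℕ∞) fun p : ℝ => R (p, y 0) :=
        hR.comp (contDiff_id.prodMk contDiff_const)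
      have hb : ∀ i p, ‖iteratedFDeriv ℝ i (fun p : ℝ => R (p, y 0)) p‖ ≤
          ‖iteratedFDeriv ℝ i R (p, y 0)‖ := fun i p => by
        have e : (fun p : ℝ => R (p, y 0)) = (fun z => R (z + (0, y 0))) ∘ L := by
          ext p; simp [L]
        have h2 : ContDiff ℝ ((⊤ : ℕ∞) : WithTop ℕ∞) fun z => R (z + (0, y 0)) :=
          hR.comp (contDiff_id.add contDiff_const)
        rw [e, ContinuousLinearMap.iteratedFDeriv_comp_right L h2 _ (by exact_mod_cast le_top),
          iteratedFDeriv_comp_add_right]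
        refine (ContinuousMultilinearMap.norm_compContinuousLinearMap_le _ _).trans ?_
        simp only [Finset.prod_const, Finset.card_univ, Fintype.card_fin]
        have hL : ‖L‖ ≤ 1 := ContinuousLinearMap.norm_inl_le_one ℝ ℝ ℝ
        refine (mul_le_of_le_one_right (norm_nonneg _) (pow_le_one₀ (norm_nonneg _) hL)).trans_eq ?_
        simp [L]
      have hi : ∀ i, Integrable (iteratedFDeriv ℝ i fun p : ℝ => R (p, y 0)) := fun i => by
        obtain ⟨D, hD⟩ := exists_decay_bound
          (hR.continuous_iteratedFDeriv (m := i) (by exact_mod_cast le_top)) (hs.iteratedFDeriv i) 0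
        refine (integrable_inv_one_add_sq.const_mul D).mono' (hf.continuous_iteratedFDeriv
          (by exact_mod_cast le_top)).aestronglyMeasurable (Filter.Eventually.of_forall fun p => ?_)
        exact (hb i p).trans (by simpa using hD p (y 0))
      have h1 := norm_pow_mul_fourier_le (N := M) (hf.of_le (by exact_mod_cast le_top))
        (fun i _ => hi i) (-y 1)
      have h2 : 𝓕 (fun p : ℝ => R (p, y 0)) (-y 1) = partialFT R y := by
        rw [Real.fourier_eq', partialFT]
        congr 1
        ext p
        rw [e1_eq_exp]
        congr 4
        simp
      rw [h2] at h1
      refine le_trans (mul_le_mul_of_nonneg_right (pow_le_pow_left₀ (abs_nonneg _) ?_ M)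
        (norm_nonneg _)) (h1.trans ?_)
      · rw [norm_neg, Real.norm_eq_abs]
        nlinarith [Real.pi_gt_three, abs_nonneg (y 1)]
      · rw [← hint]
        exact integral_mono (hi M).norm (integrable_inv_one_add_sq.const_mul C')
          fun p => (hb M p).trans (by simpa using hC' p (y 0))
    have hy : ‖y‖ ≤ |y 0| + |y 1| := by
      refine abs_le_of_sq_le_sq' ?_ (by positivity) |>.2
      rw [norm_sq_plane]
      nlinarith [sq_abs (y 0), sq_abs (y 1), mul_nonneg (abs_nonneg (y 0)) (abs_nonneg (y 1))]
    rw [norm_iteratedFDeriv_zero]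
    calc _ ≤ (2 ^ (M - 1) * (|y 0| ^ M + |y 1| ^ M)) * ‖partialFT R y‖ := by
          gcongr
          exact (pow_le_pow_left₀ (norm_nonneg _) hy M).trans
            (add_pow_le (abs_nonneg _) (abs_nonneg _) M)
      _ = 2 ^ (M - 1) * (|y 0| ^ M * ‖partialFT R y‖ + |y 1| ^ M * ‖partialFT R y‖) := by ring
      _ ≤ _ := by gcongr
  | succ n ih =>
    intro E _ _ _ R hR hs
    have hd : fderiv ℝ (partialFT R) = partialFT (partialFTDeriv R) :=
      funext fun y => (hasFDerivAt_partialFT hR hs y).fderiv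
    have h := ih (Plane →L[ℝ] E) (partialFTDeriv R) (contDiff_partialFTDeriv hR)
      (hasCompactSupport_partialFTDeriv hs)
    rw [← hd] at h
    refine ⟨?_, fun M => ?_⟩
    · rw [Nat.cast_succ, contDiff_succ_iff_fderiv]
      exact ⟨fun y => (hasFDerivAt_partialFT hR hs y).differentiableAt, by simp, h.1⟩
    · simpa only [norm_iteratedFDeriv_fderiv] using h.2 M

/-- The product of two translates of the window. -/
noncomputable def winProd (x : ℝ × ℝ) : ℂ := ((win (x.1 - x.2 / 2) * win (x.1 + x.2 / 2) / 2 : ℝ) : ℂ)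

lemma contDiff_winProd : ContDiff ℝ ((⊤ : ℕ∞) : WithTop ℕ∞) winProd := by
  have h := contDiff_win
  unfold winProd
  refine Complex.ofRealCLM.contDiff.comp (ContDiff.div_const (ContDiff.mul ?_ ?_) _)
  · exact h.comp (contDiff_fst.sub (contDiff_snd.div_const _))
  · exact h.comp (contDiff_fst.add (contDiff_snd.div_const _))

lemma hasCompactSupport_winProd : HasCompactSupport winProd := by
  refine HasCompactSupport.of_support_subset_isCompact
    ((isCompact_Icc (a := -1) (b := 1)).prod (isCompact_Icc (a := -2) (b := 2))) fun x hx => ?_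
  have h1 : |x.1 - x.2 / 2| < 1 := by
    by_contra! h
    exact hx (by simp [winProd, win_eq_zero h])
  have h2 : |x.1 + x.2 / 2| < 1 := by
    by_contra! h
    exact hx (by simp [winProd, win_eq_zero h])
  rw [abs_lt] at h1 h2
  exact ⟨⟨by linarith, by linarith⟩, ⟨by linarith, by linarith⟩⟩

/-- The ambiguity function of the window. -/
noncomputable def amb : SchwartzMap Plane ℂ where
  toFun := partialFT winProd
  smooth' := contDiff_infty.2 fun n =>
    (partialFT_decay n ℂ winProd contDiff_winProd hasCompactSupport_winProd).1
  decay' k n := (partialFT_decay n ℂ winProd contDiff_winProd hasCompactSupport_winProd).2 k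

/-- The substitution `t = p - y 0 / 2` turns the symmetric form, convenient for smoothness, into the
matrix coefficient of the window. -/
lemma amb_apply (y : Plane) : amb y = ∫ t : ℝ, e1 (y 0 * y 1 / 2 + t * y 1) *
    ((win t * win (t + y 0) / 2 : ℝ) : ℂ) := by
  rw [← integral_sub_right_eq_self _ (y 0 / 2)]
  change ∫ p : ℝ, _ = _
  congr 1
  ext p
  have h1 : p - y 0 / 2 + y 0 = p + y 0 / 2 := by ring
  have h2 : y 0 * y 1 / 2 + (p - y 0 / 2) * y 1 = y 1 * p := by ring
  rw [smul_eq_mul, winProd, h1, h2]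

lemma amb_zero : amb 0 = 1 / 2 := by
  rw [amb_apply]
  have : ∀ t, e1 ((0 : Plane) 0 * (0 : Plane) 1 / 2 + t * (0 : Plane) 1) *
      ((win t * win (t + (0 : Plane) 0) / 2 : ℝ) : ℂ) = ((win t ^ 2 / 2 : ℝ) : ℂ) := fun t => by
    simp [e1, sq]
  simp only [this]
  rw [integral_complex_ofReal, integral_div, integral_win_sq]
  norm_num

variable (g : GL (Fin 2) ℤ) [NeZero (g.1 1 0).natAbs]

lemma inner_phi0_heis (x : GGroup g) : inner ℂ (phi0 g) (heis g x (phi0 g)) =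
    if x.1.2 = 0 then amb (toPlane (x.1.1, x.2.1)) else 0 := by
  have hae : (fun p => inner ℂ (phi0 g p) (heis g x (phi0 g) p)) =ᵐ[haarM g] fun p : MGroup g =>
      e1 (x.1.1 * x.2.1 / 2 + p.1 * x.2.1 + cycPair g p.2 x.2.2) *
        (starRingEnd ℂ (winM g p) * winM g (p + x.1)) := by
    filter_upwards [heis_phi0_coeFn g x, (memLp_winM g).coeFn_toLp] with p h1 h2
    rw [h1, phi0, h2, RCLike.inner_apply]
    ring
  rw [L2.inner_def, integral_congr_ae hae,
    (integral_haarM g ((L2.integrable_inner (𝕜 := ℂ) _ _).congr hae)).2,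
    Finset.sum_eq_single 0]
  · split_ifs with h
    · rw [amb_apply]
      congr 1
      ext t
      have h2 : √2 * √2 = 2 := Real.mul_self_sqrt (by norm_num)
      have h3 : ((win t * win (t + x.1.1) / 2 : ℝ) : ℂ) =
          ((win t / √2 : ℝ) : ℂ) * ((win (t + x.1.1) / √2 : ℝ) : ℂ) := by
        rw [← Complex.ofReal_mul, div_mul_div_comm, h2]
      simp only [toPlane_zero, toPlane_one, h3]
      rw [cycPair_comm, cycPair_zero]
      simp [winM, h]
    · simp [winM, h]
  · intro α _ hα
    simp [winM, hα]
  · simp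

end Ambiguity

/-! ### Oscillatory integrals against translates of a Schwartz function -/

section Oscillatory

open scoped FourierTransform SchwartzMap

/-- A Schwartz function is the Fourier transform of a Schwartz function. -/
lemma SchwartzMap.exists_eq_integral_exp (Ψ : 𝓢(Plane, ℂ)) : ∃ b : 𝓢(Plane, ℂ),
    ∀ y, Ψ y = ∫ ξ, Complex.exp (-(inner ℝ y ξ : ℝ) * Complex.I) * b ξ := by
  have hpi : 2 * Real.pi ≠ 0 := by positivity
  let e : Plane ≃L[ℝ] Plane := ContinuousLinearEquiv.smulLeft (Units.mk0 (2 * Real.pi) hpi)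
  let Ψ₂ : 𝓢(Plane, ℂ) := SchwartzMap.compCLMOfContinuousLinearEquiv ℂ e Ψ
  refine ⟨𝓕⁻ Ψ₂, fun y => ?_⟩
  have h1 : 𝓕 (𝓕⁻ Ψ₂) = Ψ₂ := FourierInvPair.fourier_fourierInv_eq Ψ₂
  have h2 : Ψ₂ ((2 * Real.pi)⁻¹ • y) = Ψ y := by
    change Ψ ((2 * Real.pi) • (2 * Real.pi)⁻¹ • y) = Ψ y
    rw [smul_smul, mul_inv_cancel₀ hpi, one_smul]
  rw [← h2]
  nth_rewrite 1 [← h1]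
  rw [SchwartzMap.fourier_coe, Real.fourier_eq']
  congr 1
  ext ξ
  rw [smul_eq_mul]
  congr 3
  rw [inner_smul_right, real_inner_comm]
  push_cast
  field_simp

variable {h : Plane → ℂ} {m : ℝ} {K : ℕ → ℝ}

/-- With `Ψ` written as a superposition of exponentials of density `b`, the integral over `y` is a
Fourier inversion and yields `h (ξ - η)`. What remains is the Fourier transform of a product
localized by `b` near `ξ = 0`: its size follows `h` near `-η`, its decay in `u` follows the
derivatives. -/
lemma DecayBound.integral_invFT_mul_schwartz (hh : DecayBound h m K) (hm : m < -2)
    {Ψ b : 𝓢(Plane, ℂ)}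
    (hb : ∀ y, Ψ y = ∫ ξ, Complex.exp (-(inner ℝ y ξ : ℝ) * Complex.I) * b ξ) (η u : Plane) :
    ∫ y, invFT h y * (Complex.exp ((inner ℝ y η : ℝ) * Complex.I) * Ψ (y + u)) =
      𝓕 (fun ξ => b ξ * h (ξ - η)) ((2 * Real.pi)⁻¹ • u) := by
  have h1 : ∀ y ξ : Plane, invFT h y * (Complex.exp ((inner ℝ y η : ℝ) * Complex.I) *
      (Complex.exp (-(inner ℝ (y + u) ξ : ℝ) * Complex.I) * b ξ)) =
      (invFT h y * Complex.exp ((inner ℝ y (η - ξ) : ℝ) * Complex.I)) *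
      (Complex.exp (-(inner ℝ u ξ : ℝ) * Complex.I) * b ξ) := fun y ξ => by
    rw [inner_add_left, inner_sub_right]
    have : Complex.exp ((inner ℝ y η : ℝ) * Complex.I) *
        Complex.exp (-((inner ℝ y ξ + inner ℝ u ξ : ℝ) : ℂ) * Complex.I) =
        Complex.exp (((inner ℝ y η - inner ℝ y ξ : ℝ) : ℂ) * Complex.I) *
        Complex.exp (-(inner ℝ u ξ : ℝ) * Complex.I) := by
      rw [← Complex.exp_add, ← Complex.exp_add]; congr 1; push_cast; ring
    linear_combination (invFT h y * b ξ) * this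
  have h2 : Integrable (fun p : Plane × Plane => invFT h p.1 *
      (Complex.exp ((inner ℝ p.1 η : ℝ) * Complex.I) *
        (Complex.exp (-(inner ℝ (p.1 + u) p.2 : ℝ) * Complex.I) * b p.2))) := by
    have h3 := (hh.integrable_invFT hm).mul_prod (b.integrable (μ := volume))
    have h4 := h3.bdd_mul (c := 1) (f := fun p : Plane × Plane =>
      Complex.exp ((inner ℝ p.1 η - inner ℝ (p.1 + u) p.2 : ℝ) * Complex.I))
      (by fun_prop) (Filter.Eventually.of_forall fun p => (Complex.norm_exp_ofReal_mul_I _).le)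
    refine h4.congr (Filter.Eventually.of_forall fun p => ?_)
    have : Complex.exp ((inner ℝ p.1 η - inner ℝ (p.1 + u) p.2 : ℝ) * Complex.I) =
        Complex.exp ((inner ℝ p.1 η : ℝ) * Complex.I) *
        Complex.exp (-(inner ℝ (p.1 + u) p.2 : ℝ) * Complex.I) := by
      rw [← Complex.exp_add]; congr 1; push_cast; ring
    simp only [this]
    ring
  simp only [hb, ← integral_const_mul]
  rw [integral_integral_swap h2, Real.fourier_eq']
  congr 1
  ext ξ
  simp only [h1]
  rw [integral_mul_const, hh.integral_invFT_mul_exp hm, neg_sub, smul_eq_mul]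
  have : Complex.exp (((-2 * Real.pi * inner ℝ ξ ((2 * Real.pi)⁻¹ • u) : ℝ) : ℂ) * Complex.I) =
      Complex.exp (-(inner ℝ u ξ : ℝ) * Complex.I) := by
    rw [inner_smul_right, real_inner_comm]
    congr 2
    push_cast
    field_simp
  rw [this]
  ring

/-- Peetre's inequality. -/
lemma one_add_norm_sub_rpow_le (hm : m ≤ 0) (ξ η : Plane) :
    (1 + ‖ξ - η‖) ^ m ≤ (1 + ‖η‖) ^ m * (1 + ‖ξ‖) ^ (-m) := by
  have h1 : 1 + ‖η‖ ≤ (1 + ‖ξ - η‖) * (1 + ‖ξ‖) := by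
    have : ‖η‖ ≤ ‖ξ - η‖ + ‖ξ‖ := by
      rw [norm_sub_rev]; simpa using norm_add_le (η - ξ) ξ
    nlinarith [norm_nonneg (ξ - η), norm_nonneg ξ]
  rw [Real.rpow_neg (by positivity), ← div_eq_mul_inv, le_div_iff₀ (by positivity),
    ← Real.mul_rpow (by positivity) (by positivity)]
  exact Real.rpow_le_rpow_of_nonpos (by positivity) h1 hm

lemma SchwartzMap.exists_norm_iteratedFDeriv_le (b : 𝓢(Plane, ℂ)) (q : ℝ) :
    ∃ B : ℝ, 0 ≤ B ∧ ∀ i ≤ 3, ∀ ξ, ‖iteratedFDeriv ℝ i b ξ‖ ≤ B * (1 + ‖ξ‖) ^ (-q) := by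
  obtain ⟨k, hk⟩ := exists_nat_ge q
  refine ⟨2 ^ k * ((Finset.Iic (k, 3)).sup fun m => SchwartzMap.seminorm ℂ m.1 m.2) b,
    mul_nonneg (by positivity) (apply_nonneg _ _), fun i hi ξ => ?_⟩
  have h := SchwartzMap.one_add_le_sup_seminorm_apply (𝕜 := ℂ) (m := (k, 3)) le_rfl hi b ξ
  have h1 : (1 + ‖ξ‖) ^ (-(k : ℝ)) ≤ (1 + ‖ξ‖) ^ (-q) :=
    Real.rpow_le_rpow_of_exponent_le (by linarith [norm_nonneg ξ]) (by linarith)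
  refine le_trans ?_ (mul_le_mul_of_nonneg_left h1
    (mul_nonneg (by positivity) (apply_nonneg _ _)))
  rw [Real.rpow_neg (by positivity), Real.rpow_natCast, ← div_eq_mul_inv,
    le_div_iff₀ (by positivity), mul_comm]
  exact h

/-- Leibniz's rule, with binomial coefficients summing to at most `2 ^ 3 = 8`. Peetre's inequality
moves the decay of `h` from `ξ - η` to `η` at the cost of `(1 + ‖ξ‖) ^ (-m)`; the exponent `-(3 -
m)` demanded of `b` pays for this and leaves `-3`. -/
lemma DecayBound.norm_iteratedFDeriv_mul_comp_sub_le (hh : DecayBound h m K) (hm : m ≤ 0)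
    {b : 𝓢(Plane, ℂ)} {B : ℝ} (hB0 : 0 ≤ B)
    (hB : ∀ i ≤ 3, ∀ ξ, ‖iteratedFDeriv ℝ i b ξ‖ ≤ B * (1 + ‖ξ‖) ^ (-(3 - m))) (η : Plane)
    {N : ℕ} (hN : N ≤ 3) (ξ : Plane) :
    ‖iteratedFDeriv ℝ N (fun ξ => b ξ * h (ξ - η)) ξ‖ ≤
      8 * B * boundSum K * (1 + ‖η‖) ^ m * (1 + ‖ξ‖) ^ (-3 : ℝ) := by
  have h0 := fun i => hh.nonneg i
  have hc : ContDiff ℝ ((⊤ : ℕ∞) : WithTop ℕ∞) fun ξ => h (ξ - η) :=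
    hh.contDiff.comp (contDiff_id.sub contDiff_const)
  refine (norm_iteratedFDeriv_mul_le (b.smooth ⊤) hc ξ (n := N)
    (by exact_mod_cast le_top)).trans ?_
  have hK : ∀ i ≤ 3, K i ≤ boundSum K := fun i hi => by
    unfold boundSum
    interval_cases i <;> linarith [h0 0, h0 1, h0 2, h0 3]
  have hb0 : 0 ≤ boundSum K := (h0 0).trans (hK 0 (by norm_num))
  have hterm : ∀ i ∈ Finset.range (N + 1), (N.choose i : ℝ) * ‖iteratedFDeriv ℝ i b ξ‖ *
      ‖iteratedFDeriv ℝ (N - i) (fun ξ => h (ξ - η)) ξ‖ ≤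
      (N.choose i : ℝ) * (B * boundSum K * (1 + ‖η‖) ^ m * (1 + ‖ξ‖) ^ (-3 : ℝ)) := fun i hi => by
    rw [Finset.mem_range] at hi
    have h1 := hB i (by omega) ξ
    have h2 : ‖iteratedFDeriv ℝ (N - i) (fun ξ => h (ξ - η)) ξ‖ ≤
        boundSum K * ((1 + ‖η‖) ^ m * (1 + ‖ξ‖) ^ (-m)) := by
      rw [iteratedFDeriv_comp_sub]
      exact (hh.bound _ _).trans (mul_le_mul (hK _ (by omega)) (one_add_norm_sub_rpow_le hm ξ η)
        (by positivity) hb0)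
    rw [mul_assoc]
    refine mul_le_mul_of_nonneg_left ((mul_le_mul h1 h2 (norm_nonneg _) (by positivity)).trans_eq
      ?_) (by positivity)
    have h3 : (1 + ‖ξ‖) ^ (-3 : ℝ) = (1 + ‖ξ‖) ^ (-(3 - m)) * (1 + ‖ξ‖) ^ (-m) := by
      rw [← Real.rpow_add (by positivity)]; congr 1; ring
    rw [h3]
    ring
  refine (Finset.sum_le_sum hterm).trans ?_
  rw [← Finset.sum_mul]
  have h8 : ∑ i ∈ Finset.range (N + 1), (N.choose i : ℝ) ≤ 8 := by
    have := Nat.sum_range_choose N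
    have h9 : 2 ^ N ≤ 2 ^ 3 := Nat.pow_le_pow_right (by norm_num) hN
    rw [← this] at h9
    exact_mod_cast h9
  calc _ ≤ 8 * (B * boundSum K * (1 + ‖η‖) ^ m * (1 + ‖ξ‖) ^ (-3 : ℝ)) :=
        mul_le_mul_of_nonneg_right h8 (by positivity)
    _ = _ := by ring

/-- The integral of the inverse Fourier transform of a symbol against a modulated translate of a
Schwartz function decays in the translation, and as the symbol in the modulation. -/
lemma exists_norm_integral_invFT_mul_schwartz_le (Ψ : 𝓢(Plane, ℂ)) (hm : m < -2) :
    ∃ C : ℝ, 0 ≤ C ∧ ∀ (h : Plane → ℂ) (K : ℕ → ℝ), DecayBound h m K → ∀ η u : Plane,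
      ‖∫ y, invFT h y * (Complex.exp ((inner ℝ y η : ℝ) * Complex.I) * Ψ (y + u))‖ ≤
        boundSum K * (C * (1 + ‖u‖) ^ (-3 : ℝ) * (1 + ‖η‖) ^ m) := by
  obtain ⟨b, hb⟩ := SchwartzMap.exists_eq_integral_exp Ψ
  obtain ⟨B, hB0, hB⟩ := b.exists_norm_iteratedFDeriv_le (3 - m)
  -- Here `64 = 8 * 8`: one `8` from Leibniz's rule, the other from `(1 + t)³ ≤ 4 (1 + t³)` with two
  -- terms to bound.
  refine ⟨64 * B * decayMass (-3), mul_nonneg (by positivity) (decayMass_nonneg _),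
    fun h K hh η u => ?_⟩
  rw [hh.integral_invFT_mul_schwartz hm hb]
  have hc : ContDiff ℝ ((⊤ : ℕ∞) : WithTop ℕ∞) fun ξ => b ξ * h (ξ - η) :=
    (b.smooth ⊤).mul (hh.contDiff.comp (contDiff_id.sub contDiff_const))
  have hd := integrable_decay (m := -3) (by norm_num)
  have hbd := fun N hN => hh.norm_iteratedFDeriv_mul_comp_sub_le (by linarith) hB0 hB η (N := N) hN
  have hi : ∀ N ≤ 3, Integrable (iteratedFDeriv ℝ N fun ξ => b ξ * h (ξ - η)) := fun N hN =>
    (hd.const_mul _).mono' (hc.continuous_iteratedFDeriv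
      (by exact_mod_cast le_top)).aestronglyMeasurable (Filter.Eventually.of_forall (hbd N hN))
  set M := 8 * B * boundSum K * (1 + ‖η‖) ^ m with hM
  have hle : ∀ N ≤ 3, ‖u‖ ^ N * ‖𝓕 (fun ξ => b ξ * h (ξ - η)) ((2 * Real.pi)⁻¹ • u)‖ ≤
      M * decayMass (-3) := fun N hN => by
    have h1 := norm_pow_mul_fourier_le (N := N) (hc.of_le (by exact_mod_cast le_top))
      (fun n hn => hi n (hn.trans hN)) ((2 * Real.pi)⁻¹ • u)
    have h2 : 2 * Real.pi * ‖(2 * Real.pi)⁻¹ • u‖ = ‖u‖ := by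
      have := Real.pi_pos
      rw [norm_smul, Real.norm_of_nonneg (by positivity)]
      field_simp
    rw [h2] at h1
    refine h1.trans ?_
    rw [decayMass, ← integral_const_mul]
    exact integral_mono (hi N hN).norm (hd.const_mul _) (hbd N hN)
  have h0 := hle 0 (by norm_num)
  have h3 := hle 3 le_rfl
  have hu := norm_nonneg u
  set X := ‖𝓕 (fun ξ => b ξ * h (ξ - η)) ((2 * Real.pi)⁻¹ • u)‖ with hX
  have hX0 : 0 ≤ X := norm_nonneg _
  have h5 : (1 + ‖u‖) ^ (3 : ℝ) ≤ 4 * (1 + ‖u‖ ^ 3) := by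
    rw [show (3 : ℝ) = ((3 : ℕ) : ℝ) by norm_num, Real.rpow_natCast]
    nlinarith [mul_nonneg (add_nonneg zero_le_one hu) (sq_nonneg (‖u‖ - 1))]
  have h6 : X * (1 + ‖u‖) ^ (3 : ℝ) ≤ 8 * (M * decayMass (-3)) := by
    calc _ ≤ X * (4 * (1 + ‖u‖ ^ 3)) := by gcongr
      _ = 4 * (‖u‖ ^ 0 * X + ‖u‖ ^ 3 * X) := by ring
      _ ≤ 4 * (M * decayMass (-3) + M * decayMass (-3)) := by gcongr
      _ = _ := by ring
  rw [← le_div_iff₀ (by positivity), div_eq_mul_inv, ← Real.rpow_neg (by positivity)] at h6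
  refine h6.trans_eq ?_
  rw [hM]
  ring

end Oscillatory

/-! ### Matrix coefficients of the Heisenberg representation -/

section Coefficients

open scoped SchwartzMap

variable {g : GL (Fin 2) ℤ}

lemma norm_cocycle (x y : GGroup g) : ‖cocycle g x y‖ = 1 := norm_e1 _

lemma cocycle_add_right (x y z : GGroup g) :
    cocycle g x (y + z) = cocycle g x y * cocycle g x z := by
  simp only [cocycle, e1_add, Prod.fst_add, Prod.snd_add, cycPair_comm g x.1.2, e1_cycPair_add]
  have : e1 ((x.1.1 * (y.2.1 + z.2.1) - x.2.1 * (y.1.1 + z.1.1)) / 2) =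
      e1 ((x.1.1 * y.2.1 - x.2.1 * y.1.1) / 2) * e1 ((x.1.1 * z.2.1 - x.2.1 * z.1.1) / 2) := by
    rw [← e1_add]; congr 1; ring
  rw [this]
  ring

lemma heis_zero (u : L2M g) : heis g 0 u = u := by
  refine Lp.ext ?_
  filter_upwards [heis_coeFn g 0 u] with p hp
  rw [hp]
  simp [cycPair, e1]

lemma inner_heis_heis_same (x : GGroup g) (u v : L2M g) :
    inner ℂ (heis g x u) (heis g x v) = inner ℂ u v :=
  LinearIsometry.inner_map_map _ _ _

lemma inner_heis_heis (a b : GGroup g) (u v : L2M g) :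
    inner ℂ (heis g a u) (heis g b v) =
      starRingEnd ℂ (cocycle g (-a) a) * cocycle g (-a) b * inner ℂ u (heis g (-a + b) v) := by
  rw [← inner_heis_heis_same (-a), heis_mul, heis_mul, inner_smul_left, inner_smul_right,
    neg_add_cancel, heis_zero]
  ring

variable (g) (θ : ℝ)

/-- The image of a point of the plane in `G`. -/
noncomputable def planePt (y : Plane) : GGroup g := ((y 0, 0), (slope' g θ * y 1, 0))

lemma piW_apply (w y : Plane) (v : L2M g) :
    piW g θ w y v = Complex.exp ((inner ℝ w y : ℝ) * Complex.I) • heis g (planePt g θ y) v := rfl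

lemma norm_piW (w y : Plane) (v : L2M g) : ‖piW g θ w y v‖ = ‖v‖ := by
  rw [piW_apply, norm_smul, Complex.norm_exp_ofReal_mul_I, one_mul, norm_heis]

/-- The diagonal map `(y₀, y₁) ↦ (y₀, μ y₁)` of the plane. -/
noncomputable def scalePlane (μ : ℝ) (hμ : μ ≠ 0) : Plane ≃L[ℝ] Plane :=
  LinearEquiv.toContinuousLinearEquiv
    { toFun := fun y => toPlane (y 0, μ * y 1)
      invFun := fun y => toPlane (y 0, μ⁻¹ * y 1)
      map_add' := fun x y => by ext i; fin_cases i <;> simp [toPlane, mul_add]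
      map_smul' := fun x y => by ext i; fin_cases i <;> simp [toPlane, mul_left_comm]
      left_inv := fun y => by ext i; fin_cases i <;> simp [toPlane, hμ]
      right_inv := fun y => by ext i; fin_cases i <;> simp [toPlane, hμ] }

/-- The ambiguity function in the coordinates of the representation of the plane. -/
noncomputable def scaledAmb (μ : ℝ) (hμ : μ ≠ 0) : 𝓢(Plane, ℂ) :=
  SchwartzMap.compCLMOfContinuousLinearEquiv ℂ (scalePlane μ hμ) amb

lemma scaledAmb_apply (μ : ℝ) (hμ : μ ≠ 0) (y : Plane) :
    scaledAmb μ hμ y = amb (toPlane (y 0, μ * y 1)) := rfl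

/-- The frequency in a matrix coefficient. -/
noncomputable def coeffFreq (w : Plane) (a b Z : GGroup g) : Plane :=
  w + toPlane (Real.pi * (a.2.1 + b.2.1 - Z.2.1), -(Real.pi * slope' g θ * (a.1.1 + b.1.1 - Z.1.1)))

/-- The translation in a matrix coefficient. -/
noncomputable def coeffShift (a b Z : GGroup g) : Plane :=
  toPlane (Z.1.1 + b.1.1 - a.1.1, (slope' g θ)⁻¹ * (Z.2.1 + b.2.1 - a.2.1))

/-- The constant factor in a matrix coefficient. -/
noncomputable def coeffConst (a b Z : GGroup g) : ℂ :=
  if Z.1.2 + b.1.2 = a.1.2 then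
    starRingEnd ℂ (cocycle g (-a) a) * cocycle g Z b * cocycle g (-a) (Z + b) else 0

lemma norm_coeffConst_le (a b Z : GGroup g) : ‖coeffConst g a b Z‖ ≤ 1 := by
  unfold coeffConst
  split_ifs <;> simp [norm_cocycle]

variable {g θ} [NeZero (g.1 1 0).natAbs]

/-- All translations are gathered into one, at the price of cocycles. As the cocycle is
multiplicative in its second argument, the dependence on `y` separates into an exponential, of
frequency `coeffFreq`, and the ambiguity function at the total displacement. -/
lemma inner_heis_piW (hμ : slope' g θ ≠ 0) (w y : Plane) (a b Z : GGroup g) :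
    inner ℂ (heis g a (phi0 g)) (heis g Z (piW g θ w y (heis g b (phi0 g)))) =
      coeffConst g a b Z * (Complex.exp ((inner ℝ y (coeffFreq g θ w a b Z) : ℝ) * Complex.I) *
        scaledAmb (slope' g θ) hμ (y + coeffShift g θ a b Z)) := by
  rw [piW_apply, map_smul, heis_mul g (planePt g θ y) b, map_smul, heis_mul, inner_smul_right, inner_smul_right,
    inner_smul_right, inner_heis_heis, inner_phi0_heis, scaledAmb_apply]
  have h1 : (-a + (Z + (planePt g θ y + b))).1.2 = 0 ↔ Z.1.2 + b.1.2 = a.1.2 := by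
    simp only [planePt, Prod.fst_add, Prod.snd_add, Prod.fst_neg, Prod.snd_neg, zero_add]
    rw [neg_add_eq_zero, eq_comm]
  have h2 : toPlane ((-a + (Z + (planePt g θ y + b))).1.1, (-a + (Z + (planePt g θ y + b))).2.1) =
      toPlane ((y + coeffShift g θ a b Z) 0, slope' g θ * (y + coeffShift g θ a b Z) 1) := by
    congr 2
    · simp [coeffShift, planePt]; ring
    · simp [coeffShift, planePt, mul_add, mul_inv_cancel_left₀ hμ]; ring
  rw [h2]
  simp only [h1, coeffConst]
  split_ifs with h
  -- All phases that depend on `y` are collected in one exponential; the other cocycles make up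
  -- `coeffConst`.
  · have h3 : Complex.exp ((inner ℝ w y : ℝ) * Complex.I) * (cocycle g (planePt g θ y) b *
        cocycle g Z (planePt g θ y) * cocycle g (-a) (planePt g θ y)) =
        Complex.exp ((inner ℝ y (coeffFreq g θ w a b Z) : ℝ) * Complex.I) := by
      simp only [cocycle, ← e1_add]
      rw [e1_eq_exp, ← Complex.exp_add]
      congr 1
      simp only [planePt, cycPair, coeffFreq, inner_plane]
      simp
      ring
    rw [cocycle_add_right Z, cocycle_add_right (-a), cocycle_add_right (-a), ← h3,
      cocycle_add_right (-a)]
    ring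
  · simp

/-- At constant norm `M`, `‖ν y - ν y₀‖² = 2 M² - 2 Re ⟪ν y₀, ν y⟫`, so weak continuity implies
strong continuity. -/
lemma continuous_of_continuous_inner {X H : Type*} [TopologicalSpace X] [NormedAddCommGroup H]
    [InnerProductSpace ℂ H] {ν : X → H} {M : ℝ} (hM : ∀ y, ‖ν y‖ = M)
    (hν : ∀ y₀, Continuous fun y => inner ℂ (ν y₀) (ν y)) : Continuous ν := by
  refine continuous_iff_continuousAt.2 fun y₀ => ?_
  rw [ContinuousAt, tendsto_iff_norm_sub_tendsto_zero]
  have h1 : ∀ y, ‖ν y - ν y₀‖ = √(2 * M ^ 2 - 2 * (inner ℂ (ν y₀) (ν y)).re) := fun y => by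
    rw [← Real.sqrt_sq (norm_nonneg (ν y - ν y₀)), norm_sub_rev, @norm_sub_sq ℂ, hM, hM]
    congr 1
    simp only [RCLike.re_to_complex]
    ring
  have h2 : Continuous fun y => √(2 * M ^ 2 - 2 * (inner ℂ (ν y₀) (ν y)).re) :=
    Real.continuous_sqrt.comp (continuous_const.sub
      (continuous_const.mul (Complex.continuous_re.comp (hν y₀))))
  simp only [h1]
  have h3 := h2.tendsto y₀
  rwa [← h1 y₀, sub_self, norm_zero] at h3

variable (g θ)

/-- By the Parseval family and constancy of the norm it is enough to see the coefficients between
frame vectors, which `inner_heis_piW` expresses through a Schwartz function. -/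
lemma continuous_piW (hμ : slope' g θ ≠ 0) (w : Plane) (v : L2M g) :
    Continuous fun y => piW g θ w y v := by
  refine (isParseval_frame g).continuous_apply (fun y v => (norm_piW g θ w y v).le) (fun z => ?_) v
  refine continuous_of_continuous_inner (fun y => norm_piW g θ w y _) fun y₀ => ?_
  have h : ∀ y, inner ℂ (piW g θ w y₀ (frame g z)) (piW g θ w y (frame g z)) =
      starRingEnd ℂ (Complex.exp ((inner ℝ w y₀ : ℝ) * Complex.I) *
        cocycle g (planePt g θ y₀) (framePt g z)) *
      inner ℂ (heis g (planePt g θ y₀ + framePt g z) (phi0 g))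
        (heis g 0 (piW g θ w y (heis g (framePt g z) (phi0 g)))) := fun y => by
    rw [heis_zero, piW_apply g θ w y₀, frame, heis_mul, smul_smul, inner_smul_left]
  simp only [h, inner_heis_piW hμ]
  have := (scaledAmb (slope' g θ) hμ).continuous
  fun_prop

variable {g θ} {h : Plane → ℂ} {m : ℝ} {K : ℕ → ℝ}

/-- The matrix of the operator of a coefficient of a symbol. -/
lemma inner_heis_integral_piW (hμ : slope' g θ ≠ 0) {w : Plane} (hh : DecayBound h m K)
    (hm : m < -2) {S : L2M g →L[ℂ] L2M g} (hS : ∀ v, S v = ∫ y, invFT h y • piW g θ w y v)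
    (a b Z : GGroup g) :
    inner ℂ (heis g a (phi0 g)) (heis g Z (S (heis g b (phi0 g)))) =
      coeffConst g a b Z * ∫ y, invFT h y *
        (Complex.exp ((inner ℝ y (coeffFreq g θ w a b Z) : ℝ) * Complex.I) *
        scaledAmb (slope' g θ) hμ (y + coeffShift g θ a b Z)) := by
  have hi := integrable_smul_of_contraction (fun y v => (norm_piW g θ w y v).le)
    (continuous_piW g θ hμ w) (hh.integrable_invFT hm) (heis g b (phi0 g))
  rw [hS, ← (heis g Z).integral_comp_comm hi, ← innerSL_apply_apply ℂ,
    ← (innerSL ℂ (heis g a (phi0 g))).integral_comp_comm ((heis g Z).integrable_comp hi),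
    ← integral_const_mul]
  congr 1
  ext y
  rw [innerSL_apply_apply, map_smul, inner_smul_right, inner_heis_piW hμ]
  ring

/-- The bound for the matrix in the Parseval family. -/
noncomputable def frameWeight (g : GL (Fin 2) ℤ) (θ : ℝ) (m : ℝ)
    (p : (Zc g × (ℤ × ℤ)) × (Zc g × (ℤ × ℤ))) : ℝ :=
  ((1 + 1 * |((p.2.2.1 - p.1.2.1 : ℤ) : ℝ)|) ^ (-3 / 2 : ℝ) *
    (1 + Real.pi * |slope' g θ| * |((p.1.2.1 + p.2.2.1 : ℤ) : ℝ)|) ^ (m / 2)) *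
  ((1 + |slope' g θ|⁻¹ / 2 * |((p.2.2.2 - p.1.2.2 : ℤ) : ℝ)|) ^ (-3 / 2 : ℝ) *
    (1 + Real.pi / 2 * |((p.1.2.2 + p.2.2.2 : ℤ) : ℝ)|) ^ (m / 2))

/-- In the differences and sums of the indices the weight is a product of four summable functions of
one integer. The change of indices is not onto, because of parity, but injectivity suffices. -/
lemma summable_frameWeight (hμ : slope' g θ ≠ 0) (hm : m < -2) : Summable (frameWeight g θ m) := by
  have hpi := Real.pi_pos
  have hμ' := abs_pos.2 hμ
  have h1 := summable_one_add_mul_abs (a := 1) (p := -3 / 2) one_pos (by norm_num)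
  have h2 := summable_one_add_mul_abs (a := Real.pi * |slope' g θ|) (p := m / 2) (by positivity)
    (by linarith)
  have h3 := summable_one_add_mul_abs (a := |slope' g θ|⁻¹ / 2) (p := -3 / 2) (by positivity)
    (by norm_num)
  have h4 := summable_one_add_mul_abs (a := Real.pi / 2) (p := m / 2) (by positivity) (by linarith)
  have h12 := h1.mul_of_nonneg h2 (fun n => by positivity) fun n => by positivity
  have h34 := h3.mul_of_nonneg h4 (fun n => by positivity) fun n => by positivity
  have h1234 := h12.mul_of_nonneg h34 (fun n => by positivity) fun n => by positivity
  have hz : Summable fun _ : Zc g × Zc g => (1 : ℝ) := (hasSum_fintype _).summable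
  have hall := hz.mul_of_nonneg h1234 (fun n => by simp) fun n => by positivity
  let e : (Zc g × (ℤ × ℤ)) × (Zc g × (ℤ × ℤ)) → (Zc g × Zc g) × ((ℤ × ℤ) × (ℤ × ℤ)) := fun p =>
    ((p.1.1, p.2.1), ((p.2.2.1 - p.1.2.1, p.1.2.1 + p.2.2.1),
      (p.2.2.2 - p.1.2.2, p.1.2.2 + p.2.2.2)))
  have he : Function.Injective e := fun p q hpq => by
    obtain ⟨⟨i, j, k⟩, ⟨i', j', k'⟩⟩ := p
    obtain ⟨⟨p, q, r⟩, ⟨p', q', r'⟩⟩ := q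
    simp only [e, Prod.mk.injEq] at hpq ⊢
    obtain ⟨⟨h1, h2⟩, ⟨h3, h4⟩, h5, h6⟩ := hpq
    exact ⟨⟨h1, by omega, by omega⟩, h2, by omega, by omega⟩
  refine (hall.comp_injective (i := e) he).congr fun p => ?_
  simp only [Function.comp_apply, e, one_mul, frameWeight]

/-- The shift depends on the difference of the two lattice points, the frequency on their sum.
Peetre's inequality removes `w` from the frequency and produces the factor `(1 + ‖w‖) ^ (-m)`. -/
lemma exists_norm_inner_frame_le (hμ : slope' g θ ≠ 0) (hm : m < -2) (w : Plane) :
    ∃ C : ℝ, ∀ (h : Plane → ℂ) (K : ℕ → ℝ), DecayBound h m K → ∀ S : L2M g →L[ℂ] L2M g,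
      (∀ v, S v = ∫ y, invFT h y • piW g θ w y v) → ∀ i j,
      ‖inner ℂ (frame g i) (S (frame g j))‖ ≤ boundSum K * (C * frameWeight g θ m (i, j)) := by
  obtain ⟨C, hC0, hC⟩ := exists_norm_integral_invFT_mul_schwartz_le (scaledAmb (slope' g θ) hμ) hm
  refine ⟨C * (1 + ‖w‖) ^ (-m), fun h K hh S hS i j => ?_⟩
  have h1 := inner_heis_integral_piW hμ hh hm hS (framePt g i) (framePt g j) 0
  rw [heis_zero] at h1
  rw [frame, frame, h1, norm_mul]
  have h0 := fun i => hh.nonneg i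
  have hb : 0 ≤ boundSum K := by simp only [boundSum]; linarith [h0 0, h0 1, h0 2, h0 3]
  refine (mul_le_of_le_one_left (norm_nonneg _) (norm_coeffConst_le g _ _ _)).trans
    ((hC h K hh _ _).trans (mul_le_mul_of_nonneg_left ?_ hb))
  set u := coeffShift g θ (framePt g i) (framePt g j) 0 with hu
  have h2 : (1 + ‖u‖) ^ (-3 : ℝ) ≤ (1 + |u 0|) ^ (-3 / 2 : ℝ) * (1 + |u 1|) ^ (-3 / 2 : ℝ) :=
    one_add_norm_rpow_le (by norm_num) u
  set η := toPlane (Real.pi * ((framePt g i).2.1 + (framePt g j).2.1 - (0 : GGroup g).2.1),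
    -(Real.pi * slope' g θ * ((framePt g i).1.1 + (framePt g j).1.1 - (0 : GGroup g).1.1))) with hη
  have h3 : (1 + ‖coeffFreq g θ w (framePt g i) (framePt g j) 0‖) ^ m ≤
      ((1 + |η 0|) ^ (m / 2) * (1 + |η 1|) ^ (m / 2)) * (1 + ‖w‖) ^ (-m) := by
    have h4 := one_add_norm_sub_rpow_le (m := m) (by linarith) w (-η)
    rw [sub_neg_eq_add, norm_neg] at h4
    exact h4.trans (mul_le_mul_of_nonneg_right (one_add_norm_rpow_le (by linarith) η)
      (by positivity))
  have hu0 : |u 0| = 1 * |((j.2.1 - i.2.1 : ℤ) : ℝ)| := by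
    rw [one_mul, hu]; simp [coeffShift, framePt]
  have hu1 : |u 1| = |slope' g θ|⁻¹ / 2 * |((j.2.2 - i.2.2 : ℤ) : ℝ)| := by
    have : u 1 = (slope' g θ)⁻¹ / 2 * ((j.2.2 - i.2.2 : ℤ) : ℝ) := by
      rw [hu]; simp [coeffShift, framePt]; ring
    rw [this, abs_mul, abs_div, abs_inv, abs_two]
  have hη0 : |η 0| = Real.pi / 2 * |((i.2.2 + j.2.2 : ℤ) : ℝ)| := by
    have : η 0 = Real.pi / 2 * ((i.2.2 + j.2.2 : ℤ) : ℝ) := by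
      rw [hη]; simp [framePt]; ring
    rw [this, abs_mul, abs_of_pos (by positivity : 0 < Real.pi / 2)]
  have hη1 : |η 1| = Real.pi * |slope' g θ| * |((i.2.1 + j.2.1 : ℤ) : ℝ)| := by
    have : η 1 = -(Real.pi * slope' g θ * ((i.2.1 + j.2.1 : ℤ) : ℝ)) := by
      rw [hη]; simp [framePt]
    rw [this, abs_neg, abs_mul, abs_mul, abs_of_pos Real.pi_pos]
  rw [hu0, hu1] at h2
  rw [hη0, hη1] at h3
  refine (mul_le_mul (mul_le_mul_of_nonneg_left h2 hC0) h3 (by positivity)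
    (by positivity)).trans_eq ?_
  simp only [frameWeight]
  ring

end Coefficients

/-! ### The trace as an integral over the translates of the window -/

section Averaging

open scoped FourierTransform

/-- A function on `ℝ²` whose sums over the translates of `ℤ²` are constant. -/
lemma integral_eq_of_hasSum_translates {G : ℝ × ℝ → ℂ} (hG : Integrable G) {c : ℂ}
    (hc : ∀ x : ℝ × ℝ, HasSum (fun n : ℤ × ℤ => G (x + ((n.1 : ℝ), (n.2 : ℝ)))) c) :
    ∫ x, G x = c := by
  -- The fibres of the integer part tile the plane by translates of the unit square, so the integral
  -- folds onto one square of area one, where the integrand is the constant `c`.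
  let fl : ℝ × ℝ → ℤ × ℤ := fun x => (⌊x.1⌋, ⌊x.2⌋)
  have hfl : Measurable fl := (Int.measurable_floor.comp measurable_fst).prodMk
    (Int.measurable_floor.comp measurable_snd)
  have hs : ∀ n, MeasurableSet (fl ⁻¹' {n}) := fun n => hfl (measurableSet_singleton n)
  have hd : Pairwise (Function.onFun Disjoint fun n => fl ⁻¹' {n}) := fun a b hab =>
    Disjoint.preimage fl (by simpa using hab)
  have hu : ⋃ n, fl ⁻¹' {n} = Set.univ := by
    rw [← Set.preimage_iUnion, Set.iUnion_of_singleton, Set.preimage_univ]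
  have hpre : ∀ n : ℤ × ℤ, (fun x : ℝ × ℝ => x + ((n.1 : ℝ), (n.2 : ℝ))) ⁻¹' (fl ⁻¹' {n}) =
      fl ⁻¹' {0} := fun n => by
    ext x
    simp [fl, Prod.ext_iff]
  have htr : ∀ {E : Type} [NormedAddCommGroup E] [NormedSpace ℝ E] (F : ℝ × ℝ → E) (n : ℤ × ℤ),
      ∫ x in fl ⁻¹' {n}, F x = ∫ x in fl ⁻¹' {0}, F (x + ((n.1 : ℝ), (n.2 : ℝ))) := by
    intro E _ _ F n
    rw [← (measurePreserving_add_right volume ((n.1 : ℝ), (n.2 : ℝ))).setIntegral_preimage_emb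
      (measurableEmbedding_addRight _) F, hpre]
  have h1 := hasSum_integral_iUnion hs hd (f := G) hG.integrableOn
  have h2 := hasSum_integral_iUnion hs hd (f := fun x => ‖G x‖) hG.norm.integrableOn
  rw [hu, setIntegral_univ] at h1
  replace h1 := h1.of_eq (fun n => (htr G n).symm) rfl
  replace h2 := h2.of_eq (fun n => (htr (fun x => ‖G x‖) n).symm) rfl
  have h3 := hasSum_integral_of_summable_integral_norm (μ := volume.restrict (fl ⁻¹' {0}))
    (F := fun (n : ℤ × ℤ) x => G (x + ((n.1 : ℝ), (n.2 : ℝ))))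
    (fun n => (hG.comp_add_right ((n.1 : ℝ), (n.2 : ℝ))).restrict) h2.summable
  rw [h1.unique h3]
  simp only [(hc _).tsum_eq]
  have h4 : fl ⁻¹' {0} = Set.Ico (0 : ℝ) 1 ×ˢ Set.Ico (0 : ℝ) 1 := by
    ext x
    simp only [fl, Set.mem_preimage, Set.mem_singleton_iff, Prod.ext_iff, Prod.fst_zero,
      Prod.snd_zero, Int.floor_eq_zero_iff, Set.mem_prod]
  rw [setIntegral_const, h4, measureReal_def, Measure.volume_eq_prod, Measure.prod_prod]
  simp

/-- Integration in affine coordinates of the plane. -/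
lemma integral_comp_affine {Φ : Plane → ℂ} (hΦ : Integrable Φ) (ζ : Plane) {a b : ℝ} (ha : a ≠ 0)
    (hb : b ≠ 0) : Integrable (fun x : ℝ × ℝ => Φ (ζ + toPlane (a * x.2, b * x.1))) ∧
      ∫ x : ℝ × ℝ, Φ (ζ + toPlane (a * x.2, b * x.1)) = (|a * b|⁻¹ : ℝ) • ∫ y, Φ y := by
  let s : ℝ × ℝ → ℝ × ℝ := Prod.map (a * ·) (b * ·)
  have hs : MeasurableEmbedding s :=
    (measurableEmbedding_mulLeft₀ ha).prodMap (measurableEmbedding_mulLeft₀ hb)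
  have hmap : Measure.map s volume = ENNReal.ofReal (|a * b|⁻¹) • volume := by
    rw [Measure.volume_eq_prod, ← Measure.map_prod_map _ _ (by fun_prop) (by fun_prop),
      Real.map_volume_mul_left ha, Real.map_volume_mul_left hb, Measure.prod_smul_left,
      Measure.prod_smul_right, smul_smul, ← ENNReal.ofReal_mul (abs_nonneg _), ← abs_mul,
      ← mul_inv, abs_inv]
  let Φ' : ℝ × ℝ → ℂ := fun p => Φ (ζ + toPlane p)
  have h1 : Integrable Φ' ∧ ∫ p, Φ' p = ∫ y, Φ y := by
    refine ⟨measurePreserving_toPlane.integrable_comp_of_integrable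
      (g := fun y => Φ (ζ + y)) (hΦ.comp_add_left ζ), ?_⟩
    rw [← integral_add_left_eq_self Φ ζ]
    exact measurePreserving_toPlane.integral_comp measurableEmbedding_toPlane fun y => Φ (ζ + y)
  have h2 : Integrable fun x => Φ' (s x) := by
    rw [← Function.comp_def, ← hs.integrable_map_iff, hmap]
    exact h1.1.smul_measure ENNReal.ofReal_ne_top
  have h3 : ∫ x, Φ' (s x) = (|a * b|⁻¹ : ℝ) • ∫ y, Φ y := by
    rw [← hs.integral_map, hmap, integral_smul_measure, h1.2,
      ENNReal.toReal_ofReal (by positivity)]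
  exact ⟨h2.swap, (integral_prod_swap fun x => Φ' (s x)).trans h3⟩

/-- Fourier inversion. -/
lemma integral_exp_mul_integral_exp {M : Plane → ℂ} (hM : Integrable M) (hc : Continuous M)
    (hE : Integrable fun ζ : Plane => ∫ y, M y * Complex.exp ((inner ℝ y ζ : ℝ) * Complex.I))
    (u : Plane) : ∫ ζ : Plane, Complex.exp ((inner ℝ u ζ : ℝ) * Complex.I) *
        ∫ y, M y * Complex.exp ((inner ℝ y ζ : ℝ) * Complex.I) =
      ((2 * Real.pi) ^ 2 : ℝ) • M (-u) := by
  have hpi := Real.pi_pos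
  have h1 : ∀ x : Plane,
      ∫ y, M y * Complex.exp ((inner ℝ y ((2 * Real.pi) • x) : ℝ) * Complex.I) = 𝓕⁻ M x :=
    fun x => by
      rw [Real.fourierInv_eq']
      congr 1
      ext y
      rw [smul_eq_mul, mul_comm, inner_smul_right]
  have h2 : Integrable (𝓕 M) := by
    have h3 := (hE.comp_smul (R := 2 * Real.pi) (by positivity)).comp_neg
    refine h3.congr (Filter.Eventually.of_forall fun x => ?_)
    simp only [h1]
    rw [Real.fourierInv_eq_fourier_neg, neg_neg]
  have h3 := hM.fourier_fourierInv_eq h2 (v := -u) hc.continuousAt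
  have h4 := integral_comp_two_pi_smul fun ζ : Plane =>
    Complex.exp ((inner ℝ u ζ : ℝ) * Complex.I) *
      ∫ y, M y * Complex.exp ((inner ℝ y ζ : ℝ) * Complex.I)
  rw [eq_comm, inv_smul_eq_iff₀ (by positivity)] at h4
  rw [h4, ← h3, Real.fourier_eq']
  congr 2
  ext x
  rw [h1, smul_eq_mul]
  congr 3
  rw [inner_smul_right, inner_neg_right, real_inner_comm]
  ring_nf

end Averaging

section HeisenbergTrace

variable {g : GL (Fin 2) ℤ}

/-- The points of `G` over which the trace is averaged. -/
noncomputable def shiftPt (β : Zc g) (x : ℝ × ℝ) : GGroup g := ((x.1, β), (x.2 / 2, 0))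

variable (g) (θ : ℝ)

lemma coeffShift_self (a Z : GGroup g) : coeffShift g θ a a Z = coeffShift g θ 0 0 Z := by
  simp [coeffShift]

lemma coeffFreq_shiftPt (w : Plane) (β : Zc g) (x : ℝ × ℝ) (Z : GGroup g) :
    coeffFreq g θ w (shiftPt β x) (shiftPt β x) Z = coeffFreq g θ w 0 0 Z +
      toPlane (Real.pi * x.2, -(2 * Real.pi * slope' g θ) * x.1) := by
  ext i
  fin_cases i <;> simp [coeffFreq, shiftPt, toPlane] <;> ring

variable {g} [NeZero (g.1 1 0).natAbs]

lemma cocycle_neg_self_shiftPt (β : Zc g) (x : ℝ × ℝ) :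
    cocycle g (-shiftPt β x) (shiftPt β x) = 1 := by
  simp only [cocycle, shiftPt, Prod.fst_neg, Prod.snd_neg, cycPair_zero]
  rw [← e1_int 0]
  congr 1
  push_cast
  ring

lemma isParseval_heis_frame (x : GGroup g) : IsParseval fun z => heis g x (frame g z) := by
  refine (isParseval_frame g).map_isometry (heis g x)
    ((starRingEnd ℂ (cocycle g (-x) x) * cocycle g (-x) 0) • heis g (-x)) (fun u v => ?_)
    fun v => ?_
  · rw [← heis_zero v, inner_heis_heis, heis_zero, add_zero, smul_apply, inner_smul_right]
  · rw [smul_apply, norm_smul, norm_heis]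
    simp [norm_cocycle]

/-- Translating a frame vector moves its lattice point up to a phase, and the phase cancels in a
diagonal coefficient. -/
lemma inner_heis_frame (T : L2M g →L[ℂ] L2M g) (x : ℝ × ℝ) (z : Zc g × (ℤ × ℤ)) :
    inner ℂ (heis g (shiftPt 0 x) (frame g z)) (T (heis g (shiftPt 0 x) (frame g z))) =
      inner ℂ (heis g (shiftPt z.1 (x + ((z.2.1 : ℝ), (z.2.2 : ℝ)))) (phi0 g))
        (T (heis g (shiftPt z.1 (x + ((z.2.1 : ℝ), (z.2.2 : ℝ)))) (phi0 g))) := by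
  have h3 : shiftPt 0 x + framePt g z = shiftPt z.1 (x + ((z.2.1 : ℝ), (z.2.2 : ℝ))) := by
    simp only [shiftPt, framePt, Prod.mk_add_mk, zero_add, add_zero, Prod.fst_add, Prod.snd_add,
      add_div]
  have h4 : starRingEnd ℂ (cocycle g (shiftPt 0 x) (framePt g z)) *
      cocycle g (shiftPt 0 x) (framePt g z) = 1 := by
    rw [mul_comm, Complex.mul_conj, Complex.normSq_eq_norm_sq, norm_cocycle]
    simp
  rw [frame, heis_mul, h3, map_smul, inner_smul_left, inner_smul_right, ← mul_assoc, h4, one_mul]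

lemma HasSum.sum_fintype_prod {α β : Type*} [Fintype α] {G : α × β → ℂ} {c : ℂ}
    (h : HasSum G c) : HasSum (fun b => ∑ a, G (a, b)) c :=
  ((Equiv.prodComm β α).hasSum_iff.2 h).prod_fiberwise fun _ => hasSum_fintype _

/-- The averaged trace formula. -/
lemma opTrace_eq_integral {T : L2M g →L[ℂ] L2M g} (hT : IsTraceClass T)
    (hi : ∀ β, Integrable fun x : ℝ × ℝ =>
      inner ℂ (heis g (shiftPt β x) (phi0 g)) (T (heis g (shiftPt β x) (phi0 g)))) :
    opTrace T = ∑ β, ∫ x : ℝ × ℝ,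
      inner ℂ (heis g (shiftPt β x) (phi0 g)) (T (heis g (shiftPt β x) (phi0 g))) := by
  generalize hG : (fun (β : Zc g) (x : ℝ × ℝ) =>
    (inner ℂ (heis g (shiftPt β x) (phi0 g)) (T (heis g (shiftPt β x) (phi0 g))) : ℂ)) = G
  have hGe : ∀ β x, (inner ℂ (heis g (shiftPt β x) (phi0 g))
      (T (heis g (shiftPt β x) (phi0 g))) : ℂ) = G β x := fun β x => by rw [← hG]
  -- The family translated by any `x` is again Parseval and computes the same trace, so the lattice
  -- sums of `G` do not depend on `x`.
  have h1 : ∀ x : ℝ × ℝ, HasSum (fun z : Zc g × (ℤ × ℤ) =>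
      G z.1 (x + ((z.2.1 : ℝ), (z.2.2 : ℝ)))) (opTrace T) := fun x =>
    (hT.hasSum_opTrace (isParseval_heis_frame (shiftPt 0 x))).of_eq
      (fun z => by rw [inner_heis_frame, hGe]) rfl
  simp only [hGe] at hi ⊢
  rw [← integral_finsetSum _ fun β _ => hi β]
  exact (integral_eq_of_hasSum_translates (integrable_finsetSum _ fun β _ => hi β)
    fun x => (h1 x).sum_fintype_prod).symm

variable (g) {θ}

/-- On the diagonal the constant becomes an exponential in `x` of frequency `coeffShift`, through
the same displacement by which `coeffFreq_shiftPt` moves the frequency. This makes the integral over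
`x` a Fourier inversion. -/
lemma coeffConst_shiftPt (hμ : slope' g θ ≠ 0) (β : Zc g) (x : ℝ × ℝ) (Z : GGroup g) :
    coeffConst g (shiftPt β x) (shiftPt β x) Z =
      (if Z.1.2 = 0 then e1 (cycPair g (-β) Z.2.2) else 0) *
        Complex.exp ((inner ℝ (coeffShift g θ 0 0 Z)
          (toPlane (Real.pi * x.2, -(2 * Real.pi * slope' g θ) * x.1)) : ℝ) * Complex.I) := by
  have h0 : Z.1.2 + (shiftPt β x).1.2 = (shiftPt β x).1.2 ↔ Z.1.2 = 0 := by simp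
  rw [coeffConst, cocycle_add_right, cocycle_neg_self_shiftPt]
  simp only [h0]
  split_ifs with h
  · rw [map_one, one_mul, mul_one, mul_comm (e1 _)]
    simp only [cocycle, shiftPt, Prod.fst_neg, Prod.snd_neg, cycPair_zero, add_zero]
    rw [e1_add, ← mul_assoc, ← e1_add]
    congr 1
    rw [e1_eq_exp]
    congr 3
    simp only [inner_plane, coeffShift, toPlane_zero, toPlane_one, Prod.fst_zero, Prod.snd_zero]
    field_simp
    ring
  · simp

variable {g} {h : Plane → ℂ} {m : ℝ} {K : ℕ → ℝ}

/-- The trace of the operator of a coefficient of a symbol. -/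
lemma opTrace_heis_comp (hμ : slope' g θ ≠ 0) {w : Plane} (hh : DecayBound h m K)
    (hm : m < -2) {S : L2M g →L[ℂ] L2M g} (hS : ∀ v, S v = ∫ y, invFT h y • piW g θ w y v)
    (Z : GGroup g) (hT : IsTraceClass (heis g Z ∘L S)) :
    opTrace (heis g Z ∘L S) = (∑ β, if Z.1.2 = 0 then e1 (cycPair g (-β) Z.2.2) else 0) *
      ((|slope' g θ|⁻¹ : ℝ) • (Complex.exp (-(inner ℝ (coeffShift g θ 0 0 Z)
        (coeffFreq g θ w 0 0 Z) : ℝ) * Complex.I) * invFT h (-coeffShift g θ 0 0 Z))) := by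
  set u := coeffShift g θ 0 0 Z with hu
  set ζ₀ := coeffFreq g θ w 0 0 Z with hζ
  let M : Plane → ℂ := fun y => invFT h y * scaledAmb (slope' g θ) hμ (y + u)
  have hΨc := (scaledAmb (slope' g θ) hμ).continuous
  have hMc : Continuous M := (continuous_invFT (hh.integrable hm)).mul (by fun_prop)
  obtain ⟨B, hB0, hB⟩ := (scaledAmb (slope' g θ) hμ).exists_norm_iteratedFDeriv_le 0
  have hMi : Integrable M := (hh.integrable_invFT hm).mul_bdd (c := B)
    (by fun_prop) (Filter.Eventually.of_forall fun y => by
      simpa using hB 0 (by norm_num) (y + u))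
  let E : Plane → ℂ := fun ζ => ∫ y, M y * Complex.exp ((inner ℝ y ζ : ℝ) * Complex.I)
  have hEeq : ∀ ζ, E ζ = ∫ y, invFT h y * (Complex.exp ((inner ℝ y ζ : ℝ) * Complex.I) *
      scaledAmb (slope' g θ) hμ (y + u)) := fun ζ => by
    refine integral_congr_ae (Filter.Eventually.of_forall fun y => ?_)
    simp only [M]
    ring
  have hEc : Continuous E := by
    have h1 := continuous_fourierInv hMi
    have h2 : E = fun ζ => FourierTransformInv.fourierInv M ((2 * Real.pi)⁻¹ • ζ) := by
      ext ζ
      rw [Real.fourierInv_eq']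
      refine integral_congr_ae (Filter.Eventually.of_forall fun y => ?_)
      have hpi := Real.pi_pos
      have h3 : 2 * Real.pi * inner ℝ y ((2 * Real.pi)⁻¹ • ζ) = inner ℝ y ζ := by
        rw [inner_smul_right]
        field_simp
      change M y * _ = Complex.exp _ • M y
      rw [smul_eq_mul, h3, mul_comm]
    rw [h2]
    fun_prop
  have hEi : Integrable E := by
    obtain ⟨C, hC0, hC⟩ :=
      exists_norm_integral_invFT_mul_schwartz_le (scaledAmb (slope' g θ) hμ) hm
    refine ((integrable_decay hm).const_mul (boundSum K * (C * (1 + ‖u‖) ^ (-3 : ℝ)))).mono'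
      hEc.aestronglyMeasurable (Filter.Eventually.of_forall fun ζ => ?_)
    rw [hEeq, mul_assoc]
    exact hC h K hh ζ u
  let Φ : Plane → ℂ := fun ζ => Complex.exp ((inner ℝ u ζ : ℝ) * Complex.I) * E ζ
  have hΦ : Integrable Φ := hEi.bdd_mul (c := 1) (by fun_prop)
    (Filter.Eventually.of_forall fun ζ => (Complex.norm_exp_ofReal_mul_I _).le)
  -- Fourier inversion evaluates `M` at `-u`, where the ambiguity function is at the origin and
  -- equals `1 / 2`.
  have hΦ' : ∫ ζ, Φ ζ = ((2 * Real.pi) ^ 2 : ℝ) • (invFT h (-u) * (1 / 2)) := by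
    have h1 := integral_exp_mul_integral_exp hMi hMc hEi u
    have h2 : scaledAmb (slope' g θ) hμ 0 = 1 / 2 := by
      rw [scaledAmb_apply, ← amb_zero]
      congr 1
      ext i
      fin_cases i <;> simp [toPlane]
    rw [← h2, ← neg_add_cancel u]
    exact h1
  have hpi := Real.pi_pos
  have hb : -(2 * Real.pi * slope' g θ) ≠ 0 := neg_ne_zero.2 (by positivity)
  obtain ⟨hA, hA'⟩ := integral_comp_affine hΦ ζ₀ hpi.ne' hb
  have hG : ∀ (β : Zc g) (x : ℝ × ℝ), inner ℂ (heis g (shiftPt β x) (phi0 g))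
      ((heis g Z ∘L S) (heis g (shiftPt β x) (phi0 g))) =
      ((if Z.1.2 = 0 then e1 (cycPair g (-β) Z.2.2) else 0) *
        Complex.exp (-(inner ℝ u ζ₀ : ℝ) * Complex.I)) *
        Φ (ζ₀ + toPlane (Real.pi * x.2, -(2 * Real.pi * slope' g θ) * x.1)) := fun β x => by
    rw [ContinuousLinearMap.comp_apply, inner_heis_integral_piW hμ hh hm hS, coeffShift_self,
      ← hu, coeffFreq_shiftPt, ← hζ, ← hEeq, coeffConst_shiftPt g hμ, ← hu]
    simp only [Φ]
    rw [inner_add_right]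
    have : Complex.exp (((inner ℝ u (toPlane (Real.pi * x.2,
          -(2 * Real.pi * slope' g θ) * x.1)) : ℝ) : ℂ) * Complex.I) =
        Complex.exp (-(inner ℝ u ζ₀ : ℝ) * Complex.I) * Complex.exp (((inner ℝ u ζ₀ +
          inner ℝ u (toPlane (Real.pi * x.2, -(2 * Real.pi * slope' g θ) * x.1)) : ℝ) : ℂ) *
            Complex.I) := by
      rw [← Complex.exp_add]
      congr 1
      push_cast
      ring
    rw [this]
    ring
  rw [opTrace_eq_integral hT fun β => by simp only [hG]; exact hA.const_mul _]
  simp only [hG]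
  simp only [integral_const_mul]
  rw [← Finset.sum_mul, ← Finset.sum_mul, hA', hΦ', mul_assoc]
  congr 1
  -- The Jacobian of the affine change is `2π² |μ|`; against `(2π)²` it leaves `2 / |μ|`, and the
  -- `2` cancels the value `1 / 2` of the ambiguity function.
  have h5 : |Real.pi * -(2 * Real.pi * slope' g θ)|⁻¹ * (2 * Real.pi) ^ 2 =
      2 * |slope' g θ|⁻¹ := by
    have hμ' := abs_pos.2 hμ
    rw [abs_mul, abs_neg, abs_mul, abs_of_pos hpi, abs_of_pos (by positivity : 0 < 2 * Real.pi)]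
    field_simp
  rw [smul_smul, h5, Complex.real_smul, Complex.real_smul]
  push_cast
  ring

end HeisenbergTrace

/-! ### The trace formula for the Heisenberg representation -/

section Heisenberg

variable {g : GL (Fin 2) ℤ} {θ : ℝ}

lemma coeffShift_latticePt (hc : g.1 1 0 ≠ 0) (hrk : rk g θ ≠ 0) (l : ℤ × ℤ) :
    coeffShift g θ 0 0 (latticePt g θ l) =
      toPlane (-(l.2 : ℝ) / (g.1 1 0 : ℝ), (l.1 : ℝ) / (g.1 1 0 : ℝ)) := by
  have hc' : ((g.1 1 0 : ℤ) : ℝ) ≠ 0 := by exact_mod_cast hc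
  ext i
  fin_cases i
  · simp [coeffShift, latticePt, toPlane]
  · simp only [coeffShift, latticePt, slope', toPlane]
    simp
    field_simp

/-- A nonzero `l` has a nonzero integer coordinate, and the coordinates of the shift are those of
`l` divided by `c`, up to order and sign. -/
lemma inv_abs_le_norm_coeffShift (hc : g.1 1 0 ≠ 0) (hrk : rk g θ ≠ 0) {l : ℤ × ℤ} (hl : l ≠ 0) :
    |(g.1 1 0 : ℝ)|⁻¹ ≤ ‖coeffShift g θ 0 0 (latticePt g θ l)‖ := by
  rw [coeffShift_latticePt hc hrk]
  have h1 : ∀ n : ℤ, n ≠ 0 → |(g.1 1 0 : ℝ)|⁻¹ ≤ |(n : ℝ) / (g.1 1 0 : ℝ)| := fun n hn => by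
    rw [abs_div, div_eq_mul_inv]
    exact le_mul_of_one_le_left (by positivity) (by exact_mod_cast Int.one_le_abs hn)
  by_cases h : l.1 = 0
  · have h2 : l.2 ≠ 0 := fun h2 => hl (Prod.ext h h2)
    refine (h1 (-l.2) (neg_ne_zero.2 h2)).trans (le_trans (le_of_eq ?_) (abs_coord_le_norm _ 0))
    simp
  · exact (h1 l.1 h).trans (abs_coord_le_norm
      (toPlane (-(l.2 : ℝ) / (g.1 1 0 : ℝ), (l.1 : ℝ) / (g.1 1 0 : ℝ))) 1)

variable [NeZero (g.1 1 0).natAbs] {h : Plane → ℂ} {m : ℝ} {K : ℕ → ℝ}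

/-- The origin of `N(π_w)`: one factor `|μ|⁻¹` for each of the `|c|` components. -/
lemma card_mul_abs_slope_inv (hc : g.1 1 0 ≠ 0) :
    (Fintype.card (Zc g) : ℝ) * |slope' g θ|⁻¹ = |rk g θ| := by
  have hc' : |(g.1 1 0 : ℝ)| ≠ 0 := abs_ne_zero.2 (by exact_mod_cast hc)
  rw [ZMod.card, Nat.cast_natAbs, slope', abs_div, inv_div, Int.cast_abs]
  field_simp

lemma opTrace_heis_latticePt_zero (hc : g.1 1 0 ≠ 0) (hμ : slope' g θ ≠ 0) {w : Plane}
    (hh : DecayBound h m K) (hm : m < -2) {S : L2M g →L[ℂ] L2M g}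
    (hS : ∀ v, S v = ∫ y, invFT h y • piW g θ w y v)
    (hT : IsTraceClass (heis g (latticePt g θ 0) ∘L S)) :
    opTrace (heis g (latticePt g θ 0) ∘L S) = (|rk g θ| : ℝ) • invFT h 0 := by
  have h0 : latticePt g θ 0 = 0 := by simp [latticePt]
  have h1 : coeffShift g θ 0 0 0 = 0 := by
    ext i; fin_cases i <;> simp [coeffShift, toPlane]
  rw [opTrace_heis_comp hμ hh hm hS _ hT, h0, h1, ← card_mul_abs_slope_inv hc]
  have h2 : ∑ β : Zc g, (if (0 : GGroup g).1.2 = 0 then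
      e1 (cycPair g (-β) (0 : GGroup g).2.2) else 0) = ((Fintype.card (Zc g) : ℝ) : ℂ) := by
    simp [cycPair_zero, e1, -ZMod.card]
  rw [h2, inner_zero_left, neg_zero, Complex.ofReal_zero, neg_zero, zero_mul, Complex.exp_zero,
    one_mul, mul_smul, Complex.real_smul (x := (Fintype.card (Zc g) : ℝ))]

lemma norm_opTrace_heis_latticePt_le (hc : g.1 1 0 ≠ 0) (hμ : slope' g θ ≠ 0) (hrk : rk g θ ≠ 0)
    {w : Plane} (hh : DecayBound h m K) (hm : m < -2) {S : L2M g →L[ℂ] L2M g}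
    (hS : ∀ v, S v = ∫ y, invFT h y • piW g θ w y v) {l : ℤ × ℤ} (hl : l ≠ 0)
    (hT : IsTraceClass (heis g (latticePt g θ l) ∘L S)) (i : ℕ) :
    ‖opTrace (heis g (latticePt g θ l) ∘L S)‖ ≤
      |rk g θ| * (|(g.1 1 0 : ℝ)| ^ i * (K i * decayMass m)) := by
  set u := coeffShift g θ 0 0 (latticePt g θ l) with hu
  have hc' : 0 < |(g.1 1 0 : ℝ)| := abs_pos.2 (by exact_mod_cast hc)
  have h1 : ‖invFT h (-u)‖ ≤ |(g.1 1 0 : ℝ)| ^ i * (K i * decayMass m) := by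
    have h2 := hh.pow_mul_norm_invFT_le hm i (-u)
    have h3 : (|(g.1 1 0 : ℝ)|⁻¹) ^ i ≤ ‖-u‖ ^ i := by
      rw [norm_neg]
      exact pow_le_pow_left₀ (by positivity) (inv_abs_le_norm_coeffShift hc hrk hl) i
    have h4 := (mul_le_mul_of_nonneg_right h3 (norm_nonneg (invFT h (-u)))).trans h2
    rwa [inv_pow, inv_mul_le_iff₀ (by positivity)] at h4
  have h5 : ‖∑ β : Zc g, if (latticePt g θ l).1.2 = 0 then
      e1 (cycPair g (-β) (latticePt g θ l).2.2) else 0‖ ≤ Fintype.card (Zc g) := by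
    refine (norm_sum_le _ _).trans ((Finset.sum_le_sum (g := fun _ => (1 : ℝ)) fun β _ => ?_).trans
      (by simp))
    split_ifs <;> simp [norm_e1]
  rw [opTrace_heis_comp hμ hh hm hS _ hT, ← hu, norm_mul, norm_smul, norm_mul, norm_inv,
    Real.norm_eq_abs, abs_abs, ← Complex.ofReal_neg, Complex.norm_exp_ofReal_mul_I, one_mul,
    ← card_mul_abs_slope_inv (g := g) (θ := θ) hc, mul_assoc (Fintype.card _ : ℝ)]
  gcongr

/-- The term `l = 0` is the main term exactly; every other term evaluates an inverse transform at
distance at least `1/|c|` from the origin. Their bounds are summable in `l` through the seminorm of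
index `4`. -/
theorem heisenberg_trace (hc : g.1 1 0 ≠ 0) (hrk : rk g θ ≠ 0) {r : ℝ} (hr : 0 < r) {Γ : Set ℂ}
    (hm : m < -2) {f : Plane → ℂ → SmoothB} (hf : IsParamSymbol r m Γ f) (w : Plane) :
    ∃ T : ℂ → L2M g →L[ℂ] L2M g,
      (∀ lam ∈ Γ, IsOp (fun l => heis g (latticePt g θ l)) (piW g θ w) (fun ξ => f ξ lam) (T lam) ∧
        IsTraceClass (T lam)) ∧
      ∀ N : ℕ, (fun lam => opTrace (T lam) -
          (|rk g θ| : ℝ) • invFT (fun ξ => (f ξ lam).coeff 0) 0)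
        =O[Bornology.cobounded ℂ ⊓ Filter.principal Γ] fun lam => (‖lam‖ ^ N)⁻¹ := by
  obtain ⟨C, hC0, hC⟩ := hf.decayBound (by linarith)
  have hμ : slope' g θ ≠ 0 := div_ne_zero (by exact_mod_cast hc) hrk
  obtain ⟨D, hD⟩ := exists_norm_inner_frame_le hμ hm w
  have key : ∀ lam ∈ Γ, ∃ T : L2M g →L[ℂ] L2M g,
      (IsOp (fun l => heis g (latticePt g θ l)) (piW g θ w) (fun ξ => f ξ lam) T ∧
        IsTraceClass T) ∧
      ∀ i, ‖opTrace T - (|rk g θ| : ℝ) • invFT (fun ξ => (f ξ lam).coeff 0) 0‖ ≤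
        (∑' l : ℤ × ℤ, |rk g θ| * (|(g.1 1 0 : ℝ)| ^ i * (C 4 i * decayMass m)) *
          ((1 + ‖l‖) ^ 4)⁻¹) * ((1 + ‖lam‖ ^ (1 / r)) ^ i)⁻¹ := fun lam hlam => by
    let A : ℕ → ℝ := fun i => C 4 i * ((1 + ‖lam‖ ^ (1 / r)) ^ i)⁻¹
    have hA : ∀ l, DecayBound (fun ξ => (f ξ lam).coeff l) m fun i => A i * ((1 + ‖l‖) ^ 4)⁻¹ :=
      fun l => by
        have := hC lam hlam 4 l
        simpa only [A, mul_right_comm] using this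
    obtain ⟨T, S, hT, hTt, hS, hSt, htr⟩ := (isParseval_frame g).exists_isOp
      (P := fun l => heis g (latticePt g θ l)) (fun l v => (norm_heis g _ v).le)
      (U := piW g θ w) (fun y v => (norm_piW g θ w y v).le) (continuous_piW g θ hμ w) hm
      (h := fun ξ => f ξ lam) (A := A) (c := fun p => D * frameWeight g θ m p)
      ((summable_frameWeight hμ hm).mul_left D) hD hA
    refine ⟨T, ⟨hT, hTt⟩, fun i => ?_⟩
    have h0 := opTrace_heis_latticePt_zero hc hμ (hA 0) hm (hS 0) (hSt 0)
    have h1 : HasSum (fun l => opTrace (heis g (latticePt g θ l) ∘L S l) -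
        if l = 0 then opTrace (heis g (latticePt g θ 0) ∘L S 0) else 0)
        (opTrace T - opTrace (heis g (latticePt g θ 0) ∘L S 0)) :=
      htr.sub (hasSum_ite_eq 0 _)
    rw [← h0, ← h1.tsum_eq, ← tsum_mul_right]
    have hs := (summable_inv_one_add_norm_pow.mul_left
      (|rk g θ| * (|(g.1 1 0 : ℝ)| ^ i * (C 4 i * decayMass m)))).mul_right
      ((1 + ‖lam‖ ^ (1 / r)) ^ i)⁻¹
    refine tsum_of_norm_bounded hs.hasSum fun l => ?_
    by_cases hl : l = 0
    · have := hC0 4 i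
      have := decayMass_nonneg m
      subst hl
      simp only [if_true, sub_self, norm_zero]
      positivity
    · rw [if_neg hl, sub_zero]
      refine (norm_opTrace_heis_latticePt_le hc hμ hrk (hA l) hm (hS l) hl (hSt l) i).trans_eq ?_
      simp only [A]
      ring
  choose! T hT htr using key
  exact ⟨T, hT, fun N => isBigO_of_param_bound hr (fun i _ => ⟨_, fun lam hlam =>
    htr lam hlam i⟩) N⟩

end Heisenberg

/-! ### The two trace formulas together -/

lemma invFT_zero (h : Plane → ℂ) :
    invFT h 0 = (((2 * Real.pi) ^ 2)⁻¹ : ℝ) • ∫ ξ, h ξ := by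
  simp [invFT]

theorem mainTheorem8 (θ : ℝ) (hθ : Irrational θ) (g : GL (Fin 2) ℤ) (hc : g.1 1 0 ≠ 0)
    (r : ℝ) (hr : 0 < r) (Γ : Set ℂ) (hΓ : IsOpen Γ) (m : ℝ) (hm : m < -2)
    (f : Plane → ℂ → SmoothB) (hf : IsParamSymbol r m Γ f) :
    -- the function `φ^B(f(·, lam))` is integrable, with integral `φ^B(f^∨(0, lam))`
    (∀ lam ∈ Γ, Integrable (fun ξ => phiB (f ξ lam).coeff) ∧
      phiB (invFourierB (fun ξ => f ξ lam) 0) =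
        (((2 * Real.pi) ^ 2)⁻¹ : ℝ) • ∫ ξ, phiB (f ξ lam).coeff) ∧
    -- the Heisenberg representation
    (∀ w : Plane, ∃ T : ℂ → L2M g →L[ℂ] L2M g,
      (∀ lam ∈ Γ, IsOp (fun l => heis g (latticePt g θ l)) (piW g θ w) (fun ξ => f ξ lam) (T lam) ∧
        IsTraceClass (T lam)) ∧
      ∀ N : ℕ, (fun lam => opTrace (T lam) -
          (|rk g θ| : ℝ) • ((((2 * Real.pi) ^ 2)⁻¹ : ℝ) • ∫ ξ, phiB (f ξ lam).coeff))
        =O[Bornology.cobounded ℂ ⊓ Filter.principal Γ] fun lam => (‖lam‖ ^ N)⁻¹) ∧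
    -- the trivial bundle
    (∃ T : ℂ → EllTwo →L[ℂ] EllTwo,
      (∀ lam ∈ Γ, IsOp (leftReg g θ) (alphaT g θ) (fun ξ => f ξ lam) (T lam) ∧
        IsTraceClass (T lam)) ∧
      ∀ N : ℕ, (fun lam => opTrace (T lam) -
          (|rk g θ| ^ 2 : ℝ) • ((((2 * Real.pi) ^ 2)⁻¹ : ℝ) • ∫ ξ, phiB (f ξ lam).coeff))
        =O[Bornology.cobounded ℂ ⊓ Filter.principal Γ] fun lam => (‖lam‖ ^ N)⁻¹) := by
  have : NeZero (g.1 1 0).natAbs := ⟨Int.natAbs_ne_zero.2 hc⟩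
  have hrk : rk g θ ≠ 0 :=
    ((hθ.intCast_mul hc).add_intCast (g.1 1 1)).ne_zero
  refine ⟨fun lam hlam => ?_, fun w => ?_, trivial_bundle_trace hrk hr hm hf⟩
  · obtain ⟨C, _, hC⟩ := hf.decayBound (by linarith)
    exact ⟨(hC lam hlam 0 0).integrable hm, invFT_zero fun ξ => (f ξ lam).coeff 0⟩
  · simpa only [invFT_zero] using! heisenberg_trace hc hrk hr hm hf w
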